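/- Let $(W,P)$ be one of the classical Hermitian symmetric pairs $(A_n,A_{k-1}\times A_{n-k})$ with $1\le k\le n$, $(C_n,A_{n-1})$ with $n\ge 2$, or $(D_n,A_{n-1})$ with $n\ge 2$, and put $N=n+1,\ n+1,\ n$ respectively. **Cosets.** The simple reflections act on the right on sequences of $N$ symbols from $\{\wedge,\vee,\circ\}$: $s_i$ swaps the symbols in positions $i,i+1$ (for $1\le i\le n$ in type $A$, $2\le i\le n$ in type $C$, $1\le i\le n-1$ in type $D$); in type $C$, $s_{1'}$ flips ($\wedge\leftrightarrow\vee$) the second symbol; in type $D$, $s_{1''}$ swaps and flips the first two symbols. The set ${}^PW$ of minimal coset representatives for $P\backslash W$ is identified with the orbit of $\varnothing=\wedge^k\vee^{n-k+1}$, $\circ\vee^n$, $\vee^n$ respectively, and carries the strong Bruhat order. **Diagrams.** A loop-free decorated $N$-tangle $d$ is a non-crossing pairing, by strands inside a rectangle, of $N$ northern and $N$ southern vertices, in which some of the strands that can be deformed to touch the left edge carry one bead. Allowed are: in type $A$, tangles without beads; in type $C$, tangles in which the first northern and first southern vertices are joined by an undecorated strand, or are joined by a decorated strand and there are a northern and a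 southern arc, or lie on two distinct strands, both decorated; in type $D$, tangles with an even number of beads. An *oriented Temperley–Lieb diagram* $\lambda d\mu$ of type $(W,P)$ is such a $d$ with $\lambda\in{}^PW$ on the northern and $\mu\in{}^PW$ on the southern boundary such that every undecorated strand is oriented (one arrow points into the strand, the other out of it); in type $D$ every decorated strand is flip-oriented (both arrows point in or both point out); and in type $C$ no strand joining $\circ$ to $\circ$ is decorated. A strand with an end point $\circ$ counts as both oriented and flip-oriented. **Algebra.** These diagrams are a basis of the $\mathbb Z[q,q^{-1}]$-algebra $\mathrm{TL}^{\wedge\vee}_{(W,P)}(q)$, with $(\lambda d\mu)(\lambda'd'\mu')=0$ if $\mu\ne\lambda'$, and otherwise given by vertical concatenation, where each closed loop is replaced by $q$ (respectively $q^{-1}$) if its rightmost vertex is $\vee$ (respectively $\wedge$); in type $C$ two beads on a strand equal one bead and a bead on a strand joining $\circ$ to $\circ$ is removed; in type $D$ two beads on a strand cancel. Let $e_i$ ($i\ge1$) be the tangle with arcs joining the vertices $i,i+1$ on both boundaries and vertical strands elsewhere, let $e_{1'}=e_{1''}$ be the same tangle for the vertices $1,2$ with both arcs decorated, and let $1_\lambda=\lambda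 1\lambda$, where $1$ is the tangle consisting of $N$ undecorated vertical strands. **Degree.** Put $\deg q^{\pm1}=\pm1$ and $\deg 1_\lambda=0$ and, whenever $\lambda$ and $\lambda s_i$ are distinct elements of ${}^PW$, $\deg(\lambda e_i\,\lambda s_i)=0$, $\deg(\lambda e_i\lambda)=1$ if $\lambda s_i>\lambda$ and $\deg(\lambda e_i\lambda)=-1$ if $\lambda s_i<\lambda$. An element of the algebra has degree $m$ if it is a $\mathbb Z$-linear combination of products of these elements, each of total degree $m$. **Theorem.** Give a northern arc whose rightmost vertex is labelled $\vee$ the degree $+1$, a southern arc whose rightmost vertex is labelled $\wedge$ the degree $-1$, and every other strand (in particular every propagating strand) the degree $0$. Let $m\in\mathbb Z$. An oriented Temperley–Lieb diagram $\lambda d\mu$ has degree $m$ if and only if $m$ is the sum of the degrees of its strands. Likewise, in every $\mathbb Z$-grading of the ring $\mathrm{TL}^{\wedge\vee}_{(W,P)}(q)$ in which $q\cdot 1$, $q^{-1}\cdot 1$, the $1_\lambda$ and the generators $\lambda e_i\mu$ are homogeneous of the degrees above, $\lambda d\mu$ is homogeneous of degree $m$ if and only if $m$ is the sum of the degrees of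 its strands. -/

import Mathlib

namespace OrientedTL

open LaurentPolynomial

/-- The classical Hermitian symmetric pairs: `A n k` is `(A_n, A_{k-1} × A_{n-k})`,
`C n` is `(C_n, A_{n-1})` and `D n` is `(D_n, A_{n-1})`. -/
inductive HermitianPair
  | A (n k : ℕ)
  | C (n : ℕ)
  | D (n : ℕ)

/-- The admissible ranks. -/
def HermitianPair.Valid : HermitianPair → Prop
  | .A n k => 1 ≤ k ∧ k ≤ n
  | .C n => 2 ≤ n
  | .D n => 2 ≤ n

/-- Number of points on the horizontal line of a coset diagram.  The points are numbered from `0`,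
so the `j`-th point (`j = 1, 2, …`) is the element of `Fin` with value `j - 1`. -/
def HermitianPair.size : HermitianPair → ℕ
  | .A n _ => n + 1
  | .C n => n + 1
  | .D n => n

/-- The symbols `∧` (`up`), `∨` (`down`), `∘` (`circ`). -/
inductive Label
  | up
  | down
  | circ
  deriving DecidableEq

instance : Fintype Label := ⟨{.up, .down, .circ}, fun a => by cases a <;> simp⟩

/-- Flip through the horizontal axis. -/
def Label.flip : Label → Label
  | .up => .down
  | .down => .up
  | .circ => .circ

/-! ### Coset diagrams and the Bruhat order -/

/-- `s i` exchanges the points with values `i` and `i + 1`; `special` is `s_{1'}` in type `C` and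
`s_{1''}` in type `D`. -/
inductive Refl (N : ℕ)
  | s (i : ℕ) (h : i + 1 < N)
  | special (h : 1 < N)

/-- The simple reflections of `W`. -/
def IsSimple : (X : HermitianPair) → Refl X.size → Prop
  | .A _ _, .s _ _ => True
  | .A _ _, .special _ => False
  | .C _, .s i _ => 1 ≤ i
  | .C _, .special _ => True
  | .D _, .s _ _ => True
  | .D _, .special _ => True

/-- Right action of the simple reflections on labelled lines (the value of the non-simple
`special` in type `A` plays no role). -/
def act : (X : HermitianPair) → Refl X.size → (Fin X.size → Label) → (Fin X.size → Label)
  | _, .s i h, w => fun j => w (Equiv.swap ⟨i, Nat.lt_of_succ_lt h⟩ ⟨i + 1, h⟩ j)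
  | .A _ _, .special _, w => w
  | .C _, .special _, w => fun j => if j.val = 1 then (w j).flip else w j
  | .D _, .special h, w => fun j =>
      if j.val = 0 then (w ⟨1, h⟩).flip
      else if j.val = 1 then (w ⟨0, Nat.lt_of_succ_lt h⟩).flip
      else w j

/-- The diagram `∅` of the identity coset. -/
def emptyDiagram : (X : HermitianPair) → Fin X.size → Label
  | .A _ k => fun j => if j.val < k then .up else .down
  | .C _ => fun j => if j.val = 0 then .circ else .down
  | .D _ => fun _ => .down

/-- `l` is an expression in the simple reflections for the coset with diagram `w`. -/
def IsExpr (X : HermitianPair) (l : List (Refl X.size)) (w : Fin X.size → Label) : Prop :=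
  (∀ r ∈ l, IsSimple X r) ∧ l.foldl (fun v r => act X r v) (emptyDiagram X) = w

/-- `^P W`, identified with the set of coset diagrams, i.e. the orbit of `∅`. -/
def PW (X : HermitianPair) : Type :=
  {w : Fin X.size → Label // ∃ l, IsExpr X l w}

instance (X : HermitianPair) : Finite (PW X) :=
  inferInstanceAs (Finite {w : Fin X.size → Label // ∃ l, IsExpr X l w})

noncomputable instance (X : HermitianPair) : Fintype (PW X) := Fintype.ofFinite _

/-- A reduced expression of the minimal coset representative, i.e. a shortest expression for
the coset. -/
def IsReducedExpr (X : HermitianPair) (l : List (Refl X.size)) (w : PW X) : Prop :=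
  IsExpr X l w.1 ∧ ∀ l', IsExpr X l' w.1 → l.length ≤ l'.length

/-- Strong Bruhat order on `^P W`: some reduced expression of `w` has a subword which is a
reduced expression of `y`. -/
def BruhatLE (X : HermitianPair) (y w : PW X) : Prop :=
  ∃ l l', IsReducedExpr X l w ∧ IsReducedExpr X l' y ∧ l'.Sublist l

def BruhatLT (X : HermitianPair) (y w : PW X) : Prop := BruhatLE X y w ∧ y ≠ w

/-- The coset `λ s`. -/
def PW.mulRefl {X : HermitianPair} (w : PW X) (r : Refl X.size) (hr : IsSimple X r) : PW X :=
  ⟨act X r w.1, by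
    obtain ⟨l, hl, hw⟩ := w.2
    refine ⟨l ++ [r], ?_, ?_⟩
    · intro r' hr'
      rcases List.mem_append.1 hr' with h | h
      · exact hl r' h
      · rw [List.mem_singleton.1 h]; exact hr
    · rw [List.foldl_append, hw]; rfl⟩

/-! ### Decorated tangles -/

/-- The boundary vertices of a tangle: `Sum.inl i` is the `i`-th northern vertex and `Sum.inr i`
the `i`-th southern vertex. -/
abbrev Vertex (N : ℕ) : Type := Fin N ⊕ Fin N

/-- Position of a vertex when the boundary of the frame is traversed clockwise, starting and
ending on the left edge. -/
def pos {N : ℕ} : Vertex N → ℕ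
  | .inl i => i.val
  | .inr i => 2 * N - 1 - i.val

/-- Combinatorial data of a loop-free tangle with at most one bead on each strand: `mate` sends a
vertex to the other end of its strand, `beaded` is the set of end points of decorated strands. -/
structure RawTangle (N : ℕ) where
  mate : Vertex N → Vertex N
  beaded : Set (Vertex N)

namespace RawTangle

variable {N : ℕ}

/-- The vertices are paired off by non-crossing strands. -/
def IsTangle (t : RawTangle N) : Prop :=
  (∀ v, t.mate (t.mate v) = v ∧ t.mate v ≠ v) ∧
  ∀ a b, ¬ (pos a < pos b ∧ pos b < pos (t.mate a) ∧ pos (t.mate a) < pos (t.mate b))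

/-- The strand at `v` can be deformed to touch the left edge of the frame: no other strand
separates it from that edge. -/
def LeftExposed (t : RawTangle N) (v : Vertex N) : Prop :=
  ¬ ∃ c, pos c < pos v ∧ pos c < pos (t.mate v) ∧
    pos v < pos (t.mate c) ∧ pos (t.mate v) < pos (t.mate c)

/-- A loop-free decorated tangle with at most one bead on each strand. -/
def IsDecorated (t : RawTangle N) : Prop :=
  t.IsTangle ∧ (∀ v ∈ t.beaded, t.mate v ∈ t.beaded) ∧ ∀ v ∈ t.beaded, t.LeftExposed v

/-- The set of strands, each represented by its first end point. -/
def strands (t : RawTangle N) : Set (Vertex N) := {v | pos v < pos (t.mate v)}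

def HasNorthernArc (t : RawTangle N) : Prop := ∃ i j, t.mate (.inl i) = .inl j

def HasSouthernArc (t : RawTangle N) : Prop := ∃ i j, t.mate (.inr i) = .inr j

/-- The tangle `e_r`: arcs between the vertices `i, i + 1` on both sides and vertical strands
elsewhere; for the special generator the arcs are at the first two vertices and carry a bead. -/
def e : Refl N → RawTangle N
  | .s i h =>
    { mate := fun v => match v with
        | .inl j => if j.val = i then .inl ⟨i + 1, h⟩
            else if j.val = i + 1 then .inl ⟨i, Nat.lt_of_succ_lt h⟩ else .inr j
        | .inr j => if j.val = i then .inr ⟨i + 1, h⟩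
            else if j.val = i + 1 then .inr ⟨i, Nat.lt_of_succ_lt h⟩ else .inl j
      beaded := ∅ }
  | .special h =>
    { mate := fun v => match v with
        | .inl j => if j.val = 0 then .inl ⟨1, h⟩
            else if j.val = 1 then .inl ⟨0, Nat.lt_of_succ_lt h⟩ else .inr j
        | .inr j => if j.val = 0 then .inr ⟨1, h⟩
            else if j.val = 1 then .inr ⟨0, Nat.lt_of_succ_lt h⟩ else .inl j
      beaded := {v | match v with
        | .inl j => j.val ≤ 1
        | .inr j => j.val ≤ 1} }

/-- The identity tangle. -/
def one (N : ℕ) : RawTangle N := ⟨Sum.swap, ∅⟩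

end RawTangle

/-- The loop-free elements of the set `𝔻𝕋[W]` of basis tangles of the generalised
Temperley--Lieb algebra of `W`. -/
def IsBasisTangle : (X : HermitianPair) → RawTangle X.size → Prop
  | .A _ _, t => t.IsDecorated ∧ t.beaded = ∅
  | .C n, t => t.IsDecorated ∧
      let first : Fin (n + 1) := 0
      ((t.mate (.inl first) = .inr first ∧ .inl first ∉ t.beaded) ∨
       (t.mate (.inl first) = .inr first ∧ .inl first ∈ t.beaded ∧
         t.HasNorthernArc ∧ t.HasSouthernArc) ∨
       (t.mate (.inl first) ≠ .inr first ∧ .inl first ∈ t.beaded ∧ .inr first ∈ t.beaded))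
  | .D _, t => t.IsDecorated ∧ Even (t.beaded ∩ t.strands).ncard

/-! ### Oriented tangles -/

/-- The symbol at a vertex, when `north` and `south` are placed on the two boundaries. -/
def label {N : ℕ} (north south : Fin N → Label) : Vertex N → Label := Sum.elim north south

/-- The arrow at the vertex `v` points into the strand at `v`. -/
def PointsIn {N : ℕ} : Vertex N → Label → Prop
  | .inl _, a => a = .down
  | .inr _, a => a = .up

/-- The arrow at the vertex `v` points out of the strand at `v`. -/
def PointsOut {N : ℕ} : Vertex N → Label → Prop
  | .inl _, a => a = .up
  | .inr _, a => a = .down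

/-- A strand with end points `v, v'` labelled by `a, a'` is oriented; a strand with an
end point `∘` always is. -/
def Oriented {N : ℕ} (v v' : Vertex N) (a a' : Label) : Prop :=
  (PointsIn v a ∧ PointsOut v' a') ∨ (PointsOut v a ∧ PointsIn v' a') ∨ a = .circ ∨ a' = .circ

/-- A strand with end points `v, v'` labelled by `a, a'` is flip-oriented; a strand with an
end point `∘` always is. -/
def FlipOriented {N : ℕ} (v v' : Vertex N) (a a' : Label) : Prop :=
  (PointsIn v a ∧ PointsIn v' a') ∨ (PointsOut v a ∧ PointsOut v' a') ∨ a = .circ ∨ a' = .circ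

/-- The type-dependent conditions on the decorated strands of an oriented tangle. -/
def DecorationCondition :
    (X : HermitianPair) → RawTangle X.size → (Vertex X.size → Label) → Prop
  | .A _ _, _, _ => True
  | .C _, t, a => ∀ v ∈ t.beaded, ¬ (a v = .circ ∧ a (t.mate v) = .circ)
  | .D _, t, a => ∀ v ∈ t.beaded, FlipOriented v (t.mate v) (a v) (a (t.mate v))

/-- `λ d μ` is an oriented tangle of type `(W, P)`. -/
def IsOriented (X : HermitianPair) (north : PW X) (t : RawTangle X.size) (south : PW X) : Prop :=
  IsBasisTangle X t ∧
  (∀ v ∉ t.beaded, Oriented v (t.mate v)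
    (label north.1 south.1 v) (label north.1 south.1 (t.mate v))) ∧
  DecorationCondition X t (label north.1 south.1)

/-- The set `𝕆𝔻𝕋[W, P]` of oriented Temperley--Lieb diagrams of type `(W, P)`. -/
structure ODT (X : HermitianPair) where
  north : PW X
  tangle : RawTangle X.size
  south : PW X
  isOriented : IsOriented X north tangle south

/-! ### The oriented Temperley--Lieb algebra -/

section Concatenation

variable {N : ℕ}

/-- Vertices of two stacked tangles: level `0` is the top line, `1` the middle line (where the
tangles are glued) and `2` the bottom line. -/
abbrev StackVertex (N : ℕ) : Type := Fin 3 × Fin N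

def upper : Vertex N → StackVertex N
  | .inl i => (0, i)
  | .inr i => (1, i)

def lower : Vertex N → StackVertex N
  | .inl i => (1, i)
  | .inr i => (2, i)

def outer : Vertex N → StackVertex N
  | .inl i => (0, i)
  | .inr i => (2, i)

/-- Two vertices are joined in the tangle obtained by stacking `t` above `t'`. -/
def Joined (t t' : RawTangle N) : StackVertex N → StackVertex N → Prop :=
  Relation.EqvGen fun x y =>
    (∃ v, x = upper v ∧ y = upper (t.mate v)) ∨ (∃ v, x = lower v ∧ y = lower (t'.mate v))

open Classical in
/-- The other end of the strand at `u` after stacking. -/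
noncomputable def concatMate (t t' : RawTangle N) (u : Vertex N) : Vertex N :=
  if h : ∃ v, v ≠ u ∧ Joined t t' (outer u) (outer v) then h.choose else u

/-- Number of beads on the strand at `u` after stacking. -/
noncomputable def beadCount (t t' : RawTangle N) (u : Vertex N) : ℕ :=
  {v ∈ t.beaded ∩ t.strands | Joined t t' (outer u) (upper v)}.ncard +
  {v ∈ t'.beaded ∩ t'.strands | Joined t t' (outer u) (lower v)}.ncard

/-- The middle vertex `j` is the rightmost vertex of a closed loop. -/
def IsLoopEnd (t t' : RawTangle N) (j : Fin N) : Prop :=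
  (∀ u, ¬ Joined t t' (1, j) (outer u)) ∧ ∀ i, Joined t t' (1, j) (1, i) → i ≤ j

/-- A closed loop is replaced by `q` or `q⁻¹` if its rightmost vertex is `∨` or `∧`. -/
def loopExponent : Label → ℤ
  | .down => 1
  | .up => -1
  | .circ => 0

open Classical in
/-- The exponent of the power of `q` which replaces all closed loops. -/
noncomputable def totalLoopExponent (t t' : RawTangle N) (middle : Fin N → Label) : ℤ :=
  ∑ j : Fin N, if IsLoopEnd t t' j then loopExponent (middle j) else 0

end Concatenation

/-- Which strands carry a bead after the bead relations: in type `C` two beads on a strand are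
equal to one and a bead on a strand from `∘` to `∘` is removed; in type `D` two beads on a strand
cancel. -/
def concatBeaded : (X : HermitianPair) → RawTangle X.size → RawTangle X.size →
    (Vertex X.size → Label) → Set (Vertex X.size)
  | .A _ _, _, _, _ => ∅
  | .C _, t, t', a =>
      {u | 0 < beadCount t t' u ∧ ¬ (a u = .circ ∧ a (concatMate t t' u) = .circ)}
  | .D _, t, t', _ => {u | Odd (beadCount t t' u)}

/-- The tangle of the vertical concatenation of `D` (above) and `D'` (below). -/
noncomputable def concat {X : HermitianPair} (D D' : ODT X) : RawTangle X.size where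
  mate := concatMate D.tangle D'.tangle
  beaded := concatBeaded X D.tangle D'.tangle (label D.north.1 D'.south.1)

/-- The free `ℤ[q, q⁻¹]`-module on the oriented Temperley--Lieb diagrams; `q` is `T 1`. -/
def TL (X : HermitianPair) : Type := ODT X →₀ ℤ[T;T⁻¹]

noncomputable instance (X : HermitianPair) : AddCommGroup (TL X) :=
  inferInstanceAs (AddCommGroup (ODT X →₀ ℤ[T;T⁻¹]))

noncomputable instance (X : HermitianPair) : Module ℤ[T;T⁻¹] (TL X) :=
  inferInstanceAs (Module ℤ[T;T⁻¹] (ODT X →₀ ℤ[T;T⁻¹]))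

/-- An oriented Temperley--Lieb diagram as a basis element. -/
noncomputable def ODT.toTL {X : HermitianPair} (D : ODT X) : TL X := Finsupp.single D 1

open Classical in
/-- The element `λ d μ`, which is zero if it is not an oriented tangle of type `(W, P)`. -/
noncomputable def elt {X : HermitianPair} (north : PW X) (t : RawTangle X.size) (south : PW X) :
    TL X :=
  if h : IsOriented X north t south then (⟨north, t, south, h⟩ : ODT X).toTL else 0

open Classical in
/-- The product of two diagrams. -/
noncomputable def mulBasis {X : HermitianPair} (D D' : ODT X) : TL X :=
  if D.south = D'.north then
    (T (totalLoopExponent D.tangle D'.tangle D.south.1) : ℤ[T;T⁻¹]) •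
      elt D.north (concat D D') D'.south
  else 0

noncomputable instance (X : HermitianPair) : Mul (TL X) where
  mul x y := Finsupp.sum x fun D a => Finsupp.sum y fun D' b => (a * b) • mulBasis D D'

/-- `1 = ∑ 1_λ`, where `1_λ = λ 1 λ`. -/
noncomputable instance (X : HermitianPair) : One (TL X) where
  one := ∑ w : PW X, elt w (RawTangle.one X.size) w

/-! ### The degree -/

/-- `λ → μ` is an edge of colour `r` of the extended Bruhat graph. -/
def IsEdge {X : HermitianPair} (r : Refl X.size) (hr : IsSimple X r) (w v : PW X) : Prop :=
  (BruhatLT X w (w.mulRefl r hr) ∨ BruhatLT X (w.mulRefl r hr) w) ∧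
  (v = w ∨ v = w.mulRefl r hr)

open Classical in
/-- The degree of an edge of colour `r` from `w` to `v`, and of the generator `w e_r v`. -/
noncomputable def edgeDegree {X : HermitianPair} (r : Refl X.size) (hr : IsSimple X r)
    (w v : PW X) : ℤ :=
  if v = w then (if BruhatLT X w (w.mulRefl r hr) then 1 else -1) else 0

/-- Paths (Bruhat strolls) in the extended Bruhat graph. -/
inductive Stroll (X : HermitianPair) : PW X → PW X → Type
  | nil (w : PW X) : Stroll X w w
  | snoc {u w v : PW X} (S : Stroll X u w) (r : Refl X.size) (hr : IsSimple X r)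
      (he : IsEdge r hr w v) : Stroll X u v

/-- The degree of a path is the sum of the degrees of its edges. -/
noncomputable def Stroll.deg {X : HermitianPair} : {u v : PW X} → Stroll X u v → ℤ
  | _, _, .nil _ => 0
  | _, v, .snoc (w := w) S r hr _ => S.deg + edgeDegree r hr w v

/-- The product of generators
`e_S = 1_{λ₁} (λ₁ e_{i₁} λ₂) (λ₂ e_{i₂} λ₃) ⋯ (λ_{k-1} e_{i_{k-1}} λ_k)`. -/
noncomputable def Stroll.elt {X : HermitianPair} : {u v : PW X} → Stroll X u v → TL X
  | _, _, .nil w => OrientedTL.elt w (RawTangle.one X.size) w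
  | _, v, .snoc (w := w) S r _ _ => S.elt * OrientedTL.elt w (RawTangle.e r) v

/-- The elements of degree `n`: the additive group spanned by all `q ^ m e_S` with
`m + deg S = n`, i.e. by the products of total degree `n` of powers of `q` and generators. -/
noncomputable def homogeneous (X : HermitianPair) (n : ℤ) : AddSubgroup (TL X) :=
  AddSubgroup.closure
    {x | ∃ (u v : PW X) (S : Stroll X u v) (m : ℤ),
      m + S.deg = n ∧ x = (T m : ℤ[T;T⁻¹]) • S.elt}

/-- `𝒜` is a `ℤ`-grading of the `ℤ`-algebra `TL X` in which `q`, `q⁻¹`, the idempotents `1_λ` and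
the generators `λ e_i μ` have their prescribed degrees. -/
structure IsDegreeGrading (X : HermitianPair) (𝒜 : ℤ → AddSubgroup (TL X)) : Prop where
  isInternal : DirectSum.IsInternal 𝒜
  mul_mem : ∀ {m n : ℤ} {x y : TL X}, x ∈ 𝒜 m → y ∈ 𝒜 n → x * y ∈ 𝒜 (m + n)
  q_mem : (T 1 : ℤ[T;T⁻¹]) • (1 : TL X) ∈ 𝒜 1
  q_inv_mem : (T (-1) : ℤ[T;T⁻¹]) • (1 : TL X) ∈ 𝒜 (-1)
  idempotent_mem : ∀ w : PW X, elt w (RawTangle.one X.size) w ∈ 𝒜 0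
  generator_mem : ∀ (r : Refl X.size) (hr : IsSimple X r) (w v : PW X), IsEdge r hr w v →
    elt w (RawTangle.e r) v ∈ 𝒜 (edgeDegree r hr w v)

/-- The degree of a strand with given end points, in a diagram with boundary labels `north` and
`south`: `+1` for a northern arc whose rightmost vertex is `∨`, `-1` for a southern arc whose
rightmost vertex is `∧`, and `0` for all other strands. -/
def strandDegree {N : ℕ} (north south : Fin N → Label) : Vertex N → Vertex N → ℤ
  | .inl i, .inl j => if north (max i j) = .down then 1 else 0
  | .inr i, .inr j => if south (max i j) = .up then -1 else 0
  | _, _ => 0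

open Classical in
/-- The sum of the degrees of all strands. -/
noncomputable def ODT.strandDegreeSum {X : HermitianPair} (D : ODT X) : ℤ :=
  ∑ v : Vertex X.size,
    if v ∈ D.tangle.strands then strandDegree D.north.1 D.south.1 v (D.tangle.mate v) else 0

end OrientedTL

namespace OrientedTL

open LaurentPolynomial

/-! ### Simple reflections and labels -/

/-! The proof compares the degree defined by generators with the exponent of `q` plus the sum of the
strand degrees, in two directions.

Upper bound: the strand degree is additive. When a diagram is multiplied on the right by a generator
`μ e_r ν`, only the strands ending at the two southern points of `r` change, and planarity together
with the orientations determines how their degrees change (`strandDegree_mate_mate`). The exponent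
of `q` from a closed loop makes up for the degree of the southern arc that disappears. In all cases
the exponent plus the strand degree grows by the degree of the generator (`strandDegreeSum_concat`).
Hence every product of generators is zero or `q ^ k D` with the expected total
(`Stroll.elt_eq_zero_or`), and a diagram of degree `n` must have strand degree `n`. This uses that
the degree of a generator, defined through the Bruhat order, can be read off from labels: a weighted
count of the symbols `∧` equals the length up to a constant, so the symbol at the second point of
`r` decides whether `r` goes up (`edgeDegree_eq`).

Existence: every diagram is a product of generators, without a power of `q` (`ODT.exists_stroll`).
If there is no southern arc, the diagram is some `1_λ`. Otherwise take the leftmost southern arc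
between neighbouring points. Its reflection `r` is special exactly when the arc is decorated. Cut
the arc together with a strand reaching the region above it, and reconnect the four ends the other
way. Stacking the result on `e_r` restores the diagram; the new southern labels can be chosen so
that the cut diagram is oriented; and the number of crossings with vertical lines drops
(`CutData.isOriented_cut`, `CutData.concat_cut`, `CutData.weight_cut_lt`). Induction on this number
finishes the argument.

Both claims follow. In an arbitrary grading with the prescribed degrees, a product of generators
lies in the component of its total degree, and a nonzero element lies in at most one component. -/

/-- The first of the two points moved by a reflection. -/
def Refl.lo {N : ℕ} : Refl N → Fin N
  | .s i h => ⟨i, Nat.lt_of_succ_lt h⟩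
  | .special h => ⟨0, Nat.lt_of_succ_lt h⟩

/-- The second of the two points moved by a reflection. -/
def Refl.hi {N : ℕ} : Refl N → Fin N
  | .s i h => ⟨i + 1, h⟩
  | .special h => ⟨1, h⟩

/-- Whether a reflection is the special one. -/
def Refl.IsSpecial {N : ℕ} : Refl N → Prop
  | .s _ _ => False
  | .special _ => True

theorem Refl.hi_val {N : ℕ} (r : Refl N) : r.hi.val = r.lo.val + 1 := by
  cases r <;> rfl

theorem Refl.lo_ne_hi {N : ℕ} (r : Refl N) : r.lo ≠ r.hi := by
  intro h
  have := r.hi_val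
  rw [← h] at this
  omega

theorem act_of_ne {X : HermitianPair} (r : Refl X.size) (w : Fin X.size → Label) (j : Fin X.size)
    (hl : j ≠ r.lo) (hh : j ≠ r.hi) : act X r w j = w j := by
  rcases r with ⟨i, h⟩ | h
  · simp only [Refl.lo, Refl.hi] at hl hh
    cases X <;> simp only [act] <;> rw [Equiv.swap_apply_of_ne_of_ne hl hh]
  · simp only [Refl.lo, Refl.hi, ne_eq, Fin.ext_iff] at hl hh
    cases X <;> simp [act, hl, hh]

theorem act_s_lo {X : HermitianPair} (i : ℕ) (h : i + 1 < X.size) (w : Fin X.size → Label) :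
    act X (.s i h) w (Refl.lo (.s i h)) = w (Refl.hi (.s i h)) := by
  cases X <;> simp [act, Refl.lo, Refl.hi]

theorem act_s_hi {X : HermitianPair} (i : ℕ) (h : i + 1 < X.size) (w : Fin X.size → Label) :
    act X (.s i h) w (Refl.hi (.s i h)) = w (Refl.lo (.s i h)) := by
  cases X <;> simp [act, Refl.lo, Refl.hi]

theorem act_special_lo_C {n : ℕ} (h : 1 < (HermitianPair.C n).size)
    (w : Fin (HermitianPair.C n).size → Label) :
    act (.C n) (.special h) w (Refl.lo (.special h)) = w (Refl.lo (.special h)) := rfl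

theorem act_special_hi_C {n : ℕ} (h : 1 < (HermitianPair.C n).size)
    (w : Fin (HermitianPair.C n).size → Label) :
    act (.C n) (.special h) w (Refl.hi (.special h)) = (w (Refl.hi (.special h))).flip := rfl

theorem act_special_lo_D {n : ℕ} (h : 1 < (HermitianPair.D n).size)
    (w : Fin (HermitianPair.D n).size → Label) :
    act (.D n) (.special h) w (Refl.lo (.special h)) = (w (Refl.hi (.special h))).flip := rfl

theorem act_special_hi_D {n : ℕ} (h : 1 < (HermitianPair.D n).size)
    (w : Fin (HermitianPair.D n).size → Label) :
    act (.D n) (.special h) w (Refl.hi (.special h)) = (w (Refl.lo (.special h))).flip := rfl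

/-- The types in which the first symbol is `∘`. -/
def HermitianPair.HasCirc : HermitianPair → Prop
  | .C _ => True
  | _ => False

/-- Coset diagrams are the orbit of `∅`, so invariants are proved by following an expression letter
by letter. The property is one of bare labelled lines, so no membership in the orbit has to be
carried along. -/
theorem PW.induction {X : HermitianPair} {P : (Fin X.size → Label) → Prop}
    (h0 : P (emptyDiagram X)) (hs : ∀ w r, IsSimple X r → P w → P (act X r w)) (w : PW X) :
    P w.1 := by
  obtain ⟨w, l, hl, rfl⟩ := w
  have key : ∀ (l : List (Refl X.size)) (v : Fin X.size → Label), (∀ r ∈ l, IsSimple X r) → P v →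
      P (l.foldl (fun v r => act X r v) v) := by
    intro l
    induction l with
    | nil => intro v _ h; exact h
    | cons a l ih =>
      intro v hl h
      exact ih _ (fun r hr => hl r (List.mem_cons_of_mem _ hr))
        (hs _ _ (hl a List.mem_cons_self) h)
  exact key l _ hl h0

theorem Label.flip_flip (a : Label) : a.flip.flip = a := by cases a <;> rfl

theorem Label.flip_eq_circ {a : Label} : a.flip = .circ ↔ a = .circ := by
  cases a <;> simp [Label.flip]

theorem act_act {X : HermitianPair} (r : Refl X.size) (w : Fin X.size → Label) :
    act X r (act X r w) = w := by
  rcases r with ⟨i, h⟩ | h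
  · cases X <;> funext j <;> simp [act]
  · cases X
    · rfl
    · funext j
      by_cases hj : j.val = 1 <;> simp [act, hj, Label.flip_flip]
    · funext j
      rcases j with ⟨_ | _ | j, hj⟩ <;> simp [act, Label.flip_flip]

/-- The symbol `∘` occurs only in type `C`, where simple transpositions start at the second point
and the special reflection flips the second point, so `∘` never leaves the first. -/
theorem act_eq_circ_iff {X : HermitianPair} {r : Refl X.size} (hr : IsSimple X r)
    {w : Fin X.size → Label} (hw : ∀ j, w j = .circ ↔ X.HasCirc ∧ j.val = 0) (j : Fin X.size) :
    act X r w j = .circ ↔ X.HasCirc ∧ j.val = 0 := by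
  rcases r with ⟨i, h⟩ | h
  · by_cases h1 : j = Refl.lo (.s i h)
    · subst h1
      rw [act_s_lo, hw]
      cases X <;> simp_all [HermitianPair.HasCirc, Refl.lo, Refl.hi, IsSimple]
      omega
    by_cases h2 : j = Refl.hi (.s i h)
    · subst h2
      rw [act_s_hi, hw]
      cases X <;> simp_all [HermitianPair.HasCirc, Refl.lo, Refl.hi, IsSimple]
      omega
    rw [act_of_ne _ _ _ h1 h2, hw]
  · cases X with
    | A n k => exact absurd hr (by simp [IsSimple])
    | C n =>
      simp only [act]
      split_ifs with h1
      · rw [Label.flip_eq_circ, hw]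
      · rw [hw]
    | D n =>
      simp only [act]
      split_ifs with h1 h1
      · rw [Label.flip_eq_circ, hw]; simp [HermitianPair.HasCirc]
      · rw [Label.flip_eq_circ, hw]; simp [HermitianPair.HasCirc]
      · rw [hw]

theorem PW.eq_circ_iff {X : HermitianPair} (w : PW X) (j : Fin X.size) :
    w.1 j = .circ ↔ X.HasCirc ∧ j.val = 0 := by
  revert j
  refine PW.induction (P := fun w => ∀ j, w j = .circ ↔ X.HasCirc ∧ j.val = 0) ?_ ?_ w
  · cases X
    · intro j; simp only [emptyDiagram, HermitianPair.HasCirc]; split_ifs <;> simp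
    · intro j; simp only [emptyDiagram, HermitianPair.HasCirc]; split_ifs with h <;> simp [h]
    · intro j; simp [emptyDiagram, HermitianPair.HasCirc]
  · intro w r hr hw j
    exact act_eq_circ_iff hr hw j

theorem PW.ne_circ {X : HermitianPair} (w : PW X) {j : Fin X.size} (hj : 0 < j.val) :
    w.1 j ≠ .circ := by
  rw [Ne, PW.eq_circ_iff]
  rintro ⟨-, h⟩
  omega

theorem PW.hi_ne_circ {X : HermitianPair} (w : PW X) (r : Refl X.size) : w.1 r.hi ≠ .circ :=
  w.ne_circ (by rw [r.hi_val]; omega)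

theorem PW.lo_ne_circ {X : HermitianPair} (w : PW X) {i : ℕ} {h : i + 1 < X.size}
    (hr : IsSimple X (.s i h)) : w.1 (Refl.lo (.s i h)) ≠ .circ := by
  rw [Ne, PW.eq_circ_iff]
  cases X <;> simp_all [HermitianPair.HasCirc, Refl.lo, IsSimple]
  omega

/-! ### The height of a coset diagram -/

/-- Sum of the values of `g` at the positions of the symbol `∧`. -/
def upSum {N : ℕ} (g : Fin N → ℤ) (w : Fin N → Label) : ℤ := ∑ j, if w j = .up then g j else 0

theorem upSum_sub {N : ℕ} (g : Fin N → ℤ) (w w' : Fin N → Label) (a b : Fin N) (hab : a ≠ b)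
    (h : ∀ j, j ≠ a → j ≠ b → w' j = w j) :
    upSum g w' - upSum g w = ((if w' a = .up then g a else 0) - (if w a = .up then g a else 0)) +
      ((if w' b = .up then g b else 0) - (if w b = .up then g b else 0)) := by
  unfold upSum
  rw [← Finset.sum_sub_distrib, ← Finset.sum_pair (f := fun j =>
    (if w' j = .up then g j else 0) - (if w j = .up then g j else 0)) hab]
  symm
  apply Finset.sum_subset (Finset.subset_univ _)
  intro j _ hj
  simp only [Finset.mem_insert, Finset.mem_singleton, not_or] at hj
  rw [h j hj.1 hj.2, sub_self]

theorem upSum_act {X : HermitianPair} (g : Fin X.size → ℤ) (r : Refl X.size)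
    (w : Fin X.size → Label) : upSum g (act X r w) - upSum g w =
      ((if act X r w r.lo = .up then g r.lo else 0) - (if w r.lo = .up then g r.lo else 0)) +
      ((if act X r w r.hi = .up then g r.hi else 0) - (if w r.hi = .up then g r.hi else 0)) :=
  upSum_sub g w _ _ _ r.lo_ne_hi (act_of_ne r w)

/-- The number of steps needed to reach a coset diagram from `∅`, up to a constant. -/
def height {N : ℕ} (w : Fin N → Label) : ℤ := upSum (fun j => j.val) w

theorem act_ne_iff {X : HermitianPair} (r : Refl X.size) (w : Fin X.size → Label) :
    act X r w ≠ w ↔ act X r w r.lo ≠ w r.lo ∨ act X r w r.hi ≠ w r.hi := by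
  constructor
  · intro h
    by_contra! hc
    apply h
    funext j
    by_cases h1 : j = r.lo
    · rw [h1, hc.1]
    by_cases h2 : j = r.hi
    · rw [h2, hc.2]
    exact act_of_ne r w j h1 h2
  · rintro (h | h) h' <;> exact h (by rw [h'])

/-- The weights start at `0`. A transposition that acts nontrivially shifts one `∧` by one place; in
type `C` the special reflection flips the point of weight `1`; in type `D` it flips two equal
symbols of weights `0` and `1`. Each changes the total by exactly one. -/
theorem height_act {X : HermitianPair} (r : Refl X.size) (hr : IsSimple X r) (w : PW X)
    (h : act X r w.1 ≠ w.1) :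
    height (act X r w.1) = height w.1 + (if w.1 r.hi = .down then 1 else -1) := by
  have key := upSum_act (fun j => (j.val : ℤ)) r w.1
  change height _ - height _ = _ at key
  rw [act_ne_iff] at h
  have h1 := r.hi_val
  have h2 := w.hi_ne_circ r
  rcases r with ⟨i, hi⟩ | hi
  · have h3 := w.lo_ne_circ hr
    rw [act_s_lo, act_s_hi] at key h
    generalize w.1 (Refl.lo (.s i hi)) = x at *
    generalize w.1 (Refl.hi (.s i hi)) = y at *
    cases x <;> cases y <;> simp_all <;> omega
  · cases X with
    | A n k => exact absurd hr (by simp [IsSimple])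
    | C n =>
      rw [act_special_lo_C, act_special_hi_C] at key h
      generalize w.1 (Refl.hi (.special hi)) = y at *
      generalize height (act _ _ _) = z at *
      cases y <;> simp_all [Label.flip, Refl.lo] <;> omega
    | D n =>
      have h3 : w.1 (Refl.lo (.special hi)) ≠ .circ := by
        rw [Ne, PW.eq_circ_iff]; simp [HermitianPair.HasCirc]
      rw [act_special_lo_D, act_special_hi_D] at key h
      generalize w.1 (Refl.lo (.special hi)) = x at *
      generalize w.1 (Refl.hi (.special hi)) = y at *
      generalize height (act _ _ _) = z at *
      cases x <;> cases y <;> simp_all [Label.flip, Refl.lo] <;> omega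

theorem height_act_eq_or {X : HermitianPair} (r : Refl X.size) (hr : IsSimple X r) (w : PW X) :
    height (act X r w.1) ≤ height w.1 + 1 := by
  by_cases h : act X r w.1 = w.1
  · rw [h]; omega
  · rw [height_act r hr w h]; split_ifs <;> omega

/-! ### Coset diagrams without descents -/

theorem upSum_one_emptyDiagram_A (n k : ℕ) (w : PW (.A n k)) :
    upSum (fun _ => 1) w.1 = upSum (fun _ => 1) (emptyDiagram (.A n k)) := by
  refine PW.induction (X := .A n k)
    (P := fun w => upSum (fun _ => 1) w = upSum (fun _ => 1) (emptyDiagram (.A n k))) rfl ?_ w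
  intro w r hr hw
  have key := upSum_act (fun _ => 1) r w
  rcases r with ⟨i, hi⟩ | hi
  · rw [act_s_lo, act_s_hi] at key
    omega
  · exact absurd hr (by simp [IsSimple])

theorem even_upSum_one_D (n : ℕ) (w : PW (.D n)) : Even (upSum (fun _ => 1) w.1) := by
  -- The absence of `∘` is carried along as well, because flipping two points preserves parity only
  -- if both symbols are arrows.
  refine (PW.induction (X := .D n) (P := fun w => (∀ j, w j = .circ ↔ False) ∧
    Even (upSum (fun _ => 1) w)) ?_ ?_ w).2
  · exact ⟨fun j => by simp [emptyDiagram], by simp [upSum, emptyDiagram]⟩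
  · rintro w r hr ⟨hc, hw⟩
    refine ⟨fun j => ?_, ?_⟩
    · have := act_eq_circ_iff (X := .D n) hr (w := w) (by simpa [HermitianPair.HasCirc] using hc) j
      simpa [HermitianPair.HasCirc] using this
    have key := upSum_act (fun _ => 1) r w
    rcases r with ⟨i, hi⟩ | hi
    · rw [act_s_lo, act_s_hi] at key
      have : upSum (fun _ => 1) (act _ (.s i hi) w) = upSum (fun _ => 1) w := by omega
      rwa [this]
    · rw [act_special_lo_D, act_special_hi_D] at key
      have h1 := hc (Refl.lo (.special hi))
      have h2 := hc (Refl.hi (.special hi))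
      generalize w (Refl.lo (.special hi)) = x at *
      generalize w (Refl.hi (.special hi)) = y at *
      generalize upSum _ (act _ _ _) = z at *
      rw [Int.even_iff] at hw ⊢
      cases x <;> cases y <;> simp_all [Label.flip] <;> omega

/-- Without the pattern `∨∧` at neighbouring points, an `∧` forces `∧` everywhere to its left; in
type `C` this stops before the first point. -/
theorem up_of_le_of_no_descent {X : HermitianPair} (w : PW X)
    (h : ∀ i (hi : i + 1 < X.size), IsSimple X (.s i hi) →
      ¬ (w.1 (Refl.lo (.s i hi)) = .down ∧ w.1 (Refl.hi (.s i hi)) = .up))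
    {j k : ℕ} (hjk : j ≤ k) (hk : k < X.size) (hj : X.HasCirc → 0 < j) (hw : w.1 ⟨k, hk⟩ = .up) :
    w.1 ⟨j, by omega⟩ = .up := by
  induction k, hjk using Nat.le_induction with
  | base => exact hw
  | succ k hjk ih =>
    apply ih (by omega)
    have hs : IsSimple X (.s k hk) := by
      cases X
      · trivial
      · exact (hj trivial).trans_le hjk
      · trivial
    have h1 := h k hk hs
    have h2 := w.lo_ne_circ hs
    simp only [Refl.lo, Refl.hi] at h1 h2
    generalize w.1 ⟨k, _⟩ = x at *
    cases x <;> simp_all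

/-- All `∧` lie at the left end. In type `A` their number is fixed, which leaves only `∅`. In type
`C` the special reflection forbids `∧` at the second point. In type `D` it forbids two `∧` at the
start, and a single `∧` contradicts the even number of `∧`. -/
theorem eq_emptyDiagram_of_no_descent {X : HermitianPair} (w : PW X)
    (h : ∀ r, IsSimple X r → act X r w.1 ≠ w.1 → w.1 r.hi = .down) : w.1 = emptyDiagram X := by
  have hs : ∀ i (hi : i + 1 < X.size), IsSimple X (.s i hi) →
      ¬ (w.1 (Refl.lo (.s i hi)) = .down ∧ w.1 (Refl.hi (.s i hi)) = .up) := by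
    rintro i hi hr ⟨h1, h2⟩
    have := h (.s i hi) hr ((act_ne_iff _ _).2 (Or.inl (by rw [act_s_lo, h1, h2]; simp)))
    rw [h2] at this
    cases this
  cases X with
  | A n k =>
    have hcirc : ∀ j, w.1 j ≠ .circ := fun j => by
      rw [Ne, PW.eq_circ_iff]; simp [HermitianPair.HasCirc]
    have hsum := upSum_one_emptyDiagram_A n k w
    have hmono : ∀ i j : Fin (HermitianPair.A n k).size, i ≤ j → w.1 j = .up → w.1 i = .up := fun i j hij hj =>
      up_of_le_of_no_descent w hs (Fin.le_def.1 hij) j.2 (fun h => h.elim) hj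
    have hcard : (Finset.univ.filter fun j : Fin (HermitianPair.A n k).size => w.1 j = Label.up).card =
        (Finset.univ.filter fun j : Fin (HermitianPair.A n k).size =>
          emptyDiagram (.A n k) j = Label.up).card := by
      simp only [upSum, Finset.sum_ite, Finset.sum_const] at hsum
      simpa using hsum
    have hset : (Finset.univ.filter fun j : Fin (HermitianPair.A n k).size => w.1 j = Label.up) =
        (Finset.univ.filter fun j : Fin (HermitianPair.A n k).size =>
          emptyDiagram (.A n k) j = Label.up) := by
      -- Both sets of `∧` are initial segments, so one contains the other, and equal cardinality
      -- makes them equal.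
      by_cases hsub : (Finset.univ.filter fun j : Fin (HermitianPair.A n k).size => w.1 j = Label.up) ⊆
          (Finset.univ.filter fun j : Fin (HermitianPair.A n k).size =>
          emptyDiagram (.A n k) j = Label.up)
      · exact Finset.eq_of_subset_of_card_le hsub hcard.ge
      · refine (Finset.eq_of_subset_of_card_le ?_ hcard.le).symm
        rw [Finset.not_subset] at hsub
        obtain ⟨j, hj, hj'⟩ := hsub
        intro i hi
        refine Finset.mem_filter.2 ⟨Finset.mem_univ _, ?_⟩
        replace hi := (Finset.mem_filter.1 hi).2
        replace hj := (Finset.mem_filter.1 hj).2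
        replace hj' : ¬ emptyDiagram (.A n k) j = Label.up := fun h =>
          hj' (Finset.mem_filter.2 ⟨Finset.mem_univ _, h⟩)
        simp only [emptyDiagram] at hi hj'
        refine hmono i j ?_ hj
        rw [Fin.le_def]
        split_ifs at hi hj'
        · exact absurd rfl hj'
        · omega
    funext j
    have hj := Finset.ext_iff.1 hset j
    have hc := hcirc j
    simp only [Finset.mem_filter, Finset.mem_univ, true_and] at hj
    simp only [emptyDiagram] at hj ⊢
    split_ifs at hj ⊢ with hk
    · simpa using hj
    · generalize w.1 j = x at *
      cases x <;> simp_all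
  | C n =>
    have hdown : ∀ j : Fin (HermitianPair.C n).size, 0 < j.val → w.1 j = .down := by
      intro j hj
      have hc := w.ne_circ (X := .C n) hj
      have hn : 1 < (HermitianPair.C n).size := by
        have := j.2
        omega
      have h1 : w.1 ⟨1, hn⟩ ≠ .up := by
        intro h1
        have := h (.special hn) trivial
          ((act_ne_iff _ _).2 (Or.inr (by rw [act_special_hi_C]; simp [Refl.hi, h1, Label.flip])))
        simp only [Refl.hi] at this
        rw [this] at h1
        cases h1
      have h2 : w.1 j ≠ .up := fun h2 =>
        h1 (up_of_le_of_no_descent (X := .C n) w hs hj j.2 (fun _ => one_pos) h2)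
      generalize w.1 j = x at *
      cases x <;> simp_all
    funext j
    simp only [emptyDiagram]
    split_ifs with hj
    · exact (w.eq_circ_iff (X := .C n) j).2 ⟨trivial, hj⟩
    · exact hdown j (by omega)
  | D n =>
    have hcirc : ∀ j, w.1 j ≠ .circ := fun j => by
      rw [Ne, PW.eq_circ_iff]; simp [HermitianPair.HasCirc]
    have hup : ∀ j : Fin (HermitianPair.D n).size, w.1 j ≠ .up := by
      intro j hj
      have hmono : ∀ i j : Fin (HermitianPair.D n).size, i ≤ j → w.1 j = .up → w.1 i = .up := fun i j hij hj =>
        up_of_le_of_no_descent (X := .D n) w hs (Fin.le_def.1 hij) j.2 (fun h => h.elim) hj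
      have h0 := hmono ⟨0, j.pos⟩ j (Fin.le_def.2 (Nat.zero_le _)) hj
      have h1 : ∀ i : Fin (HermitianPair.D n).size, i ≠ ⟨0, j.pos⟩ → w.1 i ≠ .up := by
        intro i hi hiu
        have hn : 1 < (HermitianPair.D n).size := by
          rw [Ne, Fin.ext_iff] at hi
          have := i.2
          simp only at hi
          omega
        have hi0 : 1 ≤ i.val := by
          rw [Ne, Fin.ext_iff] at hi
          simp only at hi
          omega
        have h1 := hmono ⟨1, hn⟩ i (Fin.le_def.2 hi0) hiu
        have := h (.special hn) trivial
          ((act_ne_iff _ _).2 (Or.inr (by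
            rw [act_special_hi_D]; simp [Refl.hi, Refl.lo, h1, h0, Label.flip])))
        simp only [Refl.hi] at this
        rw [this] at h1
        cases h1
      have heven := even_upSum_one_D n w
      have : upSum (fun _ => 1) w.1 = 1 := by
        refine (Finset.sum_eq_single (⟨0, j.pos⟩ : Fin (HermitianPair.D n).size) ?_ ?_).trans ?_
        · intro i _ hi
          rw [if_neg (h1 i hi)]
        · intro hh
          exact absurd (Finset.mem_univ _) hh
        · rw [if_pos h0]
      rw [this] at heven
      exact absurd heven (by decide)
    funext j
    simp only [emptyDiagram]
    have h1 := hcirc j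
    have h2 := hup j
    generalize w.1 j = x at *
    cases x <;> simp_all

/-! ### Lengths and the Bruhat order -/

/-- As long as the diagram is not `∅`, some reflection lowers the height by one; the descent read
backwards is an expression whose length is the height difference. `IsExpr.le_length` shows that no
expression is shorter. -/
theorem PW.exists_expr_length {X : HermitianPair} (w : PW X) :
    ∃ l, IsExpr X l w.1 ∧ (l.length : ℤ) = height w.1 - height (emptyDiagram X) := by
  have hnn : ∀ w : PW X, 0 ≤ height w.1 := fun w => by
    unfold height upSum
    exact Finset.sum_nonneg fun j _ => by split_ifs <;> simp
  induction hm : (height w.1).toNat using Nat.strong_induction_on generalizing w with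
  | _ m ih =>
    by_cases hw : w.1 = emptyDiagram X
    · exact ⟨[], ⟨by simp, hw.symm⟩, by rw [hw]; simp⟩
    · have : ∃ r, IsSimple X r ∧ act X r w.1 ≠ w.1 ∧ w.1 r.hi ≠ .down := by
        by_contra! hc
        exact hw (eq_emptyDiagram_of_no_descent w hc)
      obtain ⟨r, hr, hne, hd⟩ := this
      have hh := height_act r hr w hne
      rw [if_neg hd] at hh
      have h1 := hnn w
      have h2 := hnn (w.mulRefl r hr)
      have h3 : (w.mulRefl r hr).1 = act X r w.1 := rfl
      obtain ⟨l, hl, hlen⟩ := ih (height (w.mulRefl r hr).1).toNat (by rw [h3] at h2 ⊢; omega)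
        (w.mulRefl r hr) rfl
      refine ⟨l ++ [r], ⟨?_, ?_⟩, ?_⟩
      · intro r' hr'
        rcases List.mem_append.1 hr' with h | h
        · exact hl.1 r' h
        · rw [List.mem_singleton.1 h]; exact hr
      · rw [List.foldl_append, hl.2]
        exact act_act r w.1
      · rw [List.length_append, List.length_singleton]
        rw [h3] at hlen
        push_cast
        omega

/-- One letter raises the height by at most one. -/
theorem IsExpr.le_length {X : HermitianPair} {l : List (Refl X.size)} {w : Fin X.size → Label}
    (h : IsExpr X l w) : height w - height (emptyDiagram X) ≤ l.length := by
  induction l using List.reverseRecOn generalizing w with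
  | nil =>
    rw [← h.2]
    simp
  | append_singleton l r ih =>
    have hl : IsExpr X l (l.foldl (fun v r => act X r v) (emptyDiagram X)) :=
      ⟨fun r' hr' => h.1 r' (List.mem_append_left _ hr'), rfl⟩
    have h1 := ih hl
    have h2 := height_act_eq_or r (h.1 r (by simp)) ⟨_, l, hl⟩
    have h3 := h.2
    rw [List.foldl_append] at h3
    rw [← h3, List.length_append, List.length_singleton]
    simp only [List.foldl_cons, List.foldl_nil]
    push_cast
    simp only at h2
    omega

theorem IsReducedExpr.length_eq {X : HermitianPair} {l : List (Refl X.size)} {w : PW X}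
    (h : IsReducedExpr X l w) : (l.length : ℤ) = height w.1 - height (emptyDiagram X) := by
  obtain ⟨l', hl', hlen⟩ := w.exists_expr_length
  have h1 := h.2 l' hl'
  have h2 := h.1.le_length
  omega

theorem isReducedExpr_of_length_eq {X : HermitianPair} {l : List (Refl X.size)} {w : PW X}
    (h : IsExpr X l w.1) (hl : (l.length : ℤ) = height w.1 - height (emptyDiagram X)) :
    IsReducedExpr X l w := by
  refine ⟨h, fun l' hl' => ?_⟩
  have := hl'.le_length
  omega

/-- Appending `r` to a reduced expression raises the length and the height by one, so the longer
word is again reduced and contains the shorter one as a subword. -/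
theorem bruhatLT_mulRefl_of_down {X : HermitianPair} {r : Refl X.size} (hr : IsSimple X r)
    {w : PW X} (hne : w.mulRefl r hr ≠ w) (hd : w.1 r.hi = .down) :
    BruhatLT X w (w.mulRefl r hr) := by
  obtain ⟨l, hl, hlen⟩ := w.exists_expr_length
  have hne' : act X r w.1 ≠ w.1 := fun h => hne (Subtype.ext h)
  have hh := height_act r hr w hne'
  rw [if_pos hd] at hh
  refine ⟨⟨l ++ [r], l, isReducedExpr_of_length_eq ⟨?_, ?_⟩ ?_, isReducedExpr_of_length_eq hl hlen,
    List.sublist_append_left _ _⟩, hne.symm⟩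
  · intro r' hr'
    rcases List.mem_append.1 hr' with h | h
    · exact hl.1 r' h
    · rw [List.mem_singleton.1 h]; exact hr
  · rw [List.foldl_append, hl.2]
    rfl
  · rw [List.length_append, List.length_singleton]
    change _ = height (act X r w.1) - _
    push_cast
    omega

theorem BruhatLE.height_le {X : HermitianPair} {y w : PW X} (h : BruhatLE X y w) :
    height y.1 ≤ height w.1 := by
  obtain ⟨l, l', h1, h2, h3⟩ := h
  have := h1.length_eq
  have := h2.length_eq
  have := h3.length_le
  omega

theorem mulRefl_mulRefl {X : HermitianPair} {r : Refl X.size} (hr : IsSimple X r) (w : PW X) :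
    (w.mulRefl r hr).mulRefl r hr = w := Subtype.ext (act_act r w.1)

theorem bruhatLT_mulRefl_iff {X : HermitianPair} {r : Refl X.size} (hr : IsSimple X r)
    {w : PW X} (hne : w.mulRefl r hr ≠ w) :
    BruhatLT X w (w.mulRefl r hr) ↔ w.1 r.hi = .down := by
  refine ⟨fun h => ?_, bruhatLT_mulRefl_of_down hr hne⟩
  by_contra hd
  have hh := height_act r hr w (fun h => hne (Subtype.ext h))
  rw [if_neg hd] at hh
  have := h.1.height_le
  change _ ≤ height (act X r w.1) at this
  omega

/-- A reflection which moves a coset diagram moves its second point. -/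
theorem act_hi {X : HermitianPair} {r : Refl X.size} (hr : IsSimple X r) (w : PW X)
    (h : act X r w.1 ≠ w.1) : act X r w.1 r.hi = (w.1 r.hi).flip := by
  rw [act_ne_iff] at h
  have h2 := w.hi_ne_circ r
  rcases r with ⟨i, hi⟩ | hi
  · have h3 := w.lo_ne_circ hr
    rw [act_s_lo, act_s_hi] at *
    generalize w.1 (Refl.lo (.s i hi)) = x at *
    generalize w.1 (Refl.hi (.s i hi)) = y at *
    cases x <;> cases y <;> simp_all [Label.flip]
  · cases X with
    | A n k => exact absurd hr (by simp [IsSimple])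
    | C n => rw [act_special_hi_C]
    | D n =>
      have h3 : w.1 (Refl.lo (.special hi)) ≠ .circ := by
        rw [Ne, PW.eq_circ_iff]; simp [HermitianPair.HasCirc]
      rw [act_special_lo_D, act_special_hi_D] at *
      generalize w.1 (Refl.lo (.special hi)) = x at *
      generalize w.1 (Refl.hi (.special hi)) = y at *
      cases x <;> cases y <;> simp_all [Label.flip]

theorem bruhatLT_or_iff {X : HermitianPair} {r : Refl X.size} (hr : IsSimple X r) (w : PW X) :
    (BruhatLT X w (w.mulRefl r hr) ∨ BruhatLT X (w.mulRefl r hr) w) ↔ w.mulRefl r hr ≠ w := by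
  constructor
  · rintro (h | h)
    · exact h.2.symm
    · exact h.2
  · intro h
    by_cases hd : w.1 r.hi = .down
    · exact Or.inl (bruhatLT_mulRefl_of_down hr h hd)
    · right
      have hne : (w.mulRefl r hr).mulRefl r hr ≠ w.mulRefl r hr := by
        rw [mulRefl_mulRefl]; exact h.symm
      have := bruhatLT_mulRefl_of_down hr hne (by
        change act X r w.1 r.hi = _
        rw [act_hi hr w (fun h' => h (Subtype.ext h'))]
        have := w.hi_ne_circ r
        generalize w.1 r.hi = x at *
        cases x <;> simp_all [Label.flip])
      rwa [mulRefl_mulRefl] at this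

theorem isEdge_iff {X : HermitianPair} {r : Refl X.size} (hr : IsSimple X r) (w v : PW X) :
    IsEdge r hr w v ↔ w.mulRefl r hr ≠ w ∧ (v = w ∨ v = w.mulRefl r hr) := by
  rw [IsEdge, bruhatLT_or_iff]

/-- This is the theorem for generators: the first summand is the degree of the northern arc of
`e_r`, the second that of its southern arc. -/
theorem edgeDegree_eq {X : HermitianPair} {r : Refl X.size} {hr : IsSimple X r} {w v : PW X}
    (h : IsEdge r hr w v) : edgeDegree r hr w v =
      (if w.1 r.hi = .down then 1 else 0) - (if v.1 r.hi = .up then 1 else 0) := by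
  rw [isEdge_iff] at h
  have h1 := w.hi_ne_circ r
  obtain ⟨hne, rfl | rfl⟩ := h
  · rw [edgeDegree, if_pos rfl, bruhatLT_mulRefl_iff hr hne]
    generalize v.1 r.hi = x at *
    cases x <;> simp_all
  · rw [edgeDegree, if_neg hne]
    change _ = _ - (if act X r w.1 r.hi = .up then 1 else 0)
    rw [act_hi hr w (fun h => hne (Subtype.ext h))]
    generalize w.1 r.hi = x at *
    cases x <;> simp_all [Label.flip]

/-! ### The tangles of the generators -/

section Generator

variable {N : ℕ}

theorem e_mate_inl_lo (r : Refl N) : (RawTangle.e r).mate (.inl r.lo) = .inl r.hi := by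
  cases r <;> simp [RawTangle.e, Refl.lo, Refl.hi]

theorem e_mate_inl_hi (r : Refl N) : (RawTangle.e r).mate (.inl r.hi) = .inl r.lo := by
  cases r <;> simp [RawTangle.e, Refl.lo, Refl.hi]

theorem e_mate_inr_lo (r : Refl N) : (RawTangle.e r).mate (.inr r.lo) = .inr r.hi := by
  cases r <;> simp [RawTangle.e, Refl.lo, Refl.hi]

theorem e_mate_inr_hi (r : Refl N) : (RawTangle.e r).mate (.inr r.hi) = .inr r.lo := by
  cases r <;> simp [RawTangle.e, Refl.lo, Refl.hi]

theorem e_mate_inl_of_ne (r : Refl N) (j : Fin N) (h1 : j ≠ r.lo) (h2 : j ≠ r.hi) :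
    (RawTangle.e r).mate (.inl j) = .inr j := by
  cases r <;> simp_all [RawTangle.e, Refl.lo, Refl.hi, Fin.ext_iff]

theorem e_mate_inr_of_ne (r : Refl N) (j : Fin N) (h1 : j ≠ r.lo) (h2 : j ≠ r.hi) :
    (RawTangle.e r).mate (.inr j) = .inl j := by
  cases r <;> simp_all [RawTangle.e, Refl.lo, Refl.hi, Fin.ext_iff]

theorem mem_e_beaded (r : Refl N) (v : Vertex N) : v ∈ (RawTangle.e r).beaded ↔
    r.IsSpecial ∧ (v = .inl r.lo ∨ v = .inl r.hi ∨ v = .inr r.lo ∨ v = .inr r.hi) := by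
  rcases r with ⟨i, h⟩ | h
  · simp [RawTangle.e, Refl.IsSpecial]
  · rcases v with j | j <;>
      simp [RawTangle.e, Refl.IsSpecial, Refl.lo, Refl.hi, Fin.ext_iff, Nat.le_one_iff_eq_zero_or_eq_one]

theorem Refl.IsSpecial.lo_val {r : Refl N} (h : r.IsSpecial) : r.lo.val = 0 := by
  cases r
  · exact h.elim
  · rfl

/-- Cut the pairs of `a` and of `b`, join `a` to `b` and the two remaining ends to each other. -/
def splice {V : Type*} [DecidableEq V] (m : V → V) (a b u : V) : V :=
  if u = a then b else if u = b then a else if m u = a then m b else if m u = b then m a else m u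

section Splice

variable {V : Type*} [DecidableEq V] {m : V → V} {a b : V}

theorem splice_invol (hm : ∀ v, m (m v) = v ∧ m v ≠ v) (hab : a ≠ b) (v : V) :
    splice m a b (splice m a b v) = v ∧ splice m a b v ≠ v := by
  unfold splice
  grind

theorem splice_left : splice m a b a = b := by simp [splice]

theorem splice_right : splice m a b b = a := by
  unfold splice
  grind

theorem splice_mate_left (hm : ∀ v, m (m v) = v ∧ m v ≠ v) (h : m a ≠ b) :
    splice m a b (m a) = m b := by
  unfold splice
  grind

theorem splice_mate_right (hm : ∀ v, m (m v) = v ∧ m v ≠ v) (h : m a ≠ b) :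
    splice m a b (m b) = m a := by
  unfold splice
  grind

theorem splice_of_ne (hm : ∀ v, m (m v) = v ∧ m v ≠ v) {u : V} (h1 : u ≠ a) (h2 : u ≠ b)
    (h3 : u ≠ m a) (h4 : u ≠ m b) : splice m a b u = m u := by
  unfold splice
  grind

/-- Splicing undoes itself: this is why stacking the cut tangle on a generator restores the original
pairing. -/
theorem splice_splice (hm : ∀ v, m (m v) = v ∧ m v ≠ v) (h : m a ≠ b) :
    splice (splice m a b) a (m a) = m := by
  funext u
  unfold splice
  grind

end Splice

/-! ### Stacking a tangle on a generator -/

open Classical in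
/-- The end points of the component of a vertex of a tangle stacked on a generator. -/
noncomputable def component (t : RawTangle N) (r : Refl N) (x : StackVertex N) : Set (Vertex N) :=
  if x.1 = 0 then {.inl x.2, splice t.mate (.inr r.lo) (.inr r.hi) (.inl x.2)}
  else if x.1 = 1 ∧ (x.2 = r.lo ∨ x.2 = r.hi) then
    (if t.mate (.inr r.lo) = .inr r.hi then ∅ else {t.mate (.inr r.lo), t.mate (.inr r.hi)})
  else {.inr x.2, splice t.mate (.inr r.lo) (.inr r.hi) (.inr x.2)}

variable {t : RawTangle N} {r : Refl N}

theorem component_outer (u : Vertex N) : component t r (outer u) =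
    {u, splice t.mate (.inr r.lo) (.inr r.hi) u} := by
  cases u <;> simp [component, outer]

theorem component_upper (u : Vertex N) (h1 : u ≠ .inr r.lo) (h2 : u ≠ .inr r.hi) :
    component t r (upper u) = {u, splice t.mate (.inr r.lo) (.inr r.hi) u} := by
  cases u <;> simp_all [component, upper]

theorem component_upper_lo : component t r (upper (.inr r.lo)) =
    if t.mate (.inr r.lo) = .inr r.hi then ∅ else {t.mate (.inr r.lo), t.mate (.inr r.hi)} := by
  simp [component, upper]

theorem component_upper_hi : component t r (upper (.inr r.hi)) =
    if t.mate (.inr r.lo) = .inr r.hi then ∅ else {t.mate (.inr r.lo), t.mate (.inr r.hi)} := by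
  simp [component, upper]

theorem component_upper_mate (ht : t.IsTangle) (v : Vertex N) :
    component t r (upper (t.mate v)) = component t r (upper v) := by
  have hm := ht.1
  have hne : (.inr r.lo : Vertex N) ≠ .inr r.hi := by simpa using r.lo_ne_hi
  have hA := component_upper_lo (t := t) (r := r)
  have hB := component_upper_hi (t := t) (r := r)
  have hO := component_upper (t := t) (r := r)
  generalize (.inr r.lo : Vertex N) = a at *
  generalize (.inr r.hi : Vertex N) = b at *
  have main : ∀ v, v ≠ a → v ≠ b → component t r (upper (t.mate v)) = component t r (upper v) := by
    intro v h1 h2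
    rw [hO v h1 h2]
    by_cases h3 : t.mate v = a
    · have h5 : t.mate a = v := by rw [← h3, (hm v).1]
      have h6 := splice_mate_left (a := a) (b := b) hm (by rw [h5]; exact h2)
      rw [h5] at h6
      rw [h3, hA, h5, if_neg h2, h6]
    by_cases h4 : t.mate v = b
    · have h5 : t.mate b = v := by rw [← h4, (hm v).1]
      have h6 : t.mate a ≠ b := fun h => h1 (by rw [← h5, ← h, (hm a).1])
      have h7 := splice_mate_right hm h6
      rw [h5] at h7
      rw [h4, hB, if_neg h6, h5, h7, Set.pair_comm]
    · have h5 : v ≠ t.mate a := fun h => h3 (by rw [h, (hm a).1])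
      have h6 : v ≠ t.mate b := fun h => h4 (by rw [h, (hm b).1])
      have h7 : t.mate v ≠ t.mate a := fun h => h1 (by rw [← (hm v).1, h, (hm a).1])
      have h8 : t.mate v ≠ t.mate b := fun h => h2 (by rw [← (hm v).1, h, (hm b).1])
      rw [hO _ h3 h4, splice_of_ne hm h3 h4 h7 h8, (hm v).1, splice_of_ne hm h1 h2 h5 h6,
        Set.pair_comm]
  by_cases h1 : v = a
  · rw [h1]
    by_cases h2 : t.mate a = b
    · rw [h2, hA, hB]
    · have := main (t.mate a) (hm a).2 h2
      rw [(hm a).1] at this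
      exact this.symm
  by_cases h2 : v = b
  · rw [h2]
    by_cases h3 : t.mate b = a
    · rw [h3, hA, hB]
    · have := main (t.mate b) h3 (hm b).2
      rw [(hm b).1] at this
      exact this.symm
  exact main v h1 h2

theorem component_lower_mate (v : Vertex N) :
    component t r (lower ((RawTangle.e r).mate v)) = component t r (lower v) := by
  have hne := r.lo_ne_hi
  rcases v with j | j
  · by_cases h1 : j = r.lo
    · rw [h1, e_mate_inl_lo]; simp [component, lower]
    by_cases h2 : j = r.hi
    · rw [h2, e_mate_inl_hi]; simp [component, lower]
    rw [e_mate_inl_of_ne r j h1 h2]; simp [component, lower, h1, h2]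
  · by_cases h1 : j = r.lo
    · rw [h1, e_mate_inr_lo]
      simp [component, lower, splice_left, splice_right, Set.pair_comm]
    by_cases h2 : j = r.hi
    · rw [h2, e_mate_inr_hi]
      simp [component, lower, splice_left, splice_right, Set.pair_comm]
    rw [e_mate_inr_of_ne r j h1 h2]; simp [component, lower, h1, h2]

/-- `component` is the explicit candidate for the outer ends of each connected component. Since it
is constant on the generating steps of the equivalence relation, it can prove that vertices are not
joined. -/
theorem component_eq_of_joined (ht : t.IsTangle) {x y : StackVertex N}
    (h : Joined t (RawTangle.e r) x y) : component t r x = component t r y := by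
  induction h with
  | rel x y h =>
    rcases h with ⟨v, rfl, rfl⟩ | ⟨v, rfl, rfl⟩
    · exact (component_upper_mate ht v).symm
    · exact (component_lower_mate v).symm
  | refl => rfl
  | symm _ _ _ ih => exact ih.symm
  | trans _ _ _ _ _ ih1 ih2 => exact ih1.trans ih2

theorem joined_upper (t t' : RawTangle N) (v : Vertex N) :
    Joined t t' (upper v) (upper (t.mate v)) :=
  .rel _ _ (Or.inl ⟨v, rfl, rfl⟩)

theorem joined_lower (t t' : RawTangle N) (v : Vertex N) :
    Joined t t' (lower v) (lower (t'.mate v)) :=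
  .rel _ _ (Or.inr ⟨v, rfl, rfl⟩)

theorem Joined.symm {t t' : RawTangle N} {x y : StackVertex N} (h : Joined t t' x y) :
    Joined t t' y x := Relation.EqvGen.symm _ _ h

theorem Joined.trans {t t' : RawTangle N} {x y z : StackVertex N} (h : Joined t t' x y)
    (h' : Joined t t' y z) : Joined t t' x z := Relation.EqvGen.trans _ _ _ h h'

theorem joined_upper_outer (t : RawTangle N) (u : Vertex N) (h1 : u ≠ .inr r.lo)
    (h2 : u ≠ .inr r.hi) : Joined t (RawTangle.e r) (upper u) (outer u) := by
  rcases u with j | j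
  · exact .refl _
  · have := joined_lower t (RawTangle.e r) (.inl j)
    rwa [e_mate_inl_of_ne r j (fun h => h1 (by rw [h])) (fun h => h2 (by rw [h]))] at this

theorem joined_upper_lo_hi (t : RawTangle N) (r : Refl N) :
    Joined t (RawTangle.e r) (upper (.inr r.lo)) (upper (.inr r.hi)) := by
  have := joined_lower t (RawTangle.e r) (.inl r.lo)
  rwa [e_mate_inl_lo] at this

theorem joined_outer_lo_hi (t : RawTangle N) (r : Refl N) :
    Joined t (RawTangle.e r) (outer (.inr r.lo)) (outer (.inr r.hi)) := by
  have := joined_lower t (RawTangle.e r) (.inr r.lo)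
  rwa [e_mate_inr_lo] at this

theorem joined_outer_splice (ht : t.IsTangle) (u : Vertex N) :
    Joined t (RawTangle.e r) (outer u)
      (outer (splice t.mate (.inr r.lo) (.inr r.hi) u)) := by
  have hm := ht.1
  have hlh := joined_outer_lo_hi t r
  have hul := joined_upper_lo_hi t r
  have ho := fun u => joined_upper_outer (r := r) t u
  have hu := joined_upper t (RawTangle.e r)
  have hne : (.inr r.lo : Vertex N) ≠ .inr r.hi := by simpa using r.lo_ne_hi
  generalize (.inr r.lo : Vertex N) = a at *
  generalize (.inr r.hi : Vertex N) = b at *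
  unfold splice
  split_ifs with h1 h2 h3 h4
  · rw [h1]; exact hlh
  · rw [h2]; exact hlh.symm
  · have h5 : t.mate b ≠ a := fun h => h2 (by rw [← (hm u).1, h3, ← h, (hm b).1])
    refine (ho u h1 h2).symm.trans ((hu u).trans ?_)
    rw [h3]
    exact hul.trans ((hu b).trans (ho _ h5 (hm b).2))
  · have h5 : t.mate a ≠ b := fun h => h1 (by rw [← (hm u).1, h4, ← h, (hm a).1])
    refine (ho u h1 h2).symm.trans ((hu u).trans ?_)
    rw [h4]
    exact hul.symm.trans ((hu a).trans (ho _ (hm a).2 h5))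
  · exact (ho u h1 h2).symm.trans ((hu u).trans (ho _ h3 h4))

theorem joined_of_mem_component (ht : t.IsTangle) {x : StackVertex N} {v : Vertex N}
    (h : v ∈ component t r x) : Joined t (RawTangle.e r) x (outer v) := by
  have hm := ht.1
  have hout : ∀ u, v = u ∨ v = splice t.mate (.inr r.lo) (.inr r.hi) u →
      Joined t (RawTangle.e r) (outer u) (outer v) := by
    rintro u (rfl | rfl)
    · exact .refl _
    · exact joined_outer_splice ht u
  obtain ⟨⟨i, hi⟩, j⟩ := x
  rcases i with _ | _ | _ | i
  · exact hout (.inl j) (by simpa [component] using h)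
  · by_cases hj : j = r.lo ∨ j = r.hi
    · simp only [component, Fin.mk_one, Fin.isValue, one_ne_zero, ↓reduceIte, hj, and_self, zero_add] at h
      split_ifs at h with h1
      · exact h.elim
      · have key : Joined t (RawTangle.e r) (upper (.inr r.lo)) (outer v) := by
          rcases h with rfl | rfl
          · exact (joined_upper _ _ _).trans (joined_upper_outer t _ (hm _).2 h1)
          · refine (joined_upper_lo_hi t r).trans
              ((joined_upper _ _ _).trans (joined_upper_outer t _ (fun h => h1 ?_) (hm _).2))
            rw [← h, (hm _).1]
        rcases hj with rfl | rfl
        · exact key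
        · exact (joined_upper_lo_hi t r).symm.trans key
    · rw [not_or] at hj
      refine (joined_upper_outer t (.inr j) (by simpa using hj.1) (by simpa using hj.2)).trans ?_
      exact hout (.inr j) (by simpa [component, hj.1, hj.2] using h)
  · exact hout (.inr j) (by simpa [component] using h)
  · omega

theorem joined_outer_iff (ht : t.IsTangle) (u : Vertex N) (x : StackVertex N) :
    Joined t (RawTangle.e r) (outer u) x ↔ u ∈ component t r x := by
  refine ⟨fun h => ?_, fun h => (joined_of_mem_component ht h).symm⟩
  rw [← component_eq_of_joined ht h, component_outer]
  exact Or.inl rfl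

/-- `concatMate` chooses some other outer end of the component; there is exactly one, so the choice
is forced. -/
theorem concatMate_e (ht : t.IsTangle) (u : Vertex N) :
    concatMate t (RawTangle.e r) u = splice t.mate (.inr r.lo) (.inr r.hi) u := by
  have hne : (.inr r.lo : Vertex N) ≠ .inr r.hi := by simpa using r.lo_ne_hi
  have hs := splice_invol ht.1 hne
  have h : ∃ v, v ≠ u ∧ Joined t (RawTangle.e r) (outer u) (outer v) :=
    ⟨_, (hs u).2, joined_outer_splice ht u⟩
  rw [concatMate, dif_pos h]
  obtain ⟨h1, h2⟩ := h.choose_spec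
  have := (joined_outer_iff ht _ _).1 h2.symm
  rw [component_outer] at this
  exact this.resolve_left h1

/-- A loop can only consist of the northern arc of `e_r` and a southern arc of `t` with the same
feet, and its rightmost vertex is the right foot. -/
theorem isLoopEnd_e_iff (ht : t.IsTangle) (j : Fin N) :
    IsLoopEnd t (RawTangle.e r) j ↔ t.mate (.inr r.lo) = .inr r.hi ∧ j = r.hi := by
  have hj1 : ∀ u, Joined t (RawTangle.e r) (1, j) (outer u) ↔ u ∈ component t r (1, j) :=
    fun u => ⟨fun h => (joined_outer_iff ht _ _).1 h.symm,
      fun h => ((joined_outer_iff ht _ _).2 h).symm⟩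
  unfold IsLoopEnd
  simp only [hj1]
  by_cases h : j = r.lo ∨ j = r.hi
  · have hc : component t r (1, j) =
        if t.mate (.inr r.lo) = .inr r.hi then ∅ else {t.mate (.inr r.lo), t.mate (.inr r.hi)} := by
      simp [component, h]
    rw [hc]
    split_ifs with hl
    · simp only [Set.mem_empty_iff_false, not_false_eq_true, implies_true, true_and, hl]
      constructor
      · intro hi
        rcases h with rfl | h
        · have := Fin.le_def.1 (hi r.hi (joined_upper_lo_hi t r))
          rw [r.hi_val] at this
          omega
        · exact h
      · rintro rfl i hi
        have := component_eq_of_joined ht hi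
        rw [hc, if_pos hl] at this
        by_contra hlt
        have h1 : i ≠ r.hi := fun h => hlt (by rw [h])
        have h2 : i ≠ r.lo := fun h => hlt (by
          rw [h, Fin.le_def, r.hi_val]; omega)
        simp [component, h1, h2] at this
        exact (Set.insert_nonempty _ _).ne_empty this.symm
    · simp only [hl, false_and, iff_false]
      rintro ⟨h1, -⟩
      exact h1 _ (Or.inl rfl)
  · rw [not_or] at h
    simp only [h.2, and_false, iff_false]
    rintro ⟨h1, -⟩
    refine h1 (.inr j) ?_
    simp [component, h.1, h.2]

theorem totalLoopExponent_e (ht : t.IsTangle) (w : Fin N → Label) :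
    totalLoopExponent t (RawTangle.e r) w =
      if t.mate (.inr r.lo) = .inr r.hi then loopExponent (w r.hi) else 0 := by
  unfold totalLoopExponent
  simp only [isLoopEnd_e_iff ht]
  split_ifs with h <;> simp [h]

end Generator

/-! ### Positions and tangles -/

section Positions

variable {N : ℕ}

theorem pos_injective : Function.Injective (pos : Vertex N → ℕ) := by
  rintro (i | i) (j | j) h <;> simp only [pos] at h <;> have := i.2 <;> have := j.2
  · rw [Fin.ext h]
  · omega
  · omega
  · rw [Fin.ext (show i.val = j.val by omega)]

theorem pos_inl (i : Fin N) : pos (.inl i : Vertex N) = i.val := rfl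

theorem pos_inr (i : Fin N) : pos (.inr i : Vertex N) = 2 * N - 1 - i.val := rfl

theorem pos_inl_lt_inl {i j : Fin N} : pos (.inl i : Vertex N) < pos (.inl j) ↔ i.val < j.val :=
  Iff.rfl

theorem pos_inr_lt_inr {i j : Fin N} : pos (.inr i : Vertex N) < pos (.inr j) ↔ j.val < i.val := by
  have := i.2
  have := j.2
  rw [pos_inr, pos_inr]
  omega

theorem pos_inl_lt_inr {i j : Fin N} : pos (.inl i : Vertex N) < pos (.inr j) := by
  have := i.2
  have := j.2
  rw [pos_inl, pos_inr]
  omega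

theorem not_pos_inr_lt_inl {i j : Fin N} : ¬ pos (.inr i : Vertex N) < pos (.inl j) :=
  pos_inl_lt_inr.not_gt

theorem strandDegree_comm (north south : Fin N → Label) (u v : Vertex N) :
    strandDegree north south u v = strandDegree north south v u := by
  rcases u with i | i <;> rcases v with j | j <;> simp [strandDegree, max_comm]

-- The pairing exchanges first and last end points, so a symmetric function summed over all vertices
-- counts each strand twice. Working with twice the sum avoids tracking which end represents a
-- strand after stacking.
open Classical in
theorem two_mul_sum_strands {t : RawTangle N} (ht : t.IsTangle) (f : Vertex N → Vertex N → ℤ)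
    (hf : ∀ u v, f u v = f v u) :
    2 * ∑ v, (if v ∈ t.strands then f v (t.mate v) else 0) = ∑ v, f v (t.mate v) := by
  have hinv : Function.Involutive t.mate := fun v => (ht.1 v).1
  have h1 : ∑ v, (if v ∈ t.strands then f v (t.mate v) else 0) =
      ∑ v, (if v ∈ t.strands then 0 else f v (t.mate v)) := by
    rw [← Equiv.sum_comp hinv.toPerm]
    refine Finset.sum_congr rfl fun v _ => ?_
    simp only [Function.Involutive.coe_toPerm, RawTangle.strands, Set.mem_ofPred_eq, hinv v]
    have h2 : pos (t.mate v) ≠ pos v := fun h => (ht.1 v).2 (pos_injective h)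
    rw [hf]
    split_ifs <;> first | rfl | omega
  rw [two_mul]
  nth_rw 2 [h1]
  rw [← Finset.sum_add_distrib]
  refine Finset.sum_congr rfl fun v _ => ?_
  split_ifs <;> simp

end Positions

theorem IsBasisTangle.isDecorated {X : HermitianPair} {t : RawTangle X.size}
    (h : IsBasisTangle X t) : t.IsDecorated := by
  cases X <;> exact h.1

theorem ODT.isTangle {X : HermitianPair} (D : ODT X) : D.tangle.IsTangle :=
  D.isOriented.1.isDecorated.1

theorem ODT.two_mul_strandDegreeSum {X : HermitianPair} (D : ODT X) :
    2 * D.strandDegreeSum =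
      ∑ v, strandDegree D.north.1 D.south.1 v (D.tangle.mate v) :=
  two_mul_sum_strands D.isTangle _ (strandDegree_comm _ _)

/-! ### Additivity of the strand degree under multiplication by a generator -/

theorem oriented_inr_inr {N : ℕ} {i j : Fin N} {l l' : Label}
    (h : Oriented (.inr i) (.inr j) l l') (h1 : l ≠ .circ) (h2 : l' ≠ .circ) :
    l = .up ∧ l' = .down ∨ l = .down ∧ l' = .up := by
  simp only [Oriented, PointsIn, PointsOut, h1, h2, or_false] at h
  tauto

theorem oriented_inl_inr {N : ℕ} {i j : Fin N} {l l' : Label}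
    (h : Oriented (.inr i) (.inl j) l l') (h1 : l ≠ .circ) (h2 : l' ≠ .circ) :
    l = l' := by
  simp only [Oriented, PointsIn, PointsOut, h1, h2, or_false] at h
  rcases h with ⟨rfl, rfl⟩ | ⟨rfl, rfl⟩ <;> rfl

/-- Away from the first point the reflection is a transposition, and it moves the diagram only if
the two symbols differ. -/
theorem lo_label_of_isEdge {X : HermitianPair} {r : Refl X.size} {hr : IsSimple X r} {w v : PW X}
    (h : IsEdge r hr w v) (hlo : 0 < r.lo.val) :
    w.1 r.lo = .up ∧ w.1 r.hi = .down ∨ w.1 r.lo = .down ∧ w.1 r.hi = .up := by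
  rw [isEdge_iff] at h
  have h1 : act X r w.1 ≠ w.1 := fun h' => h.1 (Subtype.ext h')
  rw [act_ne_iff] at h1
  have h2 := w.hi_ne_circ r
  have h3 := w.ne_circ hlo
  rcases r with ⟨i, hi⟩ | hi
  · rw [act_s_lo, act_s_hi] at h1
    generalize w.1 (Refl.lo (.s i hi)) = x at *
    generalize w.1 (Refl.hi (.s i hi)) = y at *
    cases x <;> cases y <;> simp_all
  · exact absurd hlo (lt_irrefl 0)

theorem isEdge_label_of_ne {X : HermitianPair} {r : Refl X.size} {hr : IsSimple X r} {w v : PW X}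
    (h : IsEdge r hr w v) {j : Fin X.size} (h1 : j ≠ r.lo) (h2 : j ≠ r.hi) : v.1 j = w.1 j := by
  rw [isEdge_iff] at h
  obtain ⟨-, rfl | rfl⟩ := h
  · rfl
  · exact act_of_ne r w.1 j h1 h2

/-- The degree of the strand which arises when the strands at the points `lo` and `hi` are joined
from below. -/
theorem strandDegree_mate_mate {X : HermitianPair} {north w v : PW X} {t : RawTangle X.size}
    (ho : IsOriented X north t w) {r : Refl X.size} {hr : IsSimple X r} (he : IsEdge r hr w v)
    (hl : t.mate (.inr r.lo) ≠ .inr r.hi) :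
    strandDegree north.1 w.1 (t.mate (.inr r.lo)) (t.mate (.inr r.hi)) =
      strandDegree north.1 w.1 (.inr r.lo) (t.mate (.inr r.lo)) +
      strandDegree north.1 w.1 (.inr r.hi) (t.mate (.inr r.hi)) +
      (if w.1 r.hi = .down then 1 else 0) := by
  obtain ⟨⟨hm, hcross⟩, -, hexp⟩ := ho.1.isDecorated
  have hlo := lo_label_of_isEdge he
  have hhi := w.hi_ne_circ r
  have hlh := r.hi_val
  have hN := r.hi.2
  have ha := hm (.inr r.lo)
  have hb := hm (.inr r.hi)
  have hc1 := hcross (t.mate (.inr r.hi)) (t.mate (.inr r.lo))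
  have hc2 := hcross (t.mate (.inr r.lo)) (.inr r.hi)
  have hc3 := hcross (.inr r.hi) (.inr r.lo)
  have hob := ho.2.1 (.inr r.hi)
  have hoa := ho.2.1 (.inr r.lo)
  -- Left exposure is tested against the other strand of the pair: whichever strand is enclosed by
  -- the other one carries no bead and is therefore oriented.
  have hxb : .inr r.hi ∈ t.beaded → _ := fun h => not_exists.1 (hexp (.inr r.hi) h)
    (t.mate (.inr r.lo))
  have hxa : .inr r.lo ∈ t.beaded → _ := fun h => not_exists.1 (hexp (.inr r.lo) h) (.inr r.hi)
  have hneb : t.mate (.inr r.hi) ≠ .inr r.lo := fun h => hl (by rw [← h, hb.1])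
  have hab : t.mate (.inr r.lo) ≠ t.mate (.inr r.hi) := fun h => by
    have h1 : (.inr r.lo : Vertex X.size) = .inr r.hi := by rw [← ha.1, h, hb.1]
    exact r.lo_ne_hi (Sum.inr.inj h1)
  rw [ha.1] at *
  rw [hb.1] at *
  have hne := r.lo_ne_hi
  have hnc : ∀ j : Fin X.size, 0 < j.val → w.1 j ≠ .circ := fun j hj => w.ne_circ hj
  have hncn : ∀ j : Fin X.size, 0 < j.val → north.1 j ≠ .circ := fun j hj => north.ne_circ hj
  generalize t.mate (.inr r.lo) = x at *
  generalize t.mate (.inr r.hi) = y at *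
  generalize r.lo = a at *
  generalize r.hi = b at *
  rcases x with i | i <;> rcases y with j | j
  all_goals
    have hi2 := i.2
    have hj2 := j.2
    simp only [pos_inl_lt_inl, pos_inr_lt_inr, pos_inl_lt_inr, not_pos_inr_lt_inl, strandDegree, label,
      true_and, false_and, and_false, not_false_eq_true, Sum.elim_inl, Sum.elim_inr, ne_eq,
      Sum.inr.injEq, Sum.inl.injEq, reduceCtorEq, not_false_eq_true, and_true, Fin.ext_iff] at *
  -- Both strands propagate and become a northern arc. The strand at `hi` lies behind the one at
  -- `lo`, so it is undecorated and its two symbols agree.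
  · have hij : i < j := Fin.lt_def.2 (by omega)
    have hbb : .inr b ∉ t.beaded := fun h => hxb h (by omega)
    have := oriented_inl_inr (hob hbb) hhi (hncn j (by omega))
    rw [max_eq_right hij.le, this, zero_add, zero_add]
  -- The strand at `hi` is a southern arc to the right, hidden behind the propagating strand at
  -- `lo`; its opposite symbols make the last two terms cancel.
  · have hij : b < j := Fin.lt_def.2 (by omega)
    have hbb : .inr b ∉ t.beaded := fun h => hxb h (by omega)
    rw [max_eq_right hij.le]
    rcases oriented_inr_inr (hob hbb) hhi (hnc j (by omega)) with ⟨h1, h2⟩ | ⟨h1, h2⟩ <;>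
      simp [h1, h2]
  -- The strand at `lo` is a southern arc to the left. Its rightmost vertex is `lo`, whose symbol is
  -- opposite to that at `hi`.
  · have hij : i < a := Fin.lt_def.2 (by omega)
    rw [max_eq_left hij.le]
    rcases hlo (by omega) with ⟨h1, h2⟩ | ⟨h1, h2⟩ <;> simp [h1, h2]
  -- Two southern arcs: either one encloses the other, on the left or on the right, or they lie on
  -- either side of the pair. The enclosed one is undecorated.
  · rcases lt_or_gt_of_ne (show i.val ≠ a.val by tauto) with h1 | h1
    · have hia : i < a := Fin.lt_def.2 h1
      rw [max_eq_left hia.le]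
      rcases lt_or_gt_of_ne (show j.val ≠ b.val by tauto) with h2 | h2
      · have hji : j < i := Fin.lt_def.2 (by omega)
        have hjb : j < b := Fin.lt_def.2 h2
        have haa : .inr a ∉ t.beaded := fun h => hxa h (by omega)
        rw [max_eq_left hji.le, max_eq_left hjb.le]
        have h6 : w.1 i ≠ .circ := hnc i (by omega)
        have h7 : w.1 a ≠ .circ := hnc a (by omega)
        rcases oriented_inr_inr (hoa haa) h7 h6 with ⟨h3, h4⟩ | ⟨h3, h4⟩ <;>
          rcases hlo (by omega) with ⟨h1, h2⟩ | ⟨h1, h2⟩ <;> simp_all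
      · have hij : i < j := Fin.lt_def.2 (by omega)
        have hbj : b < j := Fin.lt_def.2 h2
        rw [max_eq_right hij.le, max_eq_right hbj.le]
        rcases hlo (by omega) with ⟨h1, h2⟩ | ⟨h1, h2⟩ <;> simp [h1, h2]
    · have hai : a < i := Fin.lt_def.2 h1
      have hji : j < i := Fin.lt_def.2 (by omega)
      have hbj : b < j := Fin.lt_def.2 (by omega)
      have hbb : .inr b ∉ t.beaded := fun h => hxb h (by omega)
      rw [max_eq_right hai.le, max_eq_left hji.le, max_eq_right hbj.le]
      rcases oriented_inr_inr (hob hbb) hhi (hnc j (by omega)) with ⟨h3, h4⟩ | ⟨h3, h4⟩ <;>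
        simp [h3, h4]

theorem loopExponent_eq (l : Label) :
    loopExponent l = (if l = .down then 1 else 0) - (if l = .up then 1 else 0) := by
  cases l <;> rfl

/-- Multiplication by a generator from below adds its degree to the sum of the strand degrees. -/
theorem strandDegreeSum_concat {X : HermitianPair} (D D' : ODT X) {r : Refl X.size}
    {hr : IsSimple X r} {w v : PW X} (he : IsEdge r hr w v) (hw : D.south = w) (hv : D'.south = v)
    (hn : D'.north = D.north) (ht : ∀ u, D'.tangle.mate u = concatMate D.tangle (RawTangle.e r) u) :
    D'.strandDegreeSum + totalLoopExponent D.tangle (RawTangle.e r) w.1 =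
      D.strandDegreeSum + edgeDegree r hr w v := by
  have h1 := D.two_mul_strandDegreeSum
  have h2 := D'.two_mul_strandDegreeSum
  have hm := D.isTangle.1
  have hlab := fun j h1 h2 => isEdge_label_of_ne he (j := j) h1 h2
  have hloc := strandDegree_mate_mate (hw ▸ D.isOriented) he
  have hne : (.inr r.lo : Vertex X.size) ≠ .inr r.hi := by simpa using r.lo_ne_hi
  simp only [ht, concatMate_e D.isTangle, hn, hv] at h2
  rw [hw] at h1
  rw [totalLoopExponent_e D.isTangle, edgeDegree_eq he]
  have hdeg : ∀ x y : Vertex X.size, x ≠ .inr r.lo → x ≠ .inr r.hi → y ≠ .inr r.lo →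
      y ≠ .inr r.hi → strandDegree D.north.1 v.1 x y = strandDegree D.north.1 w.1 x y := by
    rintro (i | i) (j | j) h1 h2 h3 h4 <;> simp only [strandDegree]
    rw [hlab]
    · intro h
      rcases max_choice i j with h' | h' <;> rw [h'] at h <;> simp_all
    · intro h
      rcases max_choice i j with h' | h' <;> rw [h'] at h <;> simp_all
  have hcap : ∀ u : Fin X.size → Label, strandDegree D.north.1 u (.inr r.lo) (.inr r.hi) =
      if u r.hi = .up then -1 else 0 := by
    intro u
    have : r.lo ≤ r.hi := Fin.le_def.2 (by rw [r.hi_val]; omega)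
    simp only [strandDegree, max_eq_right this]
  have hhi := w.hi_ne_circ r
  have hcomm := fun u x y => strandDegree_comm (N := X.size) D.north.1 u x y
  have hcapv := hcap v.1
  have hcapw := hcap w.1
  generalize D.tangle.mate = m at *
  generalize (.inr r.lo : Vertex X.size) = a at *
  generalize (.inr r.hi : Vertex X.size) = b at *
  -- Only the terms at the two feet and at their mates can change, so the comparison of the degree
  -- sums reduces to any finite set containing these ends.
  have hdiff : ∀ Q : Finset (Vertex X.size), a ∈ Q → b ∈ Q → m a ∈ Q → m b ∈ Q →
      2 * D'.strandDegreeSum - 2 * D.strandDegreeSum =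
        ∑ u ∈ Q, (strandDegree D.north.1 v.1 u (splice m a b u) -
          strandDegree D.north.1 w.1 u (m u)) := by
    intro Q q1 q2 q3 q4
    rw [h1, h2, ← Finset.sum_sub_distrib]
    symm
    refine Finset.sum_subset (Finset.subset_univ _) fun u _ hu => ?_
    have u1 : u ≠ a := fun h => hu (h ▸ q1)
    have u2 : u ≠ b := fun h => hu (h ▸ q2)
    have u3 : u ≠ m a := fun h => hu (h ▸ q3)
    have u4 : u ≠ m b := fun h => hu (h ▸ q4)
    rw [splice_of_ne hm u1 u2 u3 u4, hdeg u (m u) u1 u2 (fun h => u3 (by rw [← h, (hm u).1]))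
      (fun h => u4 (by rw [← h, (hm u).1])), sub_self]
  by_cases hl : m a = b
  -- A loop closes: the southern arc keeps its feet but changes its symbols, and the loop exponent
  -- supplies the difference between the lost arc and the northern arc of the generator.
  · have hl' : m b = a := by rw [← hl, (hm a).1]
    have key := hdiff {a, b} (by simp) (by simp) (by simp [hl]) (by simp [hl'])
    rw [Finset.sum_pair hne, splice_left, splice_right, hl, hl', hcomm _ b a, hcomm _ b a, hcapv,
      hcapw] at key
    rw [if_pos hl]
    rw [loopExponent_eq]
    split_ifs at * <;> omega
  · have hl' : m b ≠ a := fun h => hl (by rw [← h, (hm b).1])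
    have hmab : m a ≠ m b := fun h => hne (by rw [← (hm a).1, h, (hm b).1])
    have key := hdiff {a, b, m a, m b} (by simp) (by simp) (by simp) (by simp)
    rw [Finset.sum_insert (by simp [hne, (hm a).2.symm, hl'.symm]),
      Finset.sum_insert (by simp [Ne.symm hl, (hm b).2.symm]), Finset.sum_pair hmab,
      splice_left, splice_right, splice_mate_left hm hl, splice_mate_right hm hl, (hm a).1, (hm b).1,
      hcomm _ b a, hcapv, hcomm _ (m b) (m a), hcomm _ (m a) a, hcomm _ (m b) b,
      hdeg _ _ (hm a).2 hl hl' (hm b).2, hloc hl] at key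
    rw [if_neg hl]
    split_ifs at * <;> omega

/-! ### Products of generators -/

theorem elt_eq_zero_or {X : HermitianPair} (north : PW X) (t : RawTangle X.size) (south : PW X) :
    elt north t south = 0 ∨ ∃ D : ODT X, elt north t south = D.toTL ∧ D.north = north ∧
      D.tangle = t ∧ D.south = south := by
  by_cases h : IsOriented X north t south
  · exact Or.inr ⟨⟨north, t, south, h⟩, by rw [elt, dif_pos h], rfl, rfl, rfl⟩
  · exact Or.inl (by rw [elt, dif_neg h])

theorem smul_toTL {X : HermitianPair} (a : ℤ[T;T⁻¹]) (D : ODT X) :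
    a • D.toTL = (Finsupp.single D a : ODT X →₀ ℤ[T;T⁻¹]) := by
  have : a • (Finsupp.single D 1 : ODT X →₀ ℤ[T;T⁻¹]) = Finsupp.single D a := by
    rw [Finsupp.smul_single, smul_eq_mul, mul_one]
  exact this

theorem smul_toTL_mul_toTL {X : HermitianPair} (a : ℤ[T;T⁻¹]) (D D' : ODT X) :
    (a • D.toTL) * D'.toTL = a • mulBasis D D' := by
  rw [smul_toTL]
  change Finsupp.sum (Finsupp.single D a) (fun E a => Finsupp.sum (Finsupp.single D' 1)
    fun E' b => (a * b) • mulBasis E E') = _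
  rw [Finsupp.sum_single_index, Finsupp.sum_single_index, mul_one]
  · rw [mul_zero, zero_smul]
  · rw [Finsupp.sum_single_index] <;> rw [zero_mul, zero_smul]

theorem TL.zero_mul {X : HermitianPair} (x : TL X) : (0 : TL X) * x = 0 :=
  Finsupp.sum_zero_index

theorem TL.mul_zero {X : HermitianPair} (x : TL X) : x * (0 : TL X) = 0 := by
  change Finsupp.sum x (fun E a => Finsupp.sum (0 : ODT X →₀ ℤ[T;T⁻¹])
    fun E' b => (a * b) • mulBasis E E') = 0
  simp only [Finsupp.sum_zero_index]
  exact Finset.sum_const_zero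

theorem strandDegreeSum_eq_zero_of_one {X : HermitianPair} {D : ODT X}
    (h : D.tangle = RawTangle.one X.size) : D.strandDegreeSum = 0 := by
  have h1 := D.two_mul_strandDegreeSum
  rw [h, Finset.sum_eq_zero] at h1
  · omega
  · rintro (i | i) _ <;> rfl

/-- A product of generators is zero or a power of `q` times a diagram, of the expected degree. -/
theorem Stroll.elt_eq_zero_or {X : HermitianPair} {u v : PW X} (S : Stroll X u v) :
    S.elt = 0 ∨ ∃ (D : ODT X) (k : ℤ), S.elt = (T k : ℤ[T;T⁻¹]) • D.toTL ∧
      k + D.strandDegreeSum = S.deg := by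
  induction S with
  | nil =>
    rcases OrientedTL.elt_eq_zero_or u (RawTangle.one X.size) u with h | ⟨D, h, -, ht, -⟩
    · exact Or.inl (by simpa only [Stroll.elt] using h)
    · refine Or.inr ⟨D, 0, ?_, ?_⟩
      · rw [T_zero, one_smul]
        simpa only [Stroll.elt] using h
      · rw [strandDegreeSum_eq_zero_of_one ht]; simp only [Stroll.deg, add_zero]
  | @snoc w v S r hr he ih =>
    have hS : (Stroll.snoc S r hr he).elt = S.elt * OrientedTL.elt w (RawTangle.e r) v := by
      simp only [Stroll.elt]
    have hd : (Stroll.snoc S r hr he).deg = S.deg + edgeDegree r hr w v := by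
      simp only [Stroll.deg]
    rw [hS, hd]
    rcases ih with h | ⟨D, k, hD, hk⟩
    · exact Or.inl (by rw [h, TL.zero_mul])
    rcases OrientedTL.elt_eq_zero_or w (RawTangle.e r) v with h | ⟨E, h, hn, ht, hs⟩
    · exact Or.inl (by rw [h, TL.mul_zero])
    rw [hD, h, smul_toTL_mul_toTL, mulBasis]
    split_ifs with hDE
    · rcases OrientedTL.elt_eq_zero_or D.north (concat D E) E.south with h | ⟨F, h, hFn, hFt, hFs⟩
      · exact Or.inl (by rw [h, smul_zero, smul_zero])
      · refine Or.inr ⟨F, k + totalLoopExponent D.tangle E.tangle D.south.1, ?_, ?_⟩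
        · rw [h, smul_smul, T_add]
        · have := strandDegreeSum_concat D F he (hDE.trans hn) (hFs.trans hs) hFn (fun u => by
            rw [hFt, ← ht]; rfl)
          rw [hDE, hn, ht]
          omega
    · exact Or.inl (smul_zero _)

/-! ### The grading by strand degrees -/

/-- The coefficient of `q ^ k D`. -/
noncomputable def TL.coeff {X : HermitianPair} (x : TL X) (D : ODT X) (k : ℤ) : ℤ :=
  (DFunLike.coe (F := ODT X →₀ ℤ[T;T⁻¹]) x D).coeff k

theorem TL.coeff_add {X : HermitianPair} (x y : TL X) (D : ODT X) (k : ℤ) :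
    (x + y).coeff D k = x.coeff D k + y.coeff D k := rfl

theorem TL.coeff_neg {X : HermitianPair} (x : TL X) (D : ODT X) (k : ℤ) :
    (-x).coeff D k = -x.coeff D k := rfl

open Classical in
theorem TL.coeff_smul_toTL {X : HermitianPair} (D E : ODT X) (k l : ℤ) :
    ((T k : ℤ[T;T⁻¹]) • D.toTL).coeff E l = if D = E ∧ k = l then 1 else 0 := by
  rw [smul_toTL]
  change (Finsupp.single D (T k : ℤ[T;T⁻¹]) E).coeff l = _
  rw [Finsupp.single_apply]
  by_cases h : D = E <;> simp [h]

/-- The elements all of whose terms `q ^ k D` have total strand degree `n`. -/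
def strandGraded (X : HermitianPair) (n : ℤ) : AddSubgroup (TL X) where
  carrier := {x | ∀ (D : ODT X) (k : ℤ), x.coeff D k ≠ 0 →
    k + D.strandDegreeSum = n}
  zero_mem' := fun D k h => absurd rfl h
  add_mem' := by
    intro x y hx hy D k h
    by_cases h1 : x.coeff D k = 0
    · exact hy D k fun h2 => h (by rw [TL.coeff_add, h1, h2, add_zero])
    · exact hx D k h1
  neg_mem' := by
    intro x hx D k h
    exact hx D k fun h1 => h (by rw [TL.coeff_neg, h1, neg_zero])

theorem smul_toTL_mem_strandGraded_iff {X : HermitianPair} (D : ODT X) (k n : ℤ) :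
    (T k : ℤ[T;T⁻¹]) • D.toTL ∈ strandGraded X n ↔ k + D.strandDegreeSum = n := by
  constructor
  · intro h
    refine h D k ?_
    rw [TL.coeff_smul_toTL, if_pos ⟨rfl, rfl⟩]
    exact one_ne_zero
  · intro h E l hE
    rw [TL.coeff_smul_toTL] at hE
    obtain ⟨rfl, rfl⟩ : D = E ∧ k = l := by
      by_contra hc
      exact hE (if_neg hc)
    exact h

/-- A product of generators is zero or a single monomial with the right total, so the spanning
elements already lie on the right-hand side. -/
theorem homogeneous_le_strandGraded (X : HermitianPair) (n : ℤ) :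
    homogeneous X n ≤ strandGraded X n := by
  refine (AddSubgroup.closure_le _).2 ?_
  rintro _ ⟨u, v, S, m, hm, rfl⟩
  rcases S.elt_eq_zero_or with h | ⟨D, k, h, hk⟩
  · rw [h, smul_zero]
    exact (strandGraded X n).zero_mem
  · rw [h, smul_smul, ← T_add]
    exact (smul_toTL_mem_strandGraded_iff D _ n).2 (by omega)

theorem eq_strandDegreeSum_of_mem_homogeneous {X : HermitianPair} {D : ODT X} {n : ℤ}
    (h : D.toTL ∈ homogeneous X n) : n = D.strandDegreeSum := by
  have h1 := homogeneous_le_strandGraded X n h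
  have h2 := (smul_toTL_mem_strandGraded_iff D 0 n).1 (by rwa [T_zero, one_smul])
  omega

/-! ### Cutting a southern arc -/

section Surgery

variable {N : ℕ}

/-- The column of a vertex. -/
def col : Vertex N → ℕ := Sum.elim Fin.val Fin.val

theorem RawTangle.IsTangle.mem_interval {t : RawTangle N} (ht : t.IsTangle) {x c : Vertex N}
    (h1 : pos x < pos c) (h2 : pos c < pos (t.mate x)) :
    pos x < pos (t.mate c) ∧ pos (t.mate c) < pos (t.mate x) := by
  obtain ⟨hm, hc⟩ := ht
  have h3 := hc x c
  have h4 := hc (t.mate c) x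
  rw [(hm c).1] at h4
  have h5 : pos (t.mate c) ≠ pos x := fun h => by
    rw [← pos_injective h, (hm c).1] at h2
    exact lt_irrefl _ h2
  have h6 : pos (t.mate c) ≠ pos (t.mate x) := fun h => by
    have h7 : c = x := by rw [← (hm c).1, pos_injective h, (hm x).1]
    rw [h7] at h1
    exact lt_irrefl _ h1
  omega

/-- A southern arc joining two neighbouring points, together with a vertex `z` on the boundary of
the region above the arc. The strand at `z` is either decorated or passes over the arc. -/
structure CutData (t : RawTangle N) (r : Refl N) (z : Vertex N) : Prop where
  isDecorated : t.IsDecorated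
  mate_lo : t.mate (.inr r.lo) = .inr r.hi
  lo_lt : r.lo.val < pos z
  lt_hi : pos z < pos (.inr r.hi : Vertex N)
  crossing : col (t.mate z) ≤ r.lo.val ∨ z ∈ t.beaded
  maximal : ∀ w, pos z < pos w → pos w < pos (.inr r.hi : Vertex N) →
    r.lo.val < col (t.mate w) ∧ w ∉ t.beaded

theorem pos_lo (r : Refl N) : pos (.inr r.lo : Vertex N) = pos (.inr r.hi : Vertex N) + 1 := by
  have := r.hi_val
  have := r.hi.2
  simp only [pos_inr]
  omega

/-- The vertices to the right of the vertical line between the feet of the arc form an interval in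
clockwise order, which ends at the right foot. -/
theorem lt_col_iff (r : Refl N) (v : Vertex N) :
    r.lo.val < col v ↔ r.lo.val < pos v ∧ pos v ≤ pos (.inr r.hi : Vertex N) := by
  have h1 := r.hi_val
  have h2 := r.hi.2
  rcases v with i | i <;> have := i.2 <;>
    simp only [pos_inl, pos_inr, col, Sum.elim_inl, Sum.elim_inr] <;> omega

namespace CutData

variable {t : RawTangle N} {r : Refl N} {z : Vertex N}

theorem mate_hi (h : CutData t r z) : t.mate (.inr r.hi) = .inr r.lo := by
  rw [← h.mate_lo, (h.isDecorated.1.1 _).1]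

theorem ne_of_pos {u v : Vertex N} (h : pos u ≠ pos v) : u ≠ v := fun h' => h (by rw [h'])

theorem ne_hi (h : CutData t r z) : z ≠ .inr r.hi := ne_of_pos h.lt_hi.ne

theorem ne_lo (h : CutData t r z) : z ≠ .inr r.lo :=
  ne_of_pos (by have := h.lt_hi; rw [pos_lo]; omega)

theorem mate_ne_hi (h : CutData t r z) : t.mate z ≠ .inr r.hi := fun h' =>
  h.ne_lo (by rw [← h.mate_hi, ← h', (h.isDecorated.1.1 _).1])

theorem mate_ne_lo (h : CutData t r z) : t.mate z ≠ .inr r.lo := fun h' =>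
  h.ne_hi (by rw [← h.mate_lo, ← h', (h.isDecorated.1.1 _).1])

theorem lo_lt_col (h : CutData t r z) : r.lo.val < col z :=
  (lt_col_iff r z).2 ⟨h.lo_lt, h.lt_hi.le⟩

theorem mem_beaded_mate_iff (ht : t.IsDecorated) (v : Vertex N) :
    t.mate v ∈ t.beaded ↔ v ∈ t.beaded := by
  refine ⟨fun h => ?_, ht.2.1 v⟩
  have := ht.2.1 _ h
  rwa [(ht.1.1 v).1] at this

/-- Otherwise the strand at `z` would stay on the right of the vertical line and, by maximality, be
undecorated, contrary to the choice of `z`. -/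
theorem mate_outside (h : CutData t r z) :
    pos (t.mate z) < pos z ∨ pos (.inr r.lo : Vertex N) < pos (t.mate z) := by
  by_contra! hc
  have h1 : pos (t.mate z) ≠ pos z := fun h' => (h.isDecorated.1.1 z).2 (pos_injective h')
  have h2 : pos (t.mate z) ≠ pos (.inr r.hi : Vertex N) := fun h' => h.mate_ne_hi (pos_injective h')
  have h3 : pos (t.mate z) ≠ pos (.inr r.lo : Vertex N) := fun h' => h.mate_ne_lo (pos_injective h')
  have h4 := pos_lo r
  have h5 := h.maximal (t.mate z) (by omega) (by omega)
  rw [mem_beaded_mate_iff h.isDecorated] at h5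
  have h6 := h.crossing.resolve_right h5.2
  have h7 := (lt_col_iff r (t.mate z)).2 ⟨by have := h.lo_lt; omega, by omega⟩
  omega

/-- A strand leaving the gap between `z` and the arc ends to the right of the vertical line, so it
either crosses the strand at `z` or encloses it. An enclosed strand can neither be decorated nor
reach across the line, which contradicts the choice of `z`. -/
theorem mem_gap (h : CutData t r z) {w : Vertex N} (h1 : pos z < pos w)
    (h2 : pos w < pos (.inr r.hi : Vertex N)) :
    pos z < pos (t.mate w) ∧ pos (t.mate w) < pos (.inr r.hi : Vertex N) := by
  have hm := h.isDecorated.1.1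
  have hlo := pos_lo r
  have hout := h.mate_outside
  have h3 := (lt_col_iff r _).1 (h.maximal w h1 h2).1
  have h4 : pos (t.mate w) ≠ pos (.inr r.hi : Vertex N) := fun h' => by
    have h5 : w = .inr r.lo := by rw [← (hm w).1, pos_injective h', h.mate_hi]
    rw [h5] at h2
    omega
  have h5 : pos (t.mate w) ≠ pos z := fun h' => by
    have h6 : w = t.mate z := by rw [← pos_injective h', (hm w).1]
    rw [← h6] at hout
    omega
  have h6 : pos (t.mate w) ≠ pos (t.mate z) := fun h' => by
    have h7 : w = z := by rw [← (hm w).1, pos_injective h', (hm z).1]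
    rw [h7] at h1
    omega
  refine ⟨?_, by omega⟩
  by_contra hc
  have hc1 := h.isDecorated.1.2 (t.mate z) (t.mate w)
  have hc2 := h.isDecorated.1.2 (t.mate w) z
  rw [(hm w).1, (hm z).1] at hc1
  rw [(hm w).1] at hc2
  rcases hout with h7 | h7
  · have h8 : pos (t.mate w) < pos (t.mate z) := by omega
    have h9 : z ∉ t.beaded := fun hz => by
      refine h.isDecorated.2.2 z hz ⟨t.mate w, ?_⟩
      rw [(hm w).1]
      omega
    have h10 := h.crossing.resolve_right h9
    have h11 := lt_col_iff r (t.mate z)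
    omega
  · omega

/-- The pairing in which the arc and the strand at `z` are cut and joined to two strands. -/
def _root_.OrientedTL.cutMate (t : RawTangle N) (r : Refl N) (z : Vertex N) :
    Vertex N → Vertex N :=
  splice t.mate (.inr r.lo) (t.mate z)

theorem cutMate_invol (h : CutData t r z) (v : Vertex N) :
    cutMate t r z (cutMate t r z v) = v ∧ cutMate t r z v ≠ v :=
  splice_invol h.isDecorated.1.1 h.mate_ne_lo.symm v

theorem cutMate_lo : cutMate t r z (.inr r.lo) = t.mate z := splice_left

theorem cutMate_mate : cutMate t r z (t.mate z) = .inr r.lo := splice_right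

theorem cutMate_hi (h : CutData t r z) : cutMate t r z (.inr r.hi) = z := by
  have hm := h.isDecorated.1.1
  have := splice_mate_left (a := .inr r.lo) (b := t.mate z) hm
    (by rw [h.mate_lo]; exact h.mate_ne_hi.symm)
  rwa [h.mate_lo, (hm z).1] at this

theorem cutMate_self (h : CutData t r z) : cutMate t r z z = .inr r.hi := by
  have := (h.cutMate_invol (.inr r.hi)).1
  rwa [h.cutMate_hi] at this

theorem cutMate_of_ne (h : CutData t r z) {u : Vertex N} (h1 : u ≠ .inr r.lo) (h2 : u ≠ .inr r.hi)
    (h3 : u ≠ t.mate z) (h4 : u ≠ z) : cutMate t r z u = t.mate u :=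
  splice_of_ne h.isDecorated.1.1 h1 h3 (by rwa [h.mate_lo])
    (by rwa [(h.isDecorated.1.1 z).1])

/-- By `mem_gap` no strand separates `z` from the right foot, so the ends can be rejoined without
crossings. It suffices that each interval spanned by a new strand is closed under the new pairing.
-/
theorem cutMate_isTangle (h : CutData t r z) (B : Set (Vertex N)) :
    RawTangle.IsTangle ⟨cutMate t r z, B⟩ := by
  have hm := h.isDecorated.1.1
  refine ⟨h.cutMate_invol, ?_⟩
  dsimp only
  have hlo := pos_lo r
  have hout := h.mate_outside
  have hgap := fun w => h.mem_gap (w := w)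
  have hin := fun x c => RawTangle.IsTangle.mem_interval h.isDecorated.1 (x := x) (c := c)
  have ha : t.mate (.inr r.lo) = .inr r.hi := h.mate_lo
  have hb := h.mate_hi
  have hzb := h.lt_hi
  have hzz : t.mate (t.mate z) = z := (hm z).1
  have s1 := cutMate_lo (t := t) (r := r) (z := z)
  have s2 := cutMate_mate (t := t) (r := r) (z := z)
  have s3 := h.cutMate_hi
  have s4 := h.cutMate_self
  have s5 := fun u => h.cutMate_of_ne (u := u)
  have hinj : ∀ u v : Vertex N, u ≠ v → pos u ≠ pos v := fun u v h h' => h (pos_injective h')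
  generalize cutMate t r z = m' at *
  generalize hzy : t.mate z = y at *
  generalize (.inr r.lo : Vertex N) = a at *
  generalize (.inr r.hi : Vertex N) = b at *
  -- The interval spanned by a strand is closed under the new pairing.
  have key : ∀ x c, pos x < pos c → pos c < pos (m' x) → pos c < pos (m' c) →
      pos (m' c) < pos (m' x) := by
    intro x c h1 h2 h3
    have hQ : ∀ u, u = a ∨ u = b ∨ u = y ∨ u = z ∨ (u ≠ a ∧ u ≠ b ∧ u ≠ y ∧ u ≠ z) := by
      intro u; tauto
    have hm2 : ∀ u, t.mate (t.mate u) = u := fun u => (hm u).1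
    rcases hQ x with hx | hx | hx | hx | ⟨xa, xb, xy, xz⟩
    · rw [hx, s1] at h2 ⊢
      rw [hx] at h1
      rcases hQ c with hc | hc | hc | hc | ⟨ca, cb, cy, cz⟩
      · rw [hc] at h1 h2; omega
      · rw [hc] at h1 h2; omega
      · rw [hc] at h1 h2; omega
      · rw [hc] at h1 h2; omega
      · rw [s5 c ca cb cy cz] at h3 ⊢
        have h4 := hin z c
        rw [hzy] at h4
        have h5 := hgap (t.mate c)
        rw [hm2] at h5
        omega
    · rw [hx, s3] at h2
      rw [hx] at h1
      omega
    · rw [hx, s2] at h2 ⊢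
      rw [hx] at h1
      rcases hQ c with hc | hc | hc | hc | ⟨ca, cb, cy, cz⟩
      · rw [hc] at h1 h2; omega
      · rw [hc, s3]; omega
      · rw [hc] at h1 h2; omega
      · rw [hc, s4]; omega
      · rw [s5 c ca cb cy cz] at h3 ⊢
        have h4 := hin y c h1
        rw [hzz] at h4
        have := hgap c
        have := hinj c z cz
        have := hinj c b cb
        omega
    · rw [hx, s4] at h2 ⊢
      rw [hx] at h1
      have h4 := hgap c h1 h2
      rcases hQ c with hc | hc | hc | hc | ⟨ca, cb, cy, cz⟩
      · rw [hc] at h1 h2; omega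
      · rw [hc] at h1 h2; omega
      · rw [hc] at h1 h2; omega
      · rw [hc] at h1 h2; omega
      · rw [s5 c ca cb cy cz]; omega
    · rw [s5 x xa xb xy xz] at h2 ⊢
      have ia := hin x a
      have ib := hin x b
      have iy := hin x y
      have iz := hin x z
      rw [hzy] at iz
      have g1 := hgap x
      have g2 := hgap (t.mate x)
      have n1 := hinj _ _ xz
      have n2 := hinj _ _ xb
      have n5 := hinj _ _ xy
      have n3 := hinj (t.mate x) z fun h' => xy (by rw [← hm2 x, h', hzy])
      have n4 := hinj (t.mate x) b fun h' => xa (by rw [← hm2 x, h', hb])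
      have n6 := hinj (t.mate x) a fun h' => xb (by rw [← hm2 x, h', ha])
      rw [hm2] at g2
      rw [ha] at ia
      rw [hb] at ib
      rw [hzz] at iy
      rcases hQ c with hc | hc | hc | hc | ⟨ca, cb, cy, cz⟩
      · rw [hc, s1] at h3 ⊢
        rw [hc] at h1 h2
        omega
      · rw [hc, s3] at h3 ⊢
        rw [hc] at h1 h2
        omega
      · rw [hc, s2] at h3 ⊢
        rw [hc] at h1 h2
        omega
      · rw [hc, s4] at h3 ⊢
        rw [hc] at h1 h2
        omega
      · rw [s5 c ca cb cy cz]
        exact (hin x c h1 h2).2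
  rintro x c ⟨h1, h2, h3⟩
  exact absurd (key x c h1 h2 (h2.trans h3)) h3.not_gt

/-- The decorations after cutting: the strand which is no longer below the other one may be
decorated. -/
def _root_.OrientedTL.cutBeaded (t : RawTangle N) (r : Refl N) (z : Vertex N) (β : Prop) :
    Set (Vertex N) :=
  {v | v ∈ t.beaded ∧ v ≠ .inr r.lo ∧ v ≠ .inr r.hi ∧ v ≠ t.mate z ∧ v ≠ z ∨
    β ∧ (v = .inr r.lo ∨ v = t.mate z)}

/-- The tangle obtained by cutting. -/
def _root_.OrientedTL.cut (t : RawTangle N) (r : Refl N) (z : Vertex N) (β : Prop) : RawTangle N :=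
  ⟨cutMate t r z, cutBeaded t r z β⟩

variable {β : Prop}

theorem mem_cut_beaded (v : Vertex N) : v ∈ (cut t r z β).beaded ↔
    v ∈ t.beaded ∧ v ≠ .inr r.lo ∧ v ≠ .inr r.hi ∧ v ≠ t.mate z ∧ v ≠ z ∨
      β ∧ (v = .inr r.lo ∨ v = t.mate z) := Iff.rfl

theorem lo_mem_cut : .inr r.lo ∈ (cut t r z β).beaded ↔ β := by
  simp [mem_cut_beaded]

theorem mate_mem_cut : t.mate z ∈ (cut t r z β).beaded ↔ β := by
  simp [mem_cut_beaded]

theorem hi_notMem_cut (h : CutData t r z) : .inr r.hi ∉ (cut t r z β).beaded := by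
  rw [mem_cut_beaded]
  simp [h.mate_ne_hi.symm, r.lo_ne_hi.symm]

theorem self_notMem_cut (h : CutData t r z) : z ∉ (cut t r z β).beaded := by
  rw [mem_cut_beaded]
  simp [h.ne_lo, (h.isDecorated.1.1 z).2.symm]

theorem mem_cut_iff_of_ne {u : Vertex N} (h1 : u ≠ .inr r.lo) (h2 : u ≠ .inr r.hi)
    (h3 : u ≠ t.mate z) (h4 : u ≠ z) : u ∈ (cut t r z β).beaded ↔ u ∈ t.beaded := by
  simp [mem_cut_beaded, h1, h2, h3, h4]

theorem mate_ne_of_ne (h : CutData t r z) {u : Vertex N} (h1 : u ≠ .inr r.lo) (h2 : u ≠ .inr r.hi)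
    (h3 : u ≠ t.mate z) (h4 : u ≠ z) : t.mate u ≠ .inr r.lo ∧ t.mate u ≠ .inr r.hi ∧
      t.mate u ≠ t.mate z ∧ t.mate u ≠ z := by
  have hm := h.isDecorated.1.1
  refine ⟨fun h' => h2 ?_, fun h' => h1 ?_, fun h' => h4 ?_, fun h' => h3 ?_⟩
  · rw [← (hm u).1, h', h.mate_lo]
  · rw [← (hm u).1, h', h.mate_hi]
  · rw [← (hm u).1, h', (hm z).1]
  · rw [← (hm u).1, h']

/-- The new decorated strand takes over the exposure of an old one, and every other decorated strand
remains visible because no bead lies in the gap between `z` and the arc. -/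
theorem cut_isDecorated (h : CutData t r z)
    (hβ : β → z ∈ t.beaded ∨ .inr r.lo ∈ t.beaded) : (cut t r z β).IsDecorated := by
  have hm := h.isDecorated.1.1
  have hlo := pos_lo r
  have hout := h.mate_outside
  have hgap := fun w => h.mem_gap (w := w)
  have hmax := h.maximal
  have hzb := h.lt_hi
  have hinj : ∀ u v : Vertex N, u ≠ v → pos u ≠ pos v := fun u v h h' => h (pos_injective h')
  have hmz : t.mate (t.mate z) = z := (hm z).1
  refine ⟨h.cutMate_isTangle _, ?_, ?_⟩
  · intro v hv
    change cutMate t r z v ∈ _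
    rcases hv with ⟨hv, h1, h2, h3, h4⟩ | ⟨hb, rfl | rfl⟩
    · rw [h.cutMate_of_ne h1 h2 h3 h4]
      exact Or.inl ⟨h.isDecorated.2.1 v hv, h.mate_ne_of_ne h1 h2 h3 h4⟩
    · rw [cutMate_lo]
      exact Or.inr ⟨hb, Or.inr rfl⟩
    · rw [cutMate_mate]
      exact Or.inr ⟨hb, Or.inl rfl⟩
  -- A strand hiding the new decorated strand from the left edge would already hide the decorated
  -- strand at `z` or the decorated arc.
  · have main : β → ∀ c, pos c < pos (.inr r.lo : Vertex N) → pos c < pos (t.mate z) →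
        pos (.inr r.lo : Vertex N) < pos (cutMate t r z c) →
        pos (t.mate z) < pos (cutMate t r z c) → False := by
      intro hb c c1 c2 c3 c4
      by_cases ca : c = .inr r.lo
      · rw [ca] at c1; exact lt_irrefl _ c1
      by_cases cb : c = .inr r.hi
      · rw [cb, h.cutMate_hi] at c3; omega
      by_cases cy : c = t.mate z
      · rw [cy] at c2; exact lt_irrefl _ c2
      by_cases cz : c = z
      · rw [cz, h.cutMate_self] at c3; omega
      rw [h.cutMate_of_ne ca cb cy cz] at c3 c4
      have := hinj c _ cb
      have := hinj c _ cz
      have := hgap c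
      rcases hβ hb with hz | ha
      · exact h.isDecorated.2.2 z hz ⟨c, by omega⟩
      · refine h.isDecorated.2.2 _ ha ⟨c, ?_⟩
        rw [h.mate_lo]
        omega
    rintro v hv ⟨c, hc⟩
    change pos c < pos v ∧ pos c < pos (cutMate t r z v) ∧
      pos v < pos (cutMate t r z c) ∧ pos (cutMate t r z v) < pos (cutMate t r z c) at hc
    rcases hv with ⟨hv, h1, h2, h3, h4⟩ | ⟨hb, rfl | rfl⟩
    · rw [h.cutMate_of_ne h1 h2 h3 h4] at hc
      have hexp := h.isDecorated.2.2 v hv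
      obtain ⟨-, h2', -, h4'⟩ := h.mate_ne_of_ne h1 h2 h3 h4
      have m1 : ¬ (pos z < pos v ∧ pos v < pos (.inr r.hi : Vertex N)) := fun hh =>
        (hmax v hh.1 hh.2).2 hv
      have m2 : ¬ (pos z < pos (t.mate v) ∧ pos (t.mate v) < pos (.inr r.hi : Vertex N)) :=
        fun hh => (hmax _ hh.1 hh.2).2 (h.isDecorated.2.1 v hv)
      have n1 := hinj _ _ h2
      have n2 := hinj _ _ h4
      have n3 := hinj _ _ h2'
      have n4 := hinj _ _ h4'
      by_cases ca : c = .inr r.lo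
      · rw [ca, cutMate_lo] at hc
        exact hexp ⟨z, by omega⟩
      by_cases cb : c = .inr r.hi
      · rw [cb, h.cutMate_hi] at hc
        omega
      by_cases cy : c = t.mate z
      · rw [cy, cutMate_mate] at hc
        refine hexp ⟨t.mate z, ?_⟩
        rw [hmz]
        omega
      by_cases cz : c = z
      · rw [cz, h.cutMate_self] at hc
        omega
      rw [h.cutMate_of_ne ca cb cy cz] at hc
      exact hexp ⟨c, hc⟩
    · rw [cutMate_lo] at hc
      exact main hb c hc.1 hc.2.1 hc.2.2.1 hc.2.2.2
    · rw [cutMate_mate] at hc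
      exact main hb c hc.2.1 hc.1 hc.2.2.2 hc.2.2.1

/-- Sums over the vertices change under cutting only by the terms of the four affected ends. -/
theorem sum_sub_sum (h : CutData t r z) (f g : Vertex N → ℤ)
    (hfg : ∀ u, u ≠ .inr r.lo → u ≠ .inr r.hi → u ≠ t.mate z → u ≠ z → f u = g u) :
    ∑ u, f u - ∑ u, g u = (f (.inr r.lo) - g (.inr r.lo)) + (f (.inr r.hi) - g (.inr r.hi)) +
      (f (t.mate z) - g (t.mate z)) + (f z - g z) := by
  have hne : (.inr r.lo : Vertex N) ≠ .inr r.hi := by simpa using r.lo_ne_hi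
  have key : ∑ u ∈ {.inr r.lo, .inr r.hi, t.mate z, z}, (f u - g u) = ∑ u, (f u - g u) := by
    refine Finset.sum_subset (Finset.subset_univ _) fun u _ hu => ?_
    simp only [Finset.mem_insert, Finset.mem_singleton, not_or] at hu
    rw [hfg u hu.1 hu.2.1 hu.2.2.1 hu.2.2.2, sub_self]
  rw [← Finset.sum_sub_distrib, ← key,
    Finset.sum_insert (by simp [hne, h.mate_ne_lo.symm, h.ne_lo.symm]),
    Finset.sum_insert (by simp [h.mate_ne_hi.symm, h.ne_hi.symm]),
    Finset.sum_pair (h.isDecorated.1.1 z).2]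
  ring

end CutData

/-! ### Number of beads and weight after cutting -/

open Classical in
theorem ncard_beaded_inter_strands {t : RawTangle N} (ht : t.IsDecorated) :
    2 * ((t.beaded ∩ t.strands).ncard : ℤ) = ∑ v, if v ∈ t.beaded then 1 else 0 := by
  have key := two_mul_sum_strands ht.1 (fun u v => if u ∈ t.beaded ∧ v ∈ t.beaded then 1 else 0)
    (fun u v => by simp only [and_comm])
  have h1 : ∀ v, (v ∈ t.beaded ∧ t.mate v ∈ t.beaded) ↔ v ∈ t.beaded := fun v =>
    ⟨fun h => h.1, fun h => ⟨h, ht.2.1 v h⟩⟩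
  simp only [h1] at key
  rw [← key, Set.ncard_eq_toFinset_card']
  congr 1
  rw [← Finset.sum_filter, ← Finset.sum_filter, Finset.sum_const, nsmul_eq_mul, mul_one]
  congr 2
  ext v
  simp [and_comm]

open Classical in
theorem CutData.ncard_cut {t : RawTangle N} {r : Refl N} {z : Vertex N} {β : Prop}
    (h : CutData t r z) (hβ : β → z ∈ t.beaded ∨ .inr r.lo ∈ t.beaded) :
    (((cut t r z β).beaded ∩ (cut t r z β).strands).ncard : ℤ) +
      (if .inr r.lo ∈ t.beaded then 1 else 0) + (if z ∈ t.beaded then 1 else 0) =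
      (t.beaded ∩ t.strands).ncard + (if β then 1 else 0) := by
  have h1 := ncard_beaded_inter_strands (h.cut_isDecorated hβ)
  have h2 := ncard_beaded_inter_strands h.isDecorated
  have h3 := h.sum_sub_sum (fun v => if v ∈ (cut t r z β).beaded then 1 else 0)
    (fun v => if v ∈ t.beaded then 1 else 0) (fun u h1 h2 h3 h4 => by
      simp only [mem_cut_iff_of_ne h1 h2 h3 h4])
  have h4 : (.inr r.hi : Vertex N) ∈ t.beaded ↔ .inr r.lo ∈ t.beaded := by
    rw [← h.mate_lo, mem_beaded_mate_iff h.isDecorated]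
  simp only [lo_mem_cut, mate_mem_cut, h.hi_notMem_cut, h.self_notMem_cut, h4,
    mem_beaded_mate_iff h.isDecorated, if_false] at h3
  split_ifs at * <;> omega

open Classical in
/-- Twice the number of crossings of the strands with vertical lines, where a decorated strand is
drawn such that it touches the left edge. -/
noncomputable def weight (t : RawTangle N) : ℤ :=
  ∑ v, if v ∈ t.beaded then (col v + col (t.mate v) : ℤ) else |(col v : ℤ) - col (t.mate v)|

theorem weight_nonneg (t : RawTangle N) : 0 ≤ weight t :=
  Finset.sum_nonneg fun v _ => by split_ifs <;> positivity

/-- After cutting, the vertical line between the feet is crossed less often. A change in the drawing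
between decorated and undecorated is harmless if the left foot is in the first column, since a
strand from there has the same weight with and without a bead. -/
theorem CutData.weight_cut_lt {t : RawTangle N} {r : Refl N} {z : Vertex N} {β : Prop}
    (h : CutData t r z) (hlo : β ∧ z ∉ t.beaded ∨ ¬ β ∧ z ∈ t.beaded → r.lo.val = 0) :
    weight (cut t r z β) < weight t := by
  classical
  have hm := h.isDecorated.1.1
  have h3 := h.sum_sub_sum
    (fun v => if v ∈ (cut t r z β).beaded then (col v + col ((cut t r z β).mate v) : ℤ)
      else |(col v : ℤ) - col ((cut t r z β).mate v)|)
    (fun v => if v ∈ t.beaded then (col v + col (t.mate v) : ℤ)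
      else |(col v : ℤ) - col (t.mate v)|) (fun u h1 h2 h3 h4 => by
      simp only [mem_cut_iff_of_ne h1 h2 h3 h4]
      rw [show (cut t r z β).mate u = t.mate u from h.cutMate_of_ne h1 h2 h3 h4])
  have h4 : (.inr r.hi : Vertex N) ∈ t.beaded ↔ .inr r.lo ∈ t.beaded := by
    rw [← h.mate_lo, mem_beaded_mate_iff h.isDecorated]
  have e1 : (cut t r z β).mate (.inr r.lo) = t.mate z := cutMate_lo
  have e2 : (cut t r z β).mate (.inr r.hi) = z := h.cutMate_hi
  have e3 : (cut t r z β).mate (t.mate z) = .inr r.lo := cutMate_mate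
  have e4 : (cut t r z β).mate z = .inr r.hi := h.cutMate_self
  simp only [lo_mem_cut, mate_mem_cut, h.hi_notMem_cut, h.self_notMem_cut, h4, e1, e2, e3, e4,
    mem_beaded_mate_iff h.isDecorated, if_false, h.mate_lo, h.mate_hi, (hm z).1] at h3
  change weight _ - weight _ = _ at h3
  have c1 : col (.inr r.hi : Vertex N) = r.lo.val + 1 := r.hi_val
  have c2 : col (.inr r.lo : Vertex N) = r.lo.val := rfl
  have c3 := h.lo_lt_col
  have c4 := h.crossing
  rw [c1, c2] at h3
  push_cast at h3
  have a1 : |(r.lo.val : ℤ) - (r.lo.val + 1)| = 1 := by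
    rw [show (r.lo.val : ℤ) - (r.lo.val + 1) = -1 by ring]; rfl
  have a2 : |(r.lo.val : ℤ) + 1 - r.lo.val| = 1 := by
    rw [show (r.lo.val : ℤ) + 1 - r.lo.val = 1 by ring]; rfl
  have a3 : |(r.lo.val : ℤ) + 1 - col z| = col z - r.lo.val - 1 := by
    rw [abs_of_nonpos (by omega)]; ring
  have a4 : |(col z : ℤ) - (r.lo.val + 1)| = col z - r.lo.val - 1 := by
    rw [abs_of_nonneg (by omega)]; ring
  rw [a1, a2, a3, a4] at h3
  have a5 := abs_sub_comm (col (t.mate z) : ℤ) (r.lo.val : ℤ)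
  have a6 := abs_sub_comm (col (t.mate z) : ℤ) (col z : ℤ)
  rw [a5, a6] at h3
  have b1 := abs_cases ((r.lo.val : ℤ) - col (t.mate z))
  have b2 := abs_cases ((col z : ℤ) - col (t.mate z))
  generalize weight (cut t r z β) = W at *
  by_cases hb : β <;> by_cases hz : z ∈ t.beaded <;>
    simp only [hb, hz, if_true, if_false, not_true, not_false_eq_true, and_true, and_false,
      or_true, or_false, forall_const] at h3 hlo c4 <;>
    split_ifs at h3 <;> omega

end Surgery

/-! ### Existence of an arc and of a strand to cut -/

section ExistsCut

variable {N : ℕ}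

theorem card_filter_pos (l p : ℕ) (hp : p ≤ 2 * N) :
    (Finset.univ.filter fun w : Vertex N => l < pos w ∧ pos w < p).card = p - l - 1 := by
  rw [← Finset.card_image_of_injective _ pos_injective, ← Nat.card_Ioo]
  congr 1
  ext k
  simp only [Finset.mem_image, Finset.mem_filter, Finset.mem_univ, true_and, Finset.mem_Ioo]
  constructor
  · rintro ⟨w, h, rfl⟩
    exact h
  · intro h
    by_cases hk : k < N
    · exact ⟨.inl ⟨k, hk⟩, h, rfl⟩
    · have hN : 2 * N - 1 - k < N := by omega
      have hpos : pos (.inr ⟨2 * N - 1 - k, hN⟩ : Vertex N) = k := by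
        rw [pos_inr]
        simp only
        omega
      exact ⟨.inr ⟨2 * N - 1 - k, hN⟩, by rwa [hpos], hpos⟩

/-- By parity: to the right of the line, apart from the right foot, there is an odd number of
vertices, and the pairing has no fixed points, so it cannot preserve this set. -/
theorem exists_crossing {t : RawTangle N} (ht : t.IsTangle) {r : Refl N}
    (hm : t.mate (.inr r.lo) = .inr r.hi) :
    ∃ w, r.lo.val < pos w ∧ pos w < pos (.inr r.hi : Vertex N) ∧ col (t.mate w) ≤ r.lo.val := by
  by_contra! hc
  have hhi := r.hi_val
  have hN := r.hi.2
  have hpos : pos (.inr r.hi : Vertex N) = 2 * N - 2 - r.lo.val := by rw [pos_inr]; omega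
  have hcard := card_filter_pos (N := N) r.lo.val (pos (.inr r.hi : Vertex N)) (by omega)
  have hzero : ∑ w ∈ (Finset.univ.filter fun w : Vertex N =>
      r.lo.val < pos w ∧ pos w < pos (.inr r.hi : Vertex N)), (1 : ZMod 2) = 0 := by
    refine Finset.sum_involution (fun w _ => t.mate w) (fun _ _ => by decide)
      (fun w _ _ => (ht.1 w).2) ?_ (fun w _ => (ht.1 w).1)
    intro w hw
    simp only [Finset.mem_filter, Finset.mem_univ, true_and] at hw ⊢
    have h1 := (lt_col_iff r _).1 (hc w hw.1 hw.2)
    refine ⟨h1.1, lt_of_le_of_ne h1.2 fun h => ?_⟩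
    have h2 : w = .inr r.lo := by rw [← (ht.1 w).1, pos_injective h, ← hm, (ht.1 _).1]
    rw [h2, pos_lo] at hw
    omega
  -- The set has `2 * N - 2 * lo - 3` elements, while summing `1` over the pairs gives zero modulo
  -- `2`.
  rw [Finset.sum_const, hcard, nsmul_eq_mul, mul_one, ZMod.natCast_eq_zero_iff] at hzero
  omega

/-- A crossing strand exists, so one can take the last vertex before the arc whose strand crosses
the line or is decorated; maximality keeps the gap free of both. -/
theorem exists_cutData {t : RawTangle N} (ht : t.IsDecorated) {r : Refl N}
    (hm : t.mate (.inr r.lo) = .inr r.hi) : ∃ z, CutData t r z := by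
  classical
  obtain ⟨w, h1, h2, h3⟩ := exists_crossing ht.1 hm
  obtain ⟨z, hz, hmax⟩ := Finset.exists_max_image (Finset.univ.filter fun w : Vertex N =>
    r.lo.val < pos w ∧ pos w < pos (.inr r.hi : Vertex N) ∧
      (col (t.mate w) ≤ r.lo.val ∨ w ∈ t.beaded)) pos
    ⟨w, Finset.mem_filter.2 ⟨Finset.mem_univ _, h1, h2, Or.inl h3⟩⟩
  obtain ⟨-, hz1, hz2, hz3⟩ := Finset.mem_filter.1 hz
  refine ⟨z, ht, hm, hz1, hz2, hz3, fun w hw1 hw2 => ?_⟩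
  by_contra hc
  have := hmax w (Finset.mem_filter.2 ⟨Finset.mem_univ _, hz1.trans hw1, hw2, by
    by_contra! h
    exact hc h⟩)
  omega

/-- Below a southern arc there is an arc joining neighbouring points. -/
theorem exists_neighbour_arc {t : RawTangle N} (ht : t.IsTangle) {i j : Fin N} (hij : i < j)
    (h : t.mate (.inr i) = .inr j) :
    ∃ k l : Fin N, i ≤ k ∧ k < j ∧ l.val = k.val + 1 ∧ t.mate (.inr k) = .inr l := by
  induction hd : j.val - i.val using Nat.strong_induction_on generalizing i j with
  | _ d ih =>
    have hij' := Fin.lt_def.1 hij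
    have hj := j.2
    by_cases h1 : j.val = i.val + 1
    · exact ⟨i, j, le_rfl, hij, h1, h⟩
    have hi1 : i.val + 1 < N := by omega
    have hmj : t.mate (.inr j) = .inr i := by rw [← h, (ht.1 _).1]
    have hin := ht.mem_interval (x := .inr j) (c := .inr ⟨i.val + 1, hi1⟩)
      (pos_inr_lt_inr.2 (by simp only; omega))
      (by rw [hmj]; exact pos_inr_lt_inr.2 (by simp))
    have hne := (ht.1 (.inr ⟨i.val + 1, hi1⟩)).2
    rw [hmj] at hin
    rcases hl : t.mate (.inr ⟨i.val + 1, hi1⟩) with l | l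
    · rw [hl] at hin
      exact absurd hin.1 not_pos_inr_lt_inl
    · rw [hl, pos_inr_lt_inr, pos_inr_lt_inr] at hin
      rw [hl, Ne, Sum.inr.injEq, Fin.ext_iff] at hne
      simp only at hne
      obtain ⟨k, k', h2, h3, h4, h5⟩ := ih (l.val - (i.val + 1)) (by omega)
        (i := ⟨i.val + 1, hi1⟩) (j := l) (Fin.lt_def.2 (by simp only; omega)) hl rfl
      refine ⟨k, k', ?_, ?_, h4, h5⟩
      · rw [Fin.le_def] at h2 ⊢; simp only at h2; omega
      · rw [Fin.lt_def] at h3 ⊢; omega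

/-- The leftmost southern arc joining neighbouring points, if it is decorated, joins the first two
points. -/
theorem exists_leftmost_arc {t : RawTangle N} (ht : t.IsDecorated)
    (h : ∃ i j, t.mate (.inr i) = .inr j) :
    ∃ k l : Fin N, l.val = k.val + 1 ∧ t.mate (.inr k) = .inr l ∧
      (.inr k ∈ t.beaded → k.val = 0) := by
  classical
  have hex : ∃ n, ∃ k l : Fin N, k.val = n ∧ l.val = k.val + 1 ∧ t.mate (.inr k) = .inr l := by
    obtain ⟨i, j, h⟩ := h
    have hne : i ≠ j := fun hij => (ht.1.1 (.inr i)).2 (by rw [h, hij])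
    have hji : t.mate (.inr j) = .inr i := by rw [← h, (ht.1.1 _).1]
    rcases lt_or_gt_of_ne hne with hlt | hlt
    · obtain ⟨k, l, -, -, h1, h2⟩ := exists_neighbour_arc ht.1 hlt h
      exact ⟨_, k, l, rfl, h1, h2⟩
    · obtain ⟨k, l, -, -, h1, h2⟩ := exists_neighbour_arc ht.1 hlt hji
      exact ⟨_, k, l, rfl, h1, h2⟩
  -- The arc with least left foot is chosen. If it is decorated and does not start at the first
  -- point, the strand at the first southern point gives a contradiction.
  obtain ⟨k, l, hk, hl, hkl⟩ := Nat.find_spec hex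
  refine ⟨k, l, hl, hkl, fun hb => ?_⟩
  by_contra h0
  have hexp := ht.2.2 _ hb
  have hN := k.pos
  have hl2 := l.2
  have hm0 := ht.1.1 (.inr ⟨0, hN⟩)
  rcases hj : t.mate (.inr ⟨0, hN⟩) with j | j
  -- A propagating strand at the first point separates the arc from the left edge.
  · refine hexp ⟨.inl j, ?_⟩
    have : t.mate (.inl j) = .inr ⟨0, hN⟩ := by rw [← hj, hm0.1]
    rw [this, hkl]
    refine ⟨pos_inl_lt_inr, pos_inl_lt_inr, pos_inr_lt_inr.2 ?_, pos_inr_lt_inr.2 ?_⟩ <;>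
      simp only <;> omega
  · have hj0 : t.mate (.inr j) = .inr ⟨0, hN⟩ := by rw [← hj, hm0.1]
    have hjk : j ≠ k := fun h => by
      rw [h, hkl, Sum.inr.injEq] at hj0
      rw [hj0] at hl
      simp at hl
    have hjl : j ≠ l := fun h => by
      rw [h, ← hkl, (ht.1.1 _).1, Sum.inr.injEq] at hj0
      rw [hj0] at h0
      simp at h0
    rw [Ne, Fin.ext_iff] at hjk hjl
    have hj1 : j.val ≠ 0 := fun h => hm0.2 (by rw [hj]; congr 1; exact Fin.ext h)
    -- An arc from the first point either passes over the chosen arc and hides it, or ends before it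
    -- and has a shorter arc further left below it.
    by_cases hlt : l.val < j.val
    · refine hexp ⟨.inr j, ?_⟩
      rw [hkl, hj0]
      refine ⟨pos_inr_lt_inr.2 ?_, pos_inr_lt_inr.2 ?_, pos_inr_lt_inr.2 ?_, pos_inr_lt_inr.2 ?_⟩ <;>
        first | omega | (simp only; omega)
    · obtain ⟨k', l', -, h1, h2, h3⟩ := exists_neighbour_arc ht.1 (i := ⟨0, hN⟩) (j := j)
        (Fin.lt_def.2 (by simp only; omega)) hj
      exact Nat.find_min hex (m := k'.val) (by rw [Fin.lt_def] at h1; omega)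
        ⟨k', l', rfl, h2, h3⟩

/-- With no southern arcs the strands define a strictly increasing self-map of `Fin N` by planarity,
which must be the identity. -/
theorem mate_eq_swap {t : RawTangle N} (ht : t.IsTangle)
    (h : ¬ ∃ i j, t.mate (.inr i) = .inr j) : t.mate = Sum.swap := by
  have hf : ∀ i, ∃ j, t.mate (.inr i) = .inl j := fun i => by
    rcases hi : t.mate (.inr i) with j | j
    · exact ⟨j, rfl⟩
    · exact absurd ⟨i, j, hi⟩ h
  choose f hf using hf
  have hf' : ∀ i, t.mate (.inl (f i)) = .inr i := fun i => by rw [← hf, (ht.1 _).1]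
  have hmono : StrictMono f := by
    intro i j hij
    by_contra hc
    have hne : f j ≠ f i := fun h => by
      have := hf' i
      rw [← h, hf', Sum.inr.injEq] at this
      rw [this] at hij
      exact lt_irrefl _ hij
    have hlt : f j < f i := lt_of_le_of_ne (not_lt.1 hc) hne
    refine ht.2 (.inl (f j)) (.inl (f i)) ⟨hlt, ?_, ?_⟩
    · rw [hf']; exact pos_inl_lt_inr
    · rw [hf', hf']; exact pos_inr_lt_inr.2 hij
  have hid : ∀ i, f i = i := fun i => le_antisymm hmono.apply_le hmono.le_apply
  funext v
  rcases v with i | i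
  · have := hf' i
    rwa [hid] at this
  · have := hf i
    rwa [hid] at this

end ExistsCut

/-! ### Counting beads after stacking on a generator -/

section BeadCount

variable {N : ℕ}

theorem e_mate_cases (r : Refl N) (v : Vertex N) :
    (v = .inl r.lo ∧ (RawTangle.e r).mate v = .inl r.hi) ∨
    (v = .inl r.hi ∧ (RawTangle.e r).mate v = .inl r.lo) ∨
    (v = .inr r.lo ∧ (RawTangle.e r).mate v = .inr r.hi) ∨
    (v = .inr r.hi ∧ (RawTangle.e r).mate v = .inr r.lo) ∨
    ∃ j, j ≠ r.lo ∧ j ≠ r.hi ∧ ((v = .inl j ∧ (RawTangle.e r).mate v = .inr j) ∨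
      (v = .inr j ∧ (RawTangle.e r).mate v = .inl j)) := by
  rcases v with j | j <;> by_cases h1 : j = r.lo <;> by_cases h2 : j = r.hi
  all_goals first
    | exact absurd (h1.symm.trans h2) r.lo_ne_hi
    | (subst h1; simp [e_mate_inl_lo, e_mate_inr_lo])
    | (subst h2; simp [e_mate_inl_hi, e_mate_inr_hi])
    | simp [e_mate_inl_of_ne r j h1 h2, e_mate_inr_of_ne r j h1 h2, h1, h2]

theorem e_isTangle (r : Refl N) : (RawTangle.e r).IsTangle := by
  have hne := r.lo_ne_hi
  have hlh := r.hi_val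
  refine ⟨fun v => ?_, fun u v => ?_⟩
  · rcases e_mate_cases r v with ⟨rfl, h⟩ | ⟨rfl, h⟩ | ⟨rfl, h⟩ | ⟨rfl, h⟩ |
      ⟨j, h1, h2, ⟨rfl, h⟩ | ⟨rfl, h⟩⟩ <;> rw [h]
    · exact ⟨e_mate_inl_hi r, by simpa using hne.symm⟩
    · exact ⟨e_mate_inl_lo r, by simpa using hne⟩
    · exact ⟨e_mate_inr_hi r, by simpa using hne.symm⟩
    · exact ⟨e_mate_inr_lo r, by simpa using hne⟩
    · exact ⟨e_mate_inr_of_ne r j h1 h2, by simp⟩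
    · exact ⟨e_mate_inl_of_ne r j h1 h2, by simp⟩
  · rcases e_mate_cases r u with ⟨rfl, h⟩ | ⟨rfl, h⟩ | ⟨rfl, h⟩ | ⟨rfl, h⟩ |
      ⟨j, h1, h2, ⟨rfl, h⟩ | ⟨rfl, h⟩⟩ <;> rw [h] <;>
    rcases e_mate_cases r v with ⟨rfl, h'⟩ | ⟨rfl, h'⟩ | ⟨rfl, h'⟩ | ⟨rfl, h'⟩ |
      ⟨k, k1, k2, ⟨rfl, h'⟩ | ⟨rfl, h'⟩⟩ <;> rw [h'] <;>
    simp only [pos_inl_lt_inl, pos_inr_lt_inr, pos_inl_lt_inr, not_pos_inr_lt_inl, ne_eq,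
      Fin.ext_iff, true_and, false_and, and_false, and_true, not_false_eq_true] at * <;> omega

theorem e_isDecorated (r : Refl N) : (RawTangle.e r).IsDecorated := by
  have hlh := r.hi_val
  refine ⟨e_isTangle r, fun v hv => ?_, fun v hv => ?_⟩
  · rw [mem_e_beaded] at hv ⊢
    obtain ⟨hs, rfl | rfl | rfl | rfl⟩ := hv <;>
      simp [e_mate_inl_lo, e_mate_inl_hi, e_mate_inr_lo, e_mate_inr_hi, hs]
  · rw [mem_e_beaded] at hv
    obtain ⟨hs, hv⟩ := hv
    have h0 := hs.lo_val
    rintro ⟨c, h1, h2, h3, h4⟩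
    rcases hv with rfl | rfl | rfl | rfl
    all_goals
      simp only [e_mate_inl_lo, e_mate_inl_hi, e_mate_inr_lo, e_mate_inr_hi] at h2 h4
      rcases hc : (RawTangle.e r).mate c with j | j <;> rw [hc] at h3 h4 <;>
      rcases c with i | i <;>
      simp only [pos_inl_lt_inl, pos_inr_lt_inr, pos_inl_lt_inr, not_pos_inr_lt_inl] at h1 h2 h3 h4 <;>
      omega

open Classical in
theorem ncard_strand {t : RawTangle N} (ht : t.IsDecorated) (u : Vertex N) :
    {v ∈ t.beaded ∩ t.strands | v = u ∨ v = t.mate u}.ncard = if u ∈ t.beaded then 1 else 0 := by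
  have hu := ht.1.1 u
  have hpos : pos (t.mate u) ≠ pos u := fun h => hu.2 (pos_injective h)
  split_ifs with hb
  · rw [Set.ncard_eq_one]
    rcases lt_or_gt_of_ne hpos with hlt | hlt
    · refine ⟨t.mate u, Set.ext fun v => ⟨?_, ?_⟩⟩
      · rintro ⟨⟨-, hv⟩, rfl | rfl⟩
        · exact absurd hv hlt.not_gt
        · rfl
      · rintro rfl
        refine ⟨⟨ht.2.1 u hb, ?_⟩, Or.inr rfl⟩
        change pos _ < pos (t.mate (t.mate u))
        rwa [hu.1]
    · refine ⟨u, Set.ext fun v => ⟨?_, ?_⟩⟩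
      · rintro ⟨⟨-, hv⟩, rfl | rfl⟩
        · rfl
        · change pos _ < pos (t.mate (t.mate u)) at hv
          rw [hu.1] at hv
          exact absurd hv hlt.not_gt
      · rintro rfl
        exact ⟨⟨hb, hlt⟩, Or.inl rfl⟩
  · rw [Set.ncard_eq_zero]
    refine Set.eq_empty_of_forall_notMem ?_
    rintro v ⟨⟨hv, -⟩, rfl | rfl⟩
    · exact hb hv
    · exact hb ((CutData.mem_beaded_mate_iff ht u).1 hv)

variable {t : RawTangle N} {r : Refl N}

theorem mem_component_lower (hl : t.mate (.inr r.lo) ≠ .inr r.hi) {u v : Vertex N}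
    (hv : v ∈ (RawTangle.e r).beaded) : u ∈ component t r (lower v) ↔
      ((v = .inl r.lo ∨ v = (RawTangle.e r).mate (.inl r.lo)) ∧
        (u = t.mate (.inr r.lo) ∨ u = t.mate (.inr r.hi))) ∨
      ((v = .inr r.lo ∨ v = (RawTangle.e r).mate (.inr r.lo)) ∧
        (u = .inr r.lo ∨ u = .inr r.hi)) := by
  rw [e_mate_inl_lo, e_mate_inr_lo]
  have hne := r.lo_ne_hi
  rw [mem_e_beaded] at hv
  obtain ⟨-, rfl | rfl | rfl | rfl⟩ := hv
  · simp [component, lower, hl]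
  · simp [component, lower, hl]
  · simp [component, lower, splice_left]
  · simp [component, lower, splice_right, or_comm]

theorem beadCount_e_eq (ht : t.IsTangle) (u : Vertex N) : beadCount t (RawTangle.e r) u =
    {v ∈ t.beaded ∩ t.strands | u ∈ component t r (upper v)}.ncard +
    {v ∈ (RawTangle.e r).beaded ∩ (RawTangle.e r).strands | u ∈ component t r (lower v)}.ncard := by
  simp only [beadCount, joined_outer_iff ht]

theorem mem_component_upper_iff (hl : t.mate (.inr r.lo) ≠ .inr r.hi) (ht : t.IsTangle)
    (u v : Vertex N) : u ∈ component t r (upper v) ↔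
      ((v = .inr r.lo ∨ v = .inr r.hi ∨ v = t.mate (.inr r.lo) ∨ v = t.mate (.inr r.hi)) ∧
        (u = t.mate (.inr r.lo) ∨ u = t.mate (.inr r.hi))) ∨
      ((v ≠ .inr r.lo ∧ v ≠ .inr r.hi ∧ v ≠ t.mate (.inr r.lo) ∧ v ≠ t.mate (.inr r.hi)) ∧
        (u = v ∨ u = t.mate v)) := by
  have hm := ht.1
  by_cases h1 : v = .inr r.lo
  · rw [h1, component_upper_lo, if_neg hl]
    simp
  by_cases h2 : v = .inr r.hi
  · rw [h2, component_upper_hi, if_neg hl]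
    simp
  rw [component_upper v h1 h2]
  by_cases h3 : v = t.mate (.inr r.lo)
  · rw [h3, splice_mate_left hm hl]
    simp
  by_cases h4 : v = t.mate (.inr r.hi)
  · rw [h4, splice_mate_right hm hl]
    simp [or_comm]
  rw [splice_of_ne hm h1 h2 h3 h4]
  simp [h1, h2, h3, h4]

open Classical in
/-- The number of beads of the strands of a tangle, one of which is undecorated, after stacking it
on a generator. -/
theorem beadCount_e (ht : t.IsDecorated) (hl : t.mate (.inr r.lo) ≠ .inr r.hi)
    (hb : .inr r.hi ∉ t.beaded) (u : Vertex N) : beadCount t (RawTangle.e r) u =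
      if u = .inr r.lo ∨ u = .inr r.hi then (if r.IsSpecial then 1 else 0)
      else if u = t.mate (.inr r.lo) ∨ u = t.mate (.inr r.hi) then
        (if .inr r.lo ∈ t.beaded then 1 else 0) + (if r.IsSpecial then 1 else 0)
      else if u ∈ t.beaded then 1 else 0 := by
  have hm := ht.1.1
  have hsp1 : (.inl r.lo ∈ (RawTangle.e r).beaded) ↔ r.IsSpecial := by simp [mem_e_beaded]
  have hsp2 : (.inr r.lo ∈ (RawTangle.e r).beaded) ↔ r.IsSpecial := by simp [mem_e_beaded]
  have hl' : t.mate (.inr r.hi) ≠ .inr r.lo := fun h => hl (by rw [← h, (hm _).1])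
  have hb' : t.mate (.inr r.hi) ∉ t.beaded := by rwa [CutData.mem_beaded_mate_iff ht]
  have hne : (.inr r.lo : Vertex N) ≠ .inr r.hi := by simpa using r.lo_ne_hi
  have n1 := hm (.inr r.lo)
  have n2 := hm (.inr r.hi)
  have e1 := ncard_strand (e_isDecorated r) (.inl r.lo)
  have e2 := ncard_strand (e_isDecorated r) (.inr r.lo)
  simp only [hsp1, hsp2] at e1 e2
  have s1 := ncard_strand ht (.inr r.lo)
  have s2 := ncard_strand ht u
  have hlow := fun v => mem_component_lower (v := v) (u := u) hl
  have hupp := mem_component_upper_iff hl ht.1 u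
  rw [beadCount_e_eq ht.1]
  have hE :
      {v ∈ (RawTangle.e r).beaded ∩ (RawTangle.e r).strands | u ∈ component t r (lower v)} =
      {v ∈ (RawTangle.e r).beaded ∩ (RawTangle.e r).strands |
        (v = .inl r.lo ∨ v = (RawTangle.e r).mate (.inl r.lo)) ∧
          (u = t.mate (.inr r.lo) ∨ u = t.mate (.inr r.hi)) ∨
        (v = .inr r.lo ∨ v = (RawTangle.e r).mate (.inr r.lo)) ∧
          (u = .inr r.lo ∨ u = .inr r.hi)} := by
    ext v
    exact and_congr_right fun hv => hlow v hv.1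
  rw [hE]
  simp only [hupp]
  by_cases hQ1 : u = .inr r.lo ∨ u = .inr r.hi
  · have hQ2 : ¬ (u = t.mate (.inr r.lo) ∨ u = t.mate (.inr r.hi)) := by
      rintro (h | h) <;> rcases hQ1 with rfl | rfl
      · exact n1.2 h.symm
      · exact hl h.symm
      · exact hl' h.symm
      · exact n2.2 h.symm
    simp only [hQ2, hQ1, and_true, and_false, false_or, e2, if_true]
    rw [add_eq_right, Set.ncard_eq_zero]
    refine Set.eq_empty_of_forall_notMem ?_
    rintro v ⟨-, ⟨h1, h2, h3, h4⟩, rfl | rfl⟩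
    · exact hQ1.elim h1 h2
    · rcases hQ1 with h | h
      · exact h3 (by rw [← h, (hm _).1])
      · exact h4 (by rw [← h, (hm _).1])
  by_cases hQ2 : u = t.mate (.inr r.lo) ∨ u = t.mate (.inr r.hi)
  · simp only [hQ2, hQ1, and_true, and_false, or_false, e1, if_true]
    congr 1
    rw [← s1]
    congr 1
    ext v
    refine and_congr_right fun hv => ?_
    constructor
    · rintro (h | ⟨⟨h1, h2, h3, h4⟩, h⟩)
      · rcases h with h | h | h | h
        · exact Or.inl h
        · exact absurd (h ▸ hv.1) hb
        · exact Or.inr h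
        · exact absurd (h ▸ hv.1) hb'
      · exfalso
        rcases hQ2 with rfl | rfl <;> rcases h with h | h
        · exact h3 h.symm
        · exact h1 (by rw [← (hm v).1, ← h, n1.1])
        · exact h4 h.symm
        · exact h2 (by rw [← (hm v).1, ← h, n2.1])
    · rintro (h | h)
      · exact Or.inl (Or.inl h)
      · exact Or.inl (Or.inr (Or.inr (Or.inl h)))
  · simp only [hQ2, hQ1, and_false, or_false, false_or]
    rw [← s2, add_eq_left.2 (by simp)]
    congr 1
    ext v
    refine and_congr_right fun hv => ?_
    rw [not_or] at hQ1 hQ2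
    constructor
    · rintro ⟨-, h | h⟩
      · exact Or.inl h.symm
      · exact Or.inr (by rw [h, (hm v).1])
    · rintro (rfl | rfl)
      · exact ⟨⟨hQ1.1, hQ1.2, hQ2.1, hQ2.2⟩, Or.inl rfl⟩
      · refine ⟨⟨fun h => hQ2.1 ?_, fun h => hQ2.2 ?_, fun h => hQ1.1 ?_, fun h => hQ1.2 ?_⟩,
          Or.inr (hm u).1.symm⟩
        · rw [← h, (hm u).1]
        · rw [← h, (hm u).1]
        · rw [← (hm u).1, h, n1.1]
        · rw [← (hm u).1, h, n2.1]

end BeadCount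

/-! ### Orientations -/

/-- Whether the arrow at a vertex with a symbol other than `∘` points into the strand. -/
def sgn {N : ℕ} : Vertex N → Label → Bool
  | .inl _, a => a = .down
  | .inr _, a => a = .up

/-- Away from `∘` the orientation conditions become equalities and inequalities of Booleans, so
orientations along a chain of strands can be composed by parity. -/
theorem oriented_iff {N : ℕ} {v v' : Vertex N} {a a' : Label} (h : a ≠ .circ) (h' : a' ≠ .circ) :
    Oriented v v' a a' ↔ sgn v a ≠ sgn v' a' := by
  rcases v with i | i <;> rcases v' with j | j <;> cases a <;> cases a' <;>
    simp_all [Oriented, PointsIn, PointsOut, sgn]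

theorem flipOriented_iff {N : ℕ} {v v' : Vertex N} {a a' : Label} (h : a ≠ .circ)
    (h' : a' ≠ .circ) : FlipOriented v v' a a' ↔ sgn v a = sgn v' a' := by
  rcases v with i | i <;> rcases v' with j | j <;> cases a <;> cases a' <;>
    simp_all [FlipOriented, PointsIn, PointsOut, sgn]

theorem oriented_of_circ {N : ℕ} {v v' : Vertex N} {a a' : Label} (h : a = .circ ∨ a' = .circ) :
    Oriented v v' a a' := Or.inr (Or.inr h)

theorem oriented_inl_inr_self {N : ℕ} (i j : Fin N) (a : Label) :
    Oriented (.inl i) (.inr j) a a := by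
  cases a <;> simp [Oriented, PointsIn, PointsOut]

theorem oriented_inr_inl_self {N : ℕ} (i j : Fin N) (a : Label) :
    Oriented (.inr i) (.inl j) a a := by
  cases a <;> simp [Oriented, PointsIn, PointsOut]

theorem label_eq_circ_iff {X : HermitianPair} (north south : PW X) (v : Vertex X.size) :
    label north.1 south.1 v = .circ ↔ X.HasCirc ∧ col v = 0 := by
  rcases v with i | i
  · exact north.eq_circ_iff i
  · exact south.eq_circ_iff i

theorem sgn_inl_eq_iff {N : ℕ} {i j : Fin N} {a b : Label} (ha : a ≠ .circ) (hb : b ≠ .circ) :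
    sgn (.inl i) a = sgn (.inl j) b ↔ a = b := by
  cases a <;> cases b <;> simp_all [sgn]

theorem sgn_inr_eq_iff {N : ℕ} {i j : Fin N} {a b : Label} (ha : a ≠ .circ) (hb : b ≠ .circ) :
    sgn (.inr i) a = sgn (.inr j) b ↔ a = b := by
  cases a <;> cases b <;> simp_all [sgn]

theorem IsEdge.symm {X : HermitianPair} {r : Refl X.size} {hr : IsSimple X r} {w v : PW X}
    (h : IsEdge r hr w v) : IsEdge r hr v w := by
  rw [isEdge_iff] at h ⊢
  obtain ⟨h, rfl | rfl⟩ := h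
  · exact ⟨h, Or.inl rfl⟩
  · rw [mulRefl_mulRefl]
    exact ⟨h.symm, Or.inr rfl⟩

/-- The two symbols next to an edge are equal if and only if the reflection is special. -/
theorem IsEdge.label_eq_iff {X : HermitianPair} {r : Refl X.size} {hr : IsSimple X r} {w v : PW X}
    (h : IsEdge r hr w v) (hc : w.1 r.lo ≠ .circ) : w.1 r.lo = w.1 r.hi ↔ r.IsSpecial := by
  have h1 : act X r w.1 ≠ w.1 := fun h' => ((isEdge_iff hr w v).1 h).1 (Subtype.ext h')
  rw [act_ne_iff] at h1
  have h2 := w.hi_ne_circ r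
  rcases r with ⟨i, hi⟩ | hi
  · rw [act_s_lo, act_s_hi] at h1
    simp only [Refl.IsSpecial, iff_false]
    rcases h1 with h1 | h1
    · exact h1.symm
    · exact h1
  · simp only [Refl.IsSpecial, iff_true]
    cases X with
    | A n k => exact absurd hr (by simp [IsSimple])
    | C n =>
      exact absurd ((w.eq_circ_iff _).2 ⟨trivial, rfl⟩) hc
    | D n =>
      rw [act_special_lo_D, act_special_hi_D] at h1
      generalize w.1 (Refl.lo (.special hi)) = x at *
      generalize w.1 (Refl.hi (.special hi)) = y at *
      cases x <;> cases y <;> simp_all [Label.flip]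

/-- There is a neighbour with prescribed symbol at the second point of a reflection. -/
theorem exists_isEdge {X : HermitianPair} {r : Refl X.size} (hr : IsSimple X r) (v : PW X)
    (hact : act X r v.1 ≠ v.1) (s : Bool) :
    ∃ w, IsEdge r hr w v ∧ sgn (.inr r.hi) (w.1 r.hi) ≠ s := by
  have hne : v.mulRefl r hr ≠ v := fun h => hact (congrArg Subtype.val h)
  by_cases h : sgn (.inr r.hi) (v.1 r.hi) = s
  · refine ⟨v.mulRefl r hr, ?_, ?_⟩
    · rw [isEdge_iff, mulRefl_mulRefl]
      exact ⟨hne.symm, Or.inr rfl⟩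
    · change sgn _ (act X r v.1 r.hi) ≠ s
      rw [act_hi hr v hact, ← h]
      have := v.hi_ne_circ r
      generalize v.1 r.hi = x at *
      cases x <;> simp_all [sgn, Label.flip]
  · exact ⟨v, (isEdge_iff hr v v).2 ⟨hne, Or.inl rfl⟩, h⟩

/-! ### Basis tangles -/

/-- The first point is allowed to be any `o` of value `0`, so that the condition can be used
directly at a foot of an arc. -/
theorem isBasisTangle_C_iff {n : ℕ} {t : RawTangle (HermitianPair.C n).size}
    {o : Fin (HermitianPair.C n).size} (ho : o.val = 0) : IsBasisTangle (.C n) t ↔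
      t.IsDecorated ∧ ((t.mate (.inl o) = .inr o ∧ .inl o ∉ t.beaded) ∨
       (t.mate (.inl o) = .inr o ∧ .inl o ∈ t.beaded ∧ t.HasNorthernArc ∧ t.HasSouthernArc) ∨
       (t.mate (.inl o) ≠ .inr o ∧ .inl o ∈ t.beaded ∧ .inr o ∈ t.beaded)) := by
  have : o = (0 : Fin (n + 1)) := Fin.ext ho
  subst this
  rfl

theorem isBasisTangle_e {X : HermitianPair} {r : Refl X.size} (hr : IsSimple X r) :
    IsBasisTangle X (RawTangle.e r) := by
  have hd := e_isDecorated r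
  have hne := r.lo_ne_hi
  cases X with
  | A n k =>
    refine ⟨hd, Set.eq_empty_of_forall_notMem fun v hv => ?_⟩
    rw [mem_e_beaded] at hv
    rcases r with ⟨i, hi⟩ | hi
    · exact hv.1
    · exact hr
  | C n =>
    have hN : 0 < (HermitianPair.C n).size := Nat.succ_pos n
    rw [isBasisTangle_C_iff (o := ⟨0, hN⟩) rfl]
    refine ⟨hd, ?_⟩
    rcases r with ⟨i, hi⟩ | hi
    · left
      have hr' : 1 ≤ i := hr
      refine ⟨e_mate_inl_of_ne _ _ ?_ ?_, fun h => ((mem_e_beaded _ _).1 h).1⟩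
      · simp only [Refl.lo, ne_eq, Fin.mk.injEq]; omega
      · simp only [Refl.hi, ne_eq, Fin.mk.injEq]; omega
    · right; right
      refine ⟨?_, ?_, ?_⟩
      · rw [show (⟨0, hN⟩ : Fin (HermitianPair.C n).size) = Refl.lo (.special hi) from rfl,
          e_mate_inl_lo]
        simp
      · exact (mem_e_beaded _ _).2 ⟨trivial, Or.inl rfl⟩
      · exact (mem_e_beaded _ _).2 ⟨trivial, Or.inr (Or.inr (Or.inl rfl))⟩
  | D n =>
    refine ⟨hd, ?_⟩
    by_cases hs : r.IsSpecial
    · have : (RawTangle.e r).beaded ∩ (RawTangle.e r).strands = {.inl r.lo, .inr r.hi} := by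
        have hlh := r.hi_val
        ext v
        simp only [Set.mem_inter_iff, mem_e_beaded, hs, true_and, Set.mem_insert_iff,
          Set.mem_singleton_iff, RawTangle.strands, Set.mem_ofPred_eq]
        constructor
        · rintro ⟨rfl | rfl | rfl | rfl, h⟩
          · exact Or.inl rfl
          · rw [e_mate_inl_hi, pos_inl_lt_inl] at h
            omega
          · rw [e_mate_inr_lo, pos_inr_lt_inr] at h
            omega
          · exact Or.inr rfl
        · rintro (rfl | rfl)
          · refine ⟨Or.inl rfl, ?_⟩
            rw [e_mate_inl_lo, pos_inl_lt_inl]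
            omega
          · refine ⟨Or.inr (Or.inr (Or.inr rfl)), ?_⟩
            rw [e_mate_inr_hi, pos_inr_lt_inr]
            omega
      rw [this, Set.ncard_pair (by simp)]
      exact even_two
    · have : (RawTangle.e r).beaded = ∅ :=
        Set.eq_empty_of_forall_notMem fun v hv => hs ((mem_e_beaded _ _).1 hv).1
      rw [this]
      simp

/-- A transposition that moves the diagram exchanges different symbols, so its arcs are oriented. In
type `D` the special arcs have equal symbols and are flip-oriented; in type `C` only one foot
carries `∘`. Elsewhere the two boundaries agree. -/
theorem isOriented_e {X : HermitianPair} {r : Refl X.size} {hr : IsSimple X r} {w v : PW X}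
    (h : IsEdge r hr w v) : IsOriented X w (RawTangle.e r) v := by
  have hcap : ∀ u u' : PW X, IsEdge r hr u u' → ¬ r.IsSpecial → u.1 r.lo ≠ u.1 r.hi := by
    intro u u' h hs he
    have hc : u.1 r.lo ≠ .circ := by rw [he]; exact u.hi_ne_circ r
    exact hs ((h.label_eq_iff hc).1 he)
  refine ⟨isBasisTangle_e hr, fun x hx => ?_, ?_⟩
  · rw [mem_e_beaded] at hx
    rcases e_mate_cases r x with ⟨rfl, hm⟩ | ⟨rfl, hm⟩ | ⟨rfl, hm⟩ | ⟨rfl, hm⟩ |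
      ⟨j, h1, h2, ⟨rfl, hm⟩ | ⟨rfl, hm⟩⟩ <;> rw [hm] <;>
      simp only [label, Sum.elim_inl, Sum.elim_inr]
    · have hs : ¬ r.IsSpecial := fun hs => hx ⟨hs, by simp⟩
      by_cases hc : w.1 r.lo = .circ
      · exact oriented_of_circ (Or.inl hc)
      · rw [oriented_iff hc (w.hi_ne_circ r), Ne, sgn_inl_eq_iff hc (w.hi_ne_circ r)]
        exact hcap w v h hs
    · have hs : ¬ r.IsSpecial := fun hs => hx ⟨hs, by simp⟩
      by_cases hc : w.1 r.lo = .circ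
      · exact oriented_of_circ (Or.inr hc)
      · rw [oriented_iff (w.hi_ne_circ r) hc, Ne, sgn_inl_eq_iff (w.hi_ne_circ r) hc]
        exact (hcap w v h hs).symm
    · have hs : ¬ r.IsSpecial := fun hs => hx ⟨hs, by simp⟩
      by_cases hc : v.1 r.lo = .circ
      · exact oriented_of_circ (Or.inl hc)
      · rw [oriented_iff hc (v.hi_ne_circ r), Ne, sgn_inr_eq_iff hc (v.hi_ne_circ r)]
        exact hcap v w h.symm hs
    · have hs : ¬ r.IsSpecial := fun hs => hx ⟨hs, by simp⟩
      by_cases hc : v.1 r.lo = .circ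
      · exact oriented_of_circ (Or.inr hc)
      · rw [oriented_iff (v.hi_ne_circ r) hc, Ne, sgn_inr_eq_iff (v.hi_ne_circ r) hc]
        exact (hcap v w h.symm hs).symm
    · rw [isEdge_label_of_ne h h1 h2]
      exact oriented_inl_inr_self _ _ _
    · rw [isEdge_label_of_ne h h1 h2]
      exact oriented_inr_inl_self _ _ _
  · cases X with
    | A n k => trivial
    | C n =>
      rintro x hx ⟨h1, h2⟩
      rw [label_eq_circ_iff] at h1 h2
      have hlh := r.hi_val
      have c1 : ∀ i : Fin (HermitianPair.C n).size, col (.inl i) = i.val := fun _ => rfl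
      have c2 : ∀ i : Fin (HermitianPair.C n).size, col (.inr i) = i.val := fun _ => rfl
      rw [mem_e_beaded] at hx
      obtain ⟨-, rfl | rfl | rfl | rfl⟩ := hx <;>
        simp only [e_mate_inl_lo, e_mate_inl_hi, e_mate_inr_lo, e_mate_inr_hi, c1, c2] at h1 h2 <;>
        omega
    | D n =>
      intro x hx
      have hnc : ∀ (u : PW (.D n)) j, u.1 j ≠ .circ := fun u j => by
        rw [Ne, PW.eq_circ_iff]; simp [HermitianPair.HasCirc]
      rw [mem_e_beaded] at hx
      obtain ⟨hs, hx⟩ := hx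
      have e1 := (h.label_eq_iff (hnc w _)).2 hs
      have e2 := (h.symm.label_eq_iff (hnc v _)).2 hs
      rcases hx with rfl | rfl | rfl | rfl <;>
        simp only [e_mate_inl_lo, e_mate_inl_hi, e_mate_inr_lo, e_mate_inr_hi, label,
          Sum.elim_inl, Sum.elim_inr] <;>
        rw [flipOriented_iff (hnc _ _) (hnc _ _)]
      · rw [sgn_inl_eq_iff (hnc _ _) (hnc _ _), e1]
      · rw [sgn_inl_eq_iff (hnc _ _) (hnc _ _), e1]
      · rw [sgn_inr_eq_iff (hnc _ _) (hnc _ _), e2]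
      · rw [sgn_inr_eq_iff (hnc _ _) (hnc _ _), e2]

/-! ### Every diagram is a product of generators -/

/-- Whether the strand at the left end of the cut arc is decorated after cutting. -/
def cutBead : (X : HermitianPair) → RawTangle X.size → Refl X.size → Vertex X.size → Prop
  | .A _ _, _, _, _ => False
  | .C _, t, r, z => z ∈ t.beaded ∧ ¬ (r.lo.val = 0 ∧ col (t.mate z) = 0)
  | .D _, t, r, z => ¬ (z ∈ t.beaded ↔ .inr r.lo ∈ t.beaded)

section Cut

variable {X : HermitianPair} {t : RawTangle X.size} {r : Refl X.size} {z : Vertex X.size}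

theorem CutData.cutBead_imp (_ : CutData t r z) :
    cutBead X t r z → z ∈ t.beaded ∨ .inr r.lo ∈ t.beaded := by
  cases X with
  | A n k => exact fun h => h.elim
  | C n => exact fun h => Or.inl h.1
  | D n =>
    intro h
    simp only [cutBead] at h
    tauto

/-- The decoration of the cut strand changes only in type `C` with both ends in the first column, or
in type `D` when the arc is decorated, hence special and at the first point. -/
theorem CutData.cutBead_lo (_ : CutData t r z) (hb : IsBasisTangle X t)
    (hs : r.IsSpecial ↔ .inr r.lo ∈ t.beaded) :
    cutBead X t r z ∧ z ∉ t.beaded ∨ ¬ cutBead X t r z ∧ z ∈ t.beaded → r.lo.val = 0 := by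
  cases X with
  | A n k =>
    rintro (h | h)
    · exact h.1.elim
    · rw [hb.2] at h
      exact h.2.elim
  | C n =>
    simp only [cutBead]
    tauto
  | D n =>
    intro h
    refine Refl.IsSpecial.lo_val (hs.2 ?_)
    simp only [cutBead] at h
    tauto

/-- In type `C` the strand cut together with a special arc is decorated. -/
theorem CutData.mem_beaded_of_special {n : ℕ} {t : RawTangle (HermitianPair.C n).size}
    {r : Refl (HermitianPair.C n).size} {z : Vertex (HermitianPair.C n).size} (h : CutData t r z)
    (hb : IsBasisTangle (.C n) t) (hs : r.IsSpecial) : z ∈ t.beaded := by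
  by_contra hz
  have hm := h.isDecorated.1.1
  have hc := h.crossing.resolve_right hz
  have h0 := hs.lo_val
  rw [isBasisTangle_C_iff h0] at hb
  have hne := h.ne_lo
  rw [← CutData.mem_beaded_mate_iff h.isDecorated] at hz
  have hzz := (hm z).1
  have hnl := h.mate_ne_lo
  generalize t.mate z = y at *
  rcases y with i | i
  · have hi : i = r.lo := Fin.ext (by
      have : i.val ≤ r.lo.val := hc
      omega)
    subst hi
    rw [hzz] at hb
    tauto
  · refine hnl (congrArg Sum.inr (Fin.ext ?_))
    have : i.val ≤ r.lo.val := hc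
    omega

/-- In type `D` this is the parity of the bead count. In type `C` the strands at the two first
vertices are followed through the cut; `hcirc` excludes the case of a decorated first vertical
strand. -/
theorem CutData.isBasisTangle_cut (h : CutData t r z) (hb : IsBasisTangle X t)
    (hs : r.IsSpecial ↔ .inr r.lo ∈ t.beaded)
    (hcirc : X.HasCirc → ∀ o : Fin X.size, o.val = 0 →
      ¬ (t.mate (.inl o) = .inr o ∧ .inl o ∈ t.beaded)) :
    IsBasisTangle X (cut t r z (cutBead X t r z)) := by
  have hd := h.cut_isDecorated h.cutBead_imp
  have hm := h.isDecorated.1.1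
  cases X with
  | A n k =>
    refine ⟨hd, Set.eq_empty_of_forall_notMem fun v hv => ?_⟩
    rcases hv with ⟨hv, -⟩ | ⟨hv, -⟩
    · rw [hb.2] at hv
      exact hv
    · exact hv
  | C n =>
    have hN : 0 < (HermitianPair.C n).size := Nat.succ_pos n
    have hsp := h.mem_beaded_of_special hb
    obtain ⟨o, ho⟩ : ∃ o : Fin (HermitianPair.C n).size, o.val = 0 := ⟨⟨0, hN⟩, rfl⟩
    rw [isBasisTangle_C_iff ho] at hb ⊢
    have hcirc := hcirc trivial o ho
    refine ⟨hd, ?_⟩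
    have hzc := h.lo_lt_col
    have hzl : z ≠ .inl o := fun h' => by
      rw [h'] at hzc
      have : r.lo.val < o.val := hzc
      omega
    have hzr : z ≠ .inr o := fun h' => by
      rw [h'] at hzc
      have : r.lo.val < o.val := hzc
      omega
    have hhl : (.inl o : Vertex _) ≠ .inr r.hi := by simp
    have hhr : (.inr o : Vertex _) ≠ .inr r.hi := fun h' => by
      have := r.hi_val
      rw [← Sum.inr.inj h'] at this
      omega
    have hll : (.inl o : Vertex _) ≠ .inr r.lo := by simp
    have hyb := CutData.mem_beaded_mate_iff h.isDecorated z
    have hcut : (cut t r z (cutBead (.C n) t r z)).mate = cutMate t r z := rfl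
    rw [hcut]
    rcases hb.2 with hb | hb | hb
    -- An undecorated first vertical strand is not touched by the cut.
    · left
      have hor : (.inr o : Vertex _) ≠ .inr r.lo := fun h' => by
        have := h.mate_lo
        rw [← h', ← hb.1, (hm _).1] at this
        exact hhl this
      have hyl : .inl o ≠ t.mate z := fun h' => hzr (by rw [← (hm z).1, ← h', hb.1])
      rw [h.cutMate_of_ne hll hhl hyl hzl.symm, mem_cut_iff_of_ne hll hhl hyl hzl.symm]
      exact hb
    · exact absurd ⟨hb.1, hb.2.1⟩ hcirc
    -- Here the first vertices lie on two decorated strands. If the cut joins these vertices, the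
    -- bead is dropped; otherwise both strands keep theirs.
    · by_cases hyl : .inl o = t.mate z
      · have hzb : z ∈ t.beaded := by rw [← hyb, ← hyl]; exact hb.2.1
        by_cases hlo : r.lo.val = 0
        · left
          have hβ : ¬ cutBead (.C n) t r z := fun hβ => hβ.2 ⟨hlo, by rw [← hyl]; exact ho⟩
          have hlo' : r.lo = o := Fin.ext (by omega)
          rw [hyl, mate_mem_cut, cutMate_mate, hlo']
          exact ⟨rfl, hβ⟩
        · have hβ : cutBead (.C n) t r z := ⟨hzb, fun h' => hlo h'.1⟩
          have hor : (.inr o : Vertex _) ≠ .inr r.lo := fun h' => hlo (by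
            rw [← Sum.inr.inj h']; exact ho)
          have hyr : .inr o ≠ t.mate z := fun h' => by
            rw [← hyl] at h'
            cases h'
          right; right
          refine ⟨?_, ?_, ?_⟩
          · rw [hyl, cutMate_mate]
            exact hor.symm
          · rw [hyl, mate_mem_cut]; exact hβ
          · rw [mem_cut_iff_of_ne hor hhr hyr hzr.symm]; exact hb.2.2
      · right; right
        refine ⟨?_, ?_, ?_⟩
        · rw [h.cutMate_of_ne hll hhl hyl hzl.symm]; exact hb.1
        · rw [mem_cut_iff_of_ne hll hhl hyl hzl.symm]; exact hb.2.1
        · have hycol : ∀ j, t.mate z = .inl j → col (t.mate z) ≠ 0 := fun j hj h' => hyl (by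
            rw [hj] at h' ⊢
            have : j.val = 0 := h'
            exact congrArg Sum.inl (Fin.ext (by omega)))
          by_cases hor : (.inr o : Vertex _) = .inr r.lo
          · have hzb := hsp (hs.2 (by rw [← hor]; exact hb.2.2))
            rw [hor, lo_mem_cut]
            refine ⟨hzb, fun h' => ?_⟩
            rcases hj : t.mate z with j | j
            · exact hycol j hj h'.2
            · refine h.mate_ne_lo ?_
              rw [hj] at h' ⊢
              have : j.val = 0 := h'.2
              exact congrArg Sum.inr (Fin.ext (by omega))
          · by_cases hyr : .inr o = t.mate z
            · rw [hyr, mate_mem_cut]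
              refine ⟨by rw [← hyb, ← hyr]; exact hb.2.2, fun h' => hor ?_⟩
              exact congrArg Sum.inr (Fin.ext (by omega))
            · rw [mem_cut_iff_of_ne hor hhr hyr hzr.symm]; exact hb.2.2
  | D n =>
    refine ⟨hd, ?_⟩
    have h1 := h.ncard_cut h.cutBead_imp
    have h2 := hb.2
    rw [Nat.even_iff] at h2 ⊢
    by_cases ha : .inr r.lo ∈ t.beaded <;> by_cases hz : z ∈ t.beaded
    · have hβ : ¬ cutBead (.D n) t r z := fun h => h ⟨fun _ => ha, fun _ => hz⟩
      rw [if_pos ha, if_pos hz, if_neg hβ] at h1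
      omega
    · have hβ : cutBead (.D n) t r z := fun h => hz (h.2 ha)
      rw [if_pos ha, if_neg hz, if_pos hβ] at h1
      omega
    · have hβ : cutBead (.D n) t r z := fun h => ha (h.1 hz)
      rw [if_neg ha, if_pos hz, if_pos hβ] at h1
      omega
    · have hβ : ¬ cutBead (.D n) t r z := fun h =>
        h ⟨fun h => absurd h hz, fun h => absurd h ha⟩
      rw [if_neg ha, if_neg hz, if_neg hβ] at h1
      omega

end Cut

/-! ### The cut diagram is oriented and restores the original -/

section Cut

variable {X : HermitianPair} {t : RawTangle X.size} {r : Refl X.size} {z : Vertex X.size}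

theorem IsOriented.not_first_decorated {north south : PW X} (ho : IsOriented X north t south)
    (hX : X.HasCirc) (o : Fin X.size) (h0 : o.val = 0) :
    ¬ (t.mate (.inl o) = .inr o ∧ .inl o ∈ t.beaded) := by
  cases X with
  | A n k => exact hX.elim
  | C n =>
    rintro ⟨h1, h2⟩
    refine ho.2.2 _ h2 ⟨(label_eq_circ_iff _ _ _).2 ⟨hX, h0⟩, ?_⟩
    rw [h1]
    exact (label_eq_circ_iff _ _ _).2 ⟨hX, h0⟩
  | D n => exact hX.elim

/-- The neighbour `w` is chosen so that the strand from the right foot to `z` is oriented. The other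
new strand is then determined by the chain left foot, right foot, `z`, mate of `z`, and `cutBead`
records the type of orientation that results. -/
theorem CutData.isOriented_cut {north v w : PW X} (h : CutData t r z)
    (ho : IsOriented X north t v) (hs : r.IsSpecial ↔ .inr r.lo ∈ t.beaded) {hr : IsSimple X r}
    (he : IsEdge r hr w v)
    (hz : sgn (.inr r.hi) (w.1 r.hi) ≠ sgn z (label north.1 v.1 z)) :
    IsOriented X north (cut t r z (cutBead X t r z)) w := by
  have hm := h.isDecorated.1.1
  have hlab : ∀ u, u ≠ .inr r.lo → u ≠ .inr r.hi →
      label north.1 w.1 u = label north.1 v.1 u := by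
    rintro (i | i) h1 h2
    · rfl
    · exact isEdge_label_of_ne he.symm (by simpa using h1) (by simpa using h2)
  have hzc : label north.1 v.1 z ≠ .circ := fun hc => by
    have h1 := ((label_eq_circ_iff _ _ _).1 hc).2
    have h2 := h.lo_lt_col
    omega
  have hhc : label north.1 w.1 (.inr r.hi) ≠ .circ := w.hi_ne_circ r
  have hz' : label north.1 w.1 z = label north.1 v.1 z := hlab z h.ne_lo h.ne_hi
  have hy' : label north.1 w.1 (t.mate z) = label north.1 v.1 (t.mate z) :=
    hlab _ h.mate_ne_lo h.mate_ne_hi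
  have hmate : (cut t r z (cutBead X t r z)).mate = cutMate t r z := rfl
  have hbz : sgn (.inr r.hi) (label north.1 w.1 (.inr r.hi)) ≠ sgn z (label north.1 w.1 z) := by
    rw [hz']; exact hz
  -- The orientations of the strand joining the left end of the arc to the mate of `z`.
  have hedge : ∀ hc : label north.1 w.1 (.inr r.lo) ≠ .circ,
      sgn (.inr r.lo) (label north.1 w.1 (.inr r.lo)) =
        sgn (.inr r.hi) (label north.1 w.1 (.inr r.hi)) ↔ r.IsSpecial := fun hc => by
    rw [sgn_inr_eq_iff hc hhc]
    exact he.label_eq_iff hc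
  have hor : ∀ hy : label north.1 w.1 (t.mate z) ≠ .circ, z ∉ t.beaded →
      sgn z (label north.1 w.1 z) ≠ sgn (t.mate z) (label north.1 w.1 (t.mate z)) := by
    intro hy hb
    rw [hy'] at hy ⊢
    rw [hz']
    exact (oriented_iff hzc hy).1 (ho.2.1 z hb)
  have hflip : ¬ X.HasCirc → z ∈ t.beaded → label north.1 w.1 (t.mate z) ≠ .circ →
      sgn z (label north.1 w.1 z) = sgn (t.mate z) (label north.1 w.1 (t.mate z)) := by
    intro h1 h2 h3
    rw [hy'] at h3 ⊢
    rw [hz']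
    cases X with
    | A n k =>
      rw [ho.1.2] at h2
      exact h2.elim
    | C n => exact absurd trivial h1
    | D n => exact (flipOriented_iff hzc h3).1 (ho.2.2 z h2)
  have hβ : label north.1 w.1 (.inr r.lo) ≠ .circ → label north.1 w.1 (t.mate z) ≠ .circ →
      (¬ cutBead X t r z → sgn (.inr r.lo) (label north.1 w.1 (.inr r.lo)) ≠
        sgn (t.mate z) (label north.1 w.1 (t.mate z))) ∧
      (¬ X.HasCirc → cutBead X t r z → sgn (.inr r.lo) (label north.1 w.1 (.inr r.lo)) =
        sgn (t.mate z) (label north.1 w.1 (t.mate z))) := by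
    intro h1 h2
    have e1 := hedge h1
    have e2 := hor h2
    have e3 := fun hX hz => hflip hX hz h2
    generalize sgn (.inr r.lo) (label north.1 w.1 (.inr r.lo)) = sa at *
    generalize sgn (.inr r.hi) (label north.1 w.1 (.inr r.hi)) = sb at *
    generalize sgn z (label north.1 w.1 z) = sz at *
    generalize sgn (t.mate z) (label north.1 w.1 (t.mate z)) = sy at *
    -- The chain has three links; the middle one is always an inequality, the first is an equality
    -- exactly for special `r`, and the last depends on the bead at `z`.
    have b1 : ∀ a b c d : Bool, a ≠ b → b ≠ c → c ≠ d → a ≠ d := by decide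
    have b2 : ∀ a b c d : Bool, a ≠ b → b ≠ c → c = d → a = d := by decide
    have b3 : ∀ a b c d : Bool, a = b → b ≠ c → c ≠ d → a = d := by decide
    have b4 : ∀ a b c d : Bool, a = b → b ≠ c → c = d → a ≠ d := by decide
    cases X with
    | A n k =>
      have e6 : z ∉ t.beaded := by rw [ho.1.2]; exact fun h => h
      have e7 : ¬ r.IsSpecial := by rw [hs, ho.1.2]; exact fun h => h
      exact ⟨fun _ => b1 _ _ _ _ (fun h => e7 (e1.1 h)) hbz (e2 e6), fun _ h => h.elim⟩
    | C n =>
      have e6 : r.lo.val ≠ 0 := fun h0 => h1 ((label_eq_circ_iff _ _ _).2 ⟨trivial, h0⟩)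
      have e7 : ¬ r.IsSpecial := fun h => e6 h.lo_val
      exact ⟨fun hb => b1 _ _ _ _ (fun h => e7 (e1.1 h)) hbz
        (e2 fun hz => hb ⟨hz, fun h => e6 h.1⟩), fun h => absurd trivial h⟩
    | D n =>
      have e4 := e3 id
      rw [hs] at e1
      refine ⟨fun hb => ?_, fun _ hb => ?_⟩
      · have hb : z ∈ t.beaded ↔ .inr r.lo ∈ t.beaded := not_not.1 hb
        by_cases hz : z ∈ t.beaded
        · exact b4 _ _ _ _ (e1.2 (hb.1 hz)) hbz (e4 hz)
        · exact b1 _ _ _ _ (fun h => hz (hb.2 (e1.1 h))) hbz (e2 hz)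
      · have hb : ¬ (z ∈ t.beaded ↔ .inr r.lo ∈ t.beaded) := hb
        by_cases hz : z ∈ t.beaded
        · exact b2 _ _ _ _ (fun h => hb ⟨fun _ => e1.1 h, fun _ => hz⟩) hbz (e4 hz)
        · refine b3 _ _ _ _ (e1.2 ?_) hbz (e2 hz)
          by_contra ha
          exact hb ⟨fun h => absurd h hz, fun h => absurd h ha⟩
  refine ⟨h.isBasisTangle_cut ho.1 hs ho.not_first_decorated, ?_, ?_⟩
  · intro u hu
    rw [hmate]
    by_cases u1 : u = .inr r.lo
    · subst u1
      rw [cutMate_lo]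
      rw [lo_mem_cut] at hu
      by_cases c1 : label north.1 w.1 (.inr r.lo) = .circ
      · exact oriented_of_circ (Or.inl c1)
      by_cases c2 : label north.1 w.1 (t.mate z) = .circ
      · exact oriented_of_circ (Or.inr c2)
      exact (oriented_iff c1 c2).2 ((hβ c1 c2).1 hu)
    by_cases u2 : u = .inr r.hi
    · subst u2
      rw [h.cutMate_hi]
      exact (oriented_iff hhc (hz' ▸ hzc)).2 hbz
    by_cases u3 : u = t.mate z
    · subst u3
      rw [cutMate_mate]
      rw [mate_mem_cut] at hu
      by_cases c1 : label north.1 w.1 (.inr r.lo) = .circ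
      · exact oriented_of_circ (Or.inr c1)
      by_cases c2 : label north.1 w.1 (t.mate z) = .circ
      · exact oriented_of_circ (Or.inl c2)
      exact (oriented_iff c2 c1).2 ((hβ c1 c2).1 hu).symm
    by_cases u4 : u = z
    · rw [u4, h.cutMate_self]
      exact (oriented_iff (hz' ▸ hzc) hhc).2 hbz.symm
    rw [h.cutMate_of_ne u1 u2 u3 u4]
    rw [mem_cut_iff_of_ne u1 u2 u3 u4] at hu
    obtain ⟨m1, m2, -, -⟩ := h.mate_ne_of_ne u1 u2 u3 u4
    rw [hlab u u1 u2, hlab _ m1 m2]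
    exact ho.2.1 u hu
  · cases X with
    | A n k => trivial
    | C n =>
      intro u hu
      rw [hmate]
      have hcc : cutBead (.C n) t r z → ¬ (label north.1 w.1 (.inr r.lo) = .circ ∧
          label north.1 w.1 (t.mate z) = .circ) := by
        rintro hb ⟨h1, h2⟩
        rw [label_eq_circ_iff] at h1 h2
        exact hb.2 ⟨h1.2, h2.2⟩
      rcases hu with ⟨hu, u1, u2, u3, u4⟩ | ⟨hb, rfl | rfl⟩
      · rw [h.cutMate_of_ne u1 u2 u3 u4]
        obtain ⟨m1, m2, -, -⟩ := h.mate_ne_of_ne u1 u2 u3 u4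
        rw [hlab u u1 u2, hlab _ m1 m2]
        exact ho.2.2 u hu
      · rw [cutMate_lo]
        exact hcc hb
      · rw [cutMate_mate, and_comm]
        exact hcc hb
    | D n =>
      intro u hu
      rw [hmate]
      have hnc : ∀ u, label north.1 w.1 u ≠ .circ := fun u hc =>
        ((label_eq_circ_iff _ _ _).1 hc).1
      have hX : ¬ (HermitianPair.D n).HasCirc := fun h => h
      rcases hu with ⟨hu, u1, u2, u3, u4⟩ | ⟨hb, rfl | rfl⟩
      · rw [h.cutMate_of_ne u1 u2 u3 u4]
        obtain ⟨m1, m2, -, -⟩ := h.mate_ne_of_ne u1 u2 u3 u4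
        rw [hlab u u1 u2, hlab _ m1 m2]
        exact ho.2.2 u hu
      · rw [cutMate_lo, flipOriented_iff (hnc _) (hnc _)]
        exact (hβ (hnc _) (hnc _)).2 hX hb
      · rw [cutMate_mate, flipOriented_iff (hnc _) (hnc _)]
        exact ((hβ (hnc _) (hnc _)).2 hX hb).symm

theorem CutData.concatMate_cut (h : CutData t r z) :
    concatMate (cut t r z (cutBead X t r z)) (RawTangle.e r) = t.mate := by
  funext u
  have ht : (cut t r z (cutBead X t r z)).IsTangle := h.cutMate_isTangle _
  rw [concatMate_e ht]
  have h1 := splice_splice (a := .inr r.lo) (b := t.mate z) h.isDecorated.1.1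
    (by rw [h.mate_lo]; exact h.mate_ne_hi.symm)
  rw [h.mate_lo] at h1
  exact congrFun h1 u

open Classical in
theorem CutData.beadCount_cut (h : CutData t r z) (u : Vertex X.size) :
    beadCount (cut t r z (cutBead X t r z)) (RawTangle.e r) u =
      if u = .inr r.lo ∨ u = .inr r.hi then (if r.IsSpecial then 1 else 0)
      else if u = t.mate z ∨ u = z then
        (if cutBead X t r z then 1 else 0) + (if r.IsSpecial then 1 else 0)
      else if u ∈ t.beaded then 1 else 0 := by
  have e1 : (cut t r z (cutBead X t r z)).mate (.inr r.lo) = t.mate z := cutMate_lo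
  have e2 : (cut t r z (cutBead X t r z)).mate (.inr r.hi) = z := h.cutMate_hi
  rw [beadCount_e (h.cut_isDecorated h.cutBead_imp) (by rw [e1]; exact h.mate_ne_hi)
    h.hi_notMem_cut, e1, e2, lo_mem_cut]
  by_cases h1 : u = .inr r.lo ∨ u = .inr r.hi
  · rw [if_pos h1, if_pos h1]
  by_cases h2 : u = t.mate z ∨ u = z
  · rw [if_neg h1, if_neg h1, if_pos h2, if_pos h2]
  rw [if_neg h1, if_neg h1, if_neg h2, if_neg h2]
  rw [not_or] at h1 h2
  rw [mem_cut_iff_of_ne h1.1 h1.2 h2.1 h2.2]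

/-- In type `C` the bead at `z` is recovered either from the cut strand or from the generator. When
`cutBead` drops it, both ends are in the first column, so the southern arc there must be decorated
and `r` is special. -/
theorem CutData.mem_beaded_iff_C {n : ℕ} {t : RawTangle (HermitianPair.C n).size}
    {r : Refl (HermitianPair.C n).size} {z : Vertex (HermitianPair.C n).size} (h : CutData t r z)
    (hb : IsBasisTangle (.C n) t) (hs : r.IsSpecial ↔ .inr r.lo ∈ t.beaded) :
    z ∈ t.beaded ↔ cutBead (.C n) t r z ∨ r.IsSpecial := by
  have hm := h.isDecorated.1.1
  refine ⟨fun hz => ?_, fun hz => hz.elim (fun h => h.1) (h.mem_beaded_of_special hb)⟩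
  by_contra! hc
  refine hc.2 ?_
  have hlo : r.lo.val = 0 ∧ col (t.mate z) = 0 := by
    by_contra hlo
    exact hc.1 ⟨hz, hlo⟩
  rw [isBasisTangle_C_iff hlo.1] at hb
  have hlt := h.mate_lo
  rw [hs]
  rcases hb.2 with hb | hb | hb
  · have := (hm (.inl r.lo)).1
    rw [hb.1, hlt] at this
    cases this
  · have := (hm (.inl r.lo)).1
    rw [hb.1, hlt] at this
    cases this
  · exact hb.2.2

/-- The definition of `cutBead` is made for this: together with the beads of `e_r` the strand at `z`
gets back its decoration, under idempotent beads in type `C` and cancelling beads in type `D`. -/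
theorem CutData.concat_cut {north v : PW X} (h : CutData t r z)
    (ho : IsOriented X north t v) (hs : r.IsSpecial ↔ .inr r.lo ∈ t.beaded) (D E : ODT X)
    (hD : D.tangle = cut t r z (cutBead X t r z)) (hE : E.tangle = RawTangle.e r)
    (hn : D.north = north) (hv : E.south = v) : concat D E = t := by
  have h1 : (concat D E).mate = t.mate := by
    change concatMate _ _ = _
    rw [hD, hE, h.concatMate_cut]
  have hcount := h.beadCount_cut
  have hm := h.isDecorated.1.1
  have h4 : (.inr r.hi : Vertex X.size) ∈ t.beaded ↔ .inr r.lo ∈ t.beaded := by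
    rw [← h.mate_lo, CutData.mem_beaded_mate_iff h.isDecorated]
  have h5 := CutData.mem_beaded_mate_iff h.isDecorated z
  have hQ : ∀ u, (u = .inr r.lo ∨ u = .inr r.hi) ∧ (u ∈ t.beaded ↔ r.IsSpecial) ∨
      ¬ (u = .inr r.lo ∨ u = .inr r.hi) ∧ ((u = t.mate z ∨ u = z) ∧
        (u ∈ t.beaded ↔ z ∈ t.beaded) ∨ ¬ (u = t.mate z ∨ u = z)) := by
    intro u
    by_cases c1 : u = .inr r.lo ∨ u = .inr r.hi
    · refine Or.inl ⟨c1, ?_⟩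
      rcases c1 with rfl | rfl
      · exact hs.symm
      · rw [h4, hs]
    · refine Or.inr ⟨c1, ?_⟩
      by_cases c2 : u = t.mate z ∨ u = z
      · refine Or.inl ⟨c2, ?_⟩
        rcases c2 with rfl | rfl
        · exact h5
        · rfl
      · exact Or.inr c2
  have h2 : (concat D E).beaded = t.beaded := by
    change concatBeaded _ _ _ _ = _
    rw [hD, hE, hn, hv]
    cases X with
    | A n k => exact ho.1.2.symm
    | C n =>
      ext u
      have hzc : ¬ label north.1 v.1 z = .circ := fun hc => by
        have h1 := ((label_eq_circ_iff _ _ _).1 hc).2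
        have h2 := h.lo_lt_col
        omega
      have hhc : ¬ label north.1 v.1 (.inr r.hi) = .circ := v.hi_ne_circ r
      change (0 < beadCount _ _ u ∧
        ¬ (label north.1 v.1 u = _ ∧ label north.1 v.1 (concatMate _ _ u) = _)) ↔ _
      rw [hcount, h.concatMate_cut]
      rcases hQ u with ⟨c1, c2⟩ | ⟨c1, ⟨c2, c3⟩ | c2⟩
      · have hdec : ¬ (label north.1 v.1 u = .circ ∧ label north.1 v.1 (t.mate u) = .circ) := by
          rcases c1 with rfl | rfl
          · rw [h.mate_lo]; exact fun h => hhc h.2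
          · exact fun h => hhc h.1
        rw [if_pos c1, c2]
        by_cases hsp : r.IsSpecial <;> simp [hsp]
        exact fun h1 h2 => hdec ⟨h1, h2⟩
      · have hdec : ¬ (label north.1 v.1 u = .circ ∧ label north.1 v.1 (t.mate u) = .circ) := by
          rcases c2 with rfl | rfl
          · rw [(hm z).1]; exact fun h => hzc h.2
          · exact fun h => hzc h.1
        rw [if_neg c1, if_pos c2, c3, h.mem_beaded_iff_C ho.1 hs]
        by_cases hsp : r.IsSpecial <;> by_cases hb : cutBead (.C n) t r z <;> simp [hsp, hb] <;>
          exact fun h1 h2 => hdec ⟨h1, h2⟩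
      · rw [if_neg c1, if_neg c2]
        by_cases hu : u ∈ t.beaded
        · simp only [hu, if_true, zero_lt_one, true_and, iff_true]
          exact ho.2.2 u hu
        · simp [hu]
    | D n =>
      ext u
      change Odd (beadCount _ _ u) ↔ _
      rw [hcount]
      rcases hQ u with ⟨c1, c2⟩ | ⟨c1, ⟨c2, c3⟩ | c2⟩
      · rw [if_pos c1, c2]
        by_cases hsp : r.IsSpecial <;> simp [hsp]
      · rw [if_neg c1, if_pos c2, c3]
        have hb : cutBead (.D n) t r z ↔ ¬ (z ∈ t.beaded ↔ r.IsSpecial) := by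
          rw [hs]
          rfl
        by_cases hsp : r.IsSpecial <;> by_cases hz : z ∈ t.beaded <;> simp [hsp, hz, hb]
      · rw [if_neg c1, if_neg c2]
        by_cases hu : u ∈ t.beaded <;> simp [hu]
  calc concat D E = ⟨(concat D E).mate, (concat D E).beaded⟩ := rfl
    _ = ⟨t.mate, t.beaded⟩ := by rw [h1, h2]
    _ = t := rfl

end Cut

/-- The simple reflection of a leftmost southern arc. -/
theorem IsOriented.exists_reflection {X : HermitianPair} {north south : PW X}
    {t : RawTangle X.size} (ho : IsOriented X north t south) {k l : Fin X.size}
    (hl : l.val = k.val + 1) (hkl : t.mate (.inr k) = .inr l)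
    (hk : .inr k ∈ t.beaded → k.val = 0) :
    ∃ r : Refl X.size, IsSimple X r ∧ r.lo = k ∧ r.hi = l ∧
      (r.IsSpecial ↔ .inr r.lo ∈ t.beaded) := by
  have hlt := l.2
  have hm := ho.1.isDecorated.1.1
  by_cases hb : .inr k ∈ t.beaded
  · have h0 := hk hb
    have hlo : (Refl.special (N := X.size) (by omega)).lo = k := Fin.ext h0.symm
    refine ⟨.special (by omega), ?_, hlo, ?_, ?_⟩
    · cases X with
      | A n k =>
        rw [ho.1.2] at hb
        exact hb
      | C n => trivial
      | D n => trivial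
    · exact Fin.ext (by simp only [Refl.hi]; omega)
    · rw [hlo]
      exact ⟨fun _ => hb, fun _ => trivial⟩
  · refine ⟨.s k.val (by omega), ?_, rfl, ?_, ?_⟩
    · cases X with
      | A n k => trivial
      | C n =>
        change 1 ≤ k.val
        by_contra h0
        have hb' := ho.1
        rw [isBasisTangle_C_iff (o := k) (by omega)] at hb'
        have h1 := (hm (.inl k)).1
        rcases hb'.2 with h | h | h
        · rw [h.1, hkl] at h1
          cases h1
        · rw [h.1, hkl] at h1
          cases h1
        · exact hb h.2.2
      | D n => trivial
    · exact Fin.ext (by simp only [Refl.hi]; omega)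
    · exact ⟨fun h => h.elim, fun h => absurd h hb⟩

/-- The reflection of a southern arc moves the southern boundary labels. -/
theorem IsOriented.act_ne {X : HermitianPair} {north south : PW X} {t : RawTangle X.size}
    (ho : IsOriented X north t south) {r : Refl X.size} (hr : IsSimple X r)
    (hm : t.mate (.inr r.lo) = .inr r.hi) (hs : r.IsSpecial ↔ .inr r.lo ∈ t.beaded) :
    act X r south.1 ≠ south.1 := by
  rw [act_ne_iff]
  have hhi := south.hi_ne_circ r
  have h1 := ho.2.1 (.inr r.lo)
  rw [hm] at h1
  rcases r with ⟨i, hi⟩ | hi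
  · have hlo := south.lo_ne_circ hr
    have h2 := (oriented_iff hlo hhi).1 (h1 (fun h => hs.2 h))
    rw [act_s_lo]
    exact Or.inl fun h => h2 ((sgn_inr_eq_iff hlo hhi).2 h.symm)
  · cases X with
    | A n k => exact absurd hr (by simp [IsSimple])
    | C n =>
      rw [act_special_hi_C]
      right
      generalize south.1 (Refl.hi (.special hi)) = x at *
      cases x <;> simp_all [Label.flip]
    | D n =>
      have hlo : south.1 (Refl.lo (.special hi)) ≠ .circ := by
        rw [Ne, PW.eq_circ_iff]; simp [HermitianPair.HasCirc]
      have h2 := ho.2.2 _ (hs.1 trivial)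
      rw [hm] at h2
      have h3 := (sgn_inr_eq_iff hlo hhi).1 ((flipOriented_iff hlo hhi).1 h2)
      left
      intro h
      rw [act_special_lo_D, h3] at h
      clear h3 h2 h1
      generalize south.1 (Refl.hi (.special hi)) = x at h hhi
      cases x <;> simp_all [Label.flip]

/-- A diagram without southern arcs is an idempotent. -/
theorem ODT.eq_one_of_no_arc {X : HermitianPair} (D : ODT X)
    (h : ¬ ∃ i j, D.tangle.mate (.inr i) = .inr j) :
    D.tangle = RawTangle.one X.size ∧ D.south = D.north := by
  have hswap := mate_eq_swap D.isTangle h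
  have hinl : ∀ i, D.tangle.mate (.inl i) = .inr i := fun i => by rw [hswap]; rfl
  have hinr : ∀ i, D.tangle.mate (.inr i) = .inl i := fun i => by rw [hswap]; rfl
  have hdec := D.isOriented.1.isDecorated
  have hcirc := fun hX o h0 => D.isOriented.not_first_decorated hX o h0
  -- Among vertical strands only the first is exposed, so there is at most one bead. The `∘`–`∘`
  -- condition in type `C` and evenness in type `D` exclude it.
  have hzero : ∀ i, .inl i ∈ D.tangle.beaded → i.val = 0 := by
    intro i hi
    by_contra h0
    refine hdec.2.2 _ hi ⟨.inl ⟨0, i.pos⟩, ?_⟩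
    rw [hinl, hinl]
    exact ⟨pos_inl_lt_inl.2 (Nat.pos_of_ne_zero h0), pos_inl_lt_inr, pos_inl_lt_inr,
      pos_inr_lt_inr.2 (Nat.pos_of_ne_zero h0)⟩
  have hb : ∀ i, .inl i ∉ D.tangle.beaded := by
    intro i hi
    have h0 := hzero i hi
    have hbasis := D.isOriented.1
    obtain ⟨north, t, south, ho⟩ := D
    cases X with
    | A n k =>
      have := hbasis.2
      rw [this] at hi
      exact hi
    | C n => exact hcirc trivial i h0 ⟨hinl i, hi⟩
    | D n =>
      have heven := hbasis.2
      have : t.beaded ∩ t.strands = {.inl i} := by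
        ext v
        simp only [Set.mem_inter_iff, Set.mem_singleton_iff]
        constructor
        · rintro ⟨h1, h2⟩
          rcases v with j | j
          · rw [Fin.ext ((hzero j h1).trans h0.symm)]
          · change pos _ < pos (t.mate _) at h2
            rw [hinr] at h2
            exact absurd h2 not_pos_inr_lt_inl
        · rintro rfl
          refine ⟨hi, ?_⟩
          change pos _ < pos (t.mate _)
          rw [hinl]
          exact pos_inl_lt_inr
      rw [this, Set.ncard_singleton] at heven
      exact absurd heven (by decide)
  have hempty : D.tangle.beaded = ∅ := by
    refine Set.eq_empty_of_forall_notMem fun v hv => ?_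
    rcases v with i | i
    · exact hb i hv
    · refine hb i ?_
      rw [← hinr]
      exact hdec.2.1 _ hv
  refine ⟨?_, Subtype.ext (funext fun i => ?_)⟩
  · calc D.tangle = ⟨D.tangle.mate, D.tangle.beaded⟩ := rfl
      _ = RawTangle.one X.size := by rw [hswap, hempty]; rfl
  · have h1 := D.isOriented.2.1 (.inr i) (by rw [hempty]; exact fun h => h)
    rw [hinr] at h1
    by_cases hc : D.south.1 i = .circ
    · rw [hc]
      exact ((D.north.eq_circ_iff i).2 ((D.south.eq_circ_iff i).1 hc)).symm
    · exact oriented_inl_inr h1 hc fun h =>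
        hc ((D.south.eq_circ_iff i).2 ((D.north.eq_circ_iff i).1 h))

theorem elt_of_isOriented {X : HermitianPair} (D : ODT X) :
    elt D.north D.tangle D.south = D.toTL := by
  rw [elt, dif_pos D.isOriented]

/-- Every oriented Temperley--Lieb diagram is a product of generators. -/
theorem ODT.exists_stroll {X : HermitianPair} (D : ODT X) :
    ∃ S : Stroll X D.north D.south, S.elt = D.toTL := by
  induction hd : (weight D.tangle).toNat using Nat.strong_induction_on generalizing D with
  | _ d ih =>
    by_cases harc : ∃ i j, D.tangle.mate (.inr i) = .inr j
    · obtain ⟨k, l, hl, hkl, hk⟩ := exists_leftmost_arc D.isOriented.1.isDecorated harc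
      obtain ⟨r, hr, rfl, rfl, hs⟩ := D.isOriented.exists_reflection hl hkl hk
      obtain ⟨z, hz⟩ := exists_cutData D.isOriented.1.isDecorated hkl
      -- The reflection flips the symbol at the right foot, so one of the two end points of the edge
      -- gives the sign opposite to that at `z`.
      obtain ⟨w, he, hw⟩ := exists_isEdge hr D.south (D.isOriented.act_ne hr hkl hs)
        (sgn z (label D.north.1 D.south.1 z))
      have hcut := hz.isOriented_cut D.isOriented hs he hw
      have hlt := hz.weight_cut_lt (hz.cutBead_lo D.isOriented.1 hs)
      have hnn := weight_nonneg (cut D.tangle r z (cutBead X D.tangle r z))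
      obtain ⟨S, hS⟩ := ih (weight (cut D.tangle r z (cutBead X D.tangle r z))).toNat (by omega)
        ⟨D.north, _, w, hcut⟩ rfl
      refine ⟨S.snoc r hr he, ?_⟩
      have hconcat := hz.concat_cut D.isOriented hs ⟨D.north, _, w, hcut⟩
        ⟨w, _, D.south, isOriented_e he⟩ rfl rfl rfl rfl
      have hgen : elt w (RawTangle.e r) D.south =
        (⟨w, _, D.south, isOriented_e he⟩ : ODT X).toTL := elt_of_isOriented ⟨w, _, D.south, _⟩
      -- No loop closes, because in the cut tangle the left foot is joined to the mate of `z`; hence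
      -- no power of `q` appears.
      have hexp : totalLoopExponent (cut D.tangle r z (cutBead X D.tangle r z)) (RawTangle.e r) w.1
          = 0 := by
        have htangle : (cut D.tangle r z (cutBead X D.tangle r z)).IsTangle :=
          hz.cutMate_isTangle _
        rw [totalLoopExponent_e htangle]
        refine if_neg ?_
        change cutMate _ _ _ _ ≠ _
        rw [CutData.cutMate_lo]
        exact hz.mate_ne_hi
      have hmul := smul_toTL_mul_toTL 1 (⟨D.north, _, w, hcut⟩ : ODT X)
        ⟨w, _, D.south, isOriented_e he⟩
      rw [one_smul, one_smul, mulBasis, if_pos rfl, hconcat, hexp, T_zero, one_smul] at hmul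
      simp only [Stroll.elt]
      rw [hS, hgen]
      exact hmul.trans (elt_of_isOriented D)
    · obtain ⟨h1, h2⟩ := D.eq_one_of_no_arc harc
      obtain ⟨north, t, south, ho⟩ := D
      simp only at h1 h2
      subst h1 h2
      refine ⟨.nil _, ?_⟩
      simp only [Stroll.elt]
      exact elt_of_isOriented ⟨_, _, _, ho⟩

/-! ### Comparison of the two degrees -/

theorem Stroll.deg_eq_strandDegreeSum {X : HermitianPair} {u v : PW X} {S : Stroll X u v}
    {D : ODT X} (h : S.elt = D.toTL) : S.deg = D.strandDegreeSum := by
  refine eq_strandDegreeSum_of_mem_homogeneous (AddSubgroup.subset_closure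
    ⟨u, v, S, 0, zero_add _, ?_⟩)
  rw [T_zero, one_smul, h]

theorem IsDegreeGrading.elt_mem {X : HermitianPair} {𝒜 : ℤ → AddSubgroup (TL X)}
    (h : IsDegreeGrading X 𝒜) {u v : PW X} (S : Stroll X u v) : S.elt ∈ 𝒜 S.deg := by
  induction S with
  | nil =>
    simp only [Stroll.elt, Stroll.deg]
    exact h.idempotent_mem u
  | snoc S r hr he ih =>
    simp only [Stroll.elt, Stroll.deg]
    exact h.mul_mem ih (h.generator_mem r hr _ _ he)

theorem toTL_ne_zero {X : HermitianPair} (D : ODT X) : D.toTL ≠ 0 := by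
  intro h
  have h1 : (Finsupp.single D 1 : ODT X →₀ ℤ[T;T⁻¹]) = 0 := h
  exact one_ne_zero (Finsupp.single_eq_zero.1 h1)

end OrientedTL

/-- The degree of an oriented Temperley--Lieb diagram is the sum of the degrees of its strands. -/
theorem mainTheorem4 (X : OrientedTL.HermitianPair) (hX : X.Valid) (D : OrientedTL.ODT X) (n : ℤ) :
    (D.toTL ∈ OrientedTL.homogeneous X n ↔ n = D.strandDegreeSum) ∧
    ∀ 𝒜 : ℤ → AddSubgroup (OrientedTL.TL X), OrientedTL.IsDegreeGrading X 𝒜 →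
      (D.toTL ∈ 𝒜 n ↔ n = D.strandDegreeSum) := by
  obtain ⟨S, hS⟩ := D.exists_stroll
  have hdeg := OrientedTL.Stroll.deg_eq_strandDegreeSum hS
  refine ⟨⟨OrientedTL.eq_strandDegreeSum_of_mem_homogeneous, ?_⟩, fun 𝒜 h𝒜 => ?_⟩
  · rintro rfl
    refine AddSubgroup.subset_closure ⟨_, _, S, 0, (zero_add _).trans hdeg, ?_⟩
    rw [LaurentPolynomial.T_zero, one_smul, hS]
  · have hmem : D.toTL ∈ 𝒜 D.strandDegreeSum := by
      rw [← hS, ← hdeg]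
      exact h𝒜.elt_mem S
    refine ⟨fun h => ?_, fun h => h ▸ hmem⟩
    -- Distinct components of an internal grading meet only in zero, and a basis element is nonzero.
    by_contra hne
    exact OrientedTL.toTL_ne_zero D (AddSubgroup.disjoint_def.1
      (h𝒜.isInternal.addSubgroup_iSupIndep.pairwiseDisjoint hne) h hmem)
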